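/- Let $\alpha_1>\alpha_2>\alpha_3$ and $\beta_1>\beta_2>\beta_3$ be real numbers with $\alpha_1+\alpha_2+\alpha_3=\beta_1+\beta_2+\beta_3=0$. For a $3\times 3$ real matrix $\mathcal R$ put $C(\mathcal R)=\operatorname{diag}(\alpha)+\mathcal R\operatorname{diag}(\beta)\mathcal R^T$, and let $P(\mathcal R)$, $Q(\mathcal R)$ be the coefficients of $z^1$ and $z^0$ in $\det(z-C(\mathcal R))$. For $\mathcal R\in SO(3)$, $\det(z-C(\mathcal R))=z^3+P(\mathcal R)z+Q(\mathcal R)$; let $\gamma_1\ge\gamma_2\ge\gamma_3=-\gamma_1-\gamma_2$ be the eigenvalues of $C(\mathcal R)$. In Euler angles $\mathcal R=\mathcal R_z(\varphi)\mathcal R_y(\theta)\mathcal R_z(\psi)$, and with $c=\cos\theta$, $u=\cos^2\varphi$, $v=\cos^2\psi$, $s=\cos\varphi\cos\psi\sin\varphi\sin\psi$, the differences $P(\mathcal R)-p$ and $Q(\mathcal R)-q$ are values of polynomials $P_p(c)$ and $Q_q(c)$ of degree at most $2$ in $c$, whose coefficients of $c^2$ and $c^0$ are polynomials in $u,v$ and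 whose coefficients of $c$ are constant multiples of $s$. The resultant of $P_p$ and $Q_q$ in $c$ (both taken with formal degree $2$) is a polynomial $R(u,v)=R_{p,q}(u,v)$, since $s^2=u(1-u)v(1-v)$. Let $$\tilde B(u,v)=2(\alpha_1-\alpha_2)(\beta_1-\beta_2)\big[(2\alpha_1+\alpha_2)(\alpha_1+2\alpha_2)\big((\beta_1-\beta_2)v+\beta_1+2\beta_2\big)+(2\beta_1+\beta_2)(\beta_1+2\beta_2)\big((\alpha_1-\alpha_2)u+\alpha_1+2\alpha_2\big)\big].$$ If the leading coefficient $a$ of $Q_q$ is non-zero and its discriminant $\Delta_Q$ is $\ge 0$, then at the roots $c_{1,2}$ of $Q_q$ (with $+\sqrt{\Delta_Q}$ and $-\sqrt{\Delta_Q}$ respectively) one has $P_p(c_{1,2})=A\pm B\sqrt{\Delta_Q}$ for some real $A$, with $2a^2B=s\,\tilde B(u,v)$. Let $\mathcal R$ be distributed according to the normalized Haar measure on $SO(3)$, and let $S\subset\mathbb R^2$ be the set of values of $(P,Q)$ on $SO(3)$. Then $(P,Q)$ has a joint density $\rho$ with respect to Lebesgue measure; $\rho=0$ almost everywhere outside $S$,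 and for almost every $(p,q)\in S$ $$\rho(p,q)=\frac1{2\pi^2}\int_0^1 dv\int_0^1 du\,|\tilde B(u,v)|\,\delta(R(u,v))=\frac1{2\pi^2}\int_0^1 dv\sum_i\frac{|\tilde B(u_i,v)|}{|R'_u(u_i,v)|},$$ where $u_i=u_i(v)$ runs over the distinct roots of $u\mapsto R(u,v)$ in $[0,1]$, and the integral with $\delta(R)$ means the limit, as $\varepsilon\to0^+$, of the integrals with $\varepsilon^{-1}\eta(R/\varepsilon)$ in place of $\delta(R)$, this limit existing and being the same for every continuous compactly supported $\eta:\mathbb R\to\mathbb R$ with $\int\eta=1$. Finally, $(\gamma_1,\gamma_2)$ has a density with respect to Lebesgue measure; for almost every $(\gamma_1,\gamma_2)$ it equals, with $\gamma_3=-\gamma_1-\gamma_2$, $$|\Delta(\gamma)|\,\rho(\gamma_1\gamma_2+\gamma_2\gamma_3+\gamma_3\gamma_1,\,-\gamma_1\gamma_2\gamma_3),\qquad \Delta(\gamma)=(\gamma_1-\gamma_2)(\gamma_1-\gamma_3)(\gamma_2-\gamma_3),$$ if $\gamma_1\ge\gamma_2\ge\gamma_3$, and $0$ otherwise. -/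

import Mathlib

open MeasureTheory Set Filter Topology Polynomial

namespace HornReal

/-- The rotation group `SO(3)`. -/
abbrev SO3 := Matrix.specialOrthogonalGroup (Fin 3) ℝ

noncomputable section

/-- The matrix `C = diag(α) + M diag(β) Mᵀ`. -/
def sumMatrix (α β : Fin 3 → ℝ) (M : Matrix (Fin 3) (Fin 3) ℝ) : Matrix (Fin 3) (Fin 3) ℝ :=
  Matrix.diagonal α + M * Matrix.diagonal β * M.transpose

/-- The coefficient `P` of `z` in `det (z - C)`. -/
def coeffP (α β : Fin 3 → ℝ) (M : Matrix (Fin 3) (Fin 3) ℝ) : ℝ :=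
  (sumMatrix α β M).charpoly.coeff 1

/-- The constant coefficient `Q` of `det (z - C)`. -/
def coeffQ (α β : Fin 3 → ℝ) (M : Matrix (Fin 3) (Fin 3) ℝ) : ℝ :=
  (sumMatrix α β M).charpoly.coeff 0

/-- The random pair `(P, Q)` as a function of the rotation. -/
def PQ (α β : Fin 3 → ℝ) (M : SO3) : ℝ × ℝ := (coeffP α β M.1, coeffQ α β M.1)

theorem sumMatrix_isHermitian (α β : Fin 3 → ℝ) (M : Matrix (Fin 3) (Fin 3) ℝ) :
    (sumMatrix α β M).IsHermitian := by
  simp only [Matrix.IsHermitian, sumMatrix, Matrix.conjTranspose_eq_transpose_of_trivial,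
    Matrix.transpose_add, Matrix.transpose_mul, Matrix.transpose_transpose,
    Matrix.diagonal_transpose, Matrix.mul_assoc]

/-- The two largest eigenvalues `(γ₁, γ₂)`, `γ₁ ≥ γ₂ ≥ γ₃`, of `C`
(`eigenvalues₀` lists the eigenvalues with multiplicity in decreasing order). -/
def topEigenvalues (α β : Fin 3 → ℝ) (M : SO3) : ℝ × ℝ :=
  ((sumMatrix_isHermitian α β M.1).eigenvalues₀ ⟨0, by simp⟩,
    (sumMatrix_isHermitian α β M.1).eigenvalues₀ ⟨1, by simp⟩)

/-- Rotation by the angle `t` about the third axis. -/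
def rotZ (t : ℝ) : Matrix (Fin 3) (Fin 3) ℝ :=
  !![Real.cos t, -Real.sin t, 0; Real.sin t, Real.cos t, 0; 0, 0, 1]

/-- Rotation by the angle `t` about the second axis. -/
def rotY (t : ℝ) : Matrix (Fin 3) (Fin 3) ℝ :=
  !![Real.cos t, 0, Real.sin t; 0, 1, 0; -Real.sin t, 0, Real.cos t]

/-- `cos φ cos ψ sin φ sin ψ`. -/
def trigFactor (φ ψ : ℝ) : ℝ := Real.cos φ * Real.cos ψ * Real.sin φ * Real.sin ψ

/-- Coefficient of `c²` in `P_p(c)`. -/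
def aP (α β : Fin 3 → ℝ) (u z : ℝ) : ℝ :=
  -((α 0 + 2 * α 1 + α 0 * u - α 1 * u) * (β 0 + 2 * β 1 + β 0 * z - β 1 * z))

/-- The coefficient of `c` in `P_p(c)` is `trigFactor φ ψ * bP α β`. -/
def bP (α β : Fin 3 → ℝ) : ℝ := 2 * (α 0 - α 1) * (β 0 - β 1)

/-- Constant coefficient of `P_p(c)`. -/
def eP (α β : Fin 3 → ℝ) (p u z : ℝ) : ℝ :=
  -(α 0) ^ 2 - α 0 * α 1 - (α 1) ^ 2 - (β 0) ^ 2 - β 0 * β 1 - (β 1) ^ 2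
    + α 0 * (β 1 - β 0) + α 1 * (β 0 + 2 * β 1)
    + u * (α 0 - α 1) * (β 1 + 2 * β 0) + z * (α 1 + 2 * α 0) * (β 0 - β 1)
    - u * z * (α 0 - α 1) * (β 0 - β 1) - p

/-- Coefficient of `c²` in `Q_q(c)`. -/
def aQ (α β : Fin 3 → ℝ) (u z : ℝ) : ℝ :=
  (α 0 + 2 * α 1) * (α 0 + β 0) * (β 0 + 2 * β 1)
    - (α 0 - α 1) * (α 0 + α 1 - β 0) * (β 0 + 2 * β 1) * u
    + (α 0 + 2 * α 1) * (α 0 - β 0 - β 1) * (β 0 - β 1) * z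
    - (α 0 - α 1) * (β 0 - β 1) * (α 0 + α 1 + β 0 + β 1) * u * z

/-- The coefficient of `c` in `Q_q(c)` is `trigFactor φ ψ * bQ α β`. -/
def bQ (α β : Fin 3 → ℝ) : ℝ :=
  2 * (α 0 - α 1) * (β 0 - β 1) * (α 0 + α 1 + β 0 + β 1)

/-- Constant coefficient of `Q_q(c)`. -/
def eQ (α β : Fin 3 → ℝ) (q u z : ℝ) : ℝ :=
  (α 0 + β 0) * (α 0 + α 1 - β 1) * (α 1 - β 0 - β 1)
    + (α 0 - α 1) * (α 0 + α 1 - β 1) * (2 * β 0 + β 1) * u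
    - (2 * α 0 + α 1) * (α 1 - β 0 - β 1) * (β 0 - β 1) * z
    - (α 0 - α 1) * (β 0 - β 1) * (α 0 + α 1 + β 0 + β 1) * u * z - q

/-- The quadratic `P_p(c)`, for given Euler angles `φ`, `ψ`. -/
def quadP (α β : Fin 3 → ℝ) (p φ ψ : ℝ) : ℝ[X] :=
  C (aP α β (Real.cos φ ^ 2) (Real.cos ψ ^ 2)) * X ^ 2 + C (trigFactor φ ψ * bP α β) * X
    + C (eP α β p (Real.cos φ ^ 2) (Real.cos ψ ^ 2))

/-- The quadratic `Q_q(c)`, for given Euler angles `φ`, `ψ`. -/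
def quadQ (α β : Fin 3 → ℝ) (q φ ψ : ℝ) : ℝ[X] :=
  C (aQ α β (Real.cos φ ^ 2) (Real.cos ψ ^ 2)) * X ^ 2 + C (trigFactor φ ψ * bQ α β) * X
    + C (eQ α β q (Real.cos φ ^ 2) (Real.cos ψ ^ 2))

/-- Discriminant of the quadratic `Q_q(c)`. -/
def discrQ (α β : Fin 3 → ℝ) (q φ ψ : ℝ) : ℝ :=
  (trigFactor φ ψ * bQ α β) ^ 2
    - 4 * aQ α β (Real.cos φ ^ 2) (Real.cos ψ ^ 2) * eQ α β q (Real.cos φ ^ 2) (Real.cos ψ ^ 2)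

/-- The resultant `R(u, z)` in `c` of `P_p(c)` and `Q_q(c)`, as a polynomial function of
`u = cos² φ` and `z = cos² ψ`: the resultant of two quadratics written out, using
`(trigFactor φ ψ)² = u (1 - u) z (1 - z)`. -/
def resPQ (α β : Fin 3 → ℝ) (p q u z : ℝ) : ℝ :=
  (aP α β u z * eQ α β q u z - aQ α β u z * eP α β p u z) ^ 2
    - u * (1 - u) * z * (1 - z) * (aP α β u z * bQ α β - aQ α β u z * bP α β)
      * (bP α β * eQ α β q u z - bQ α β * eP α β p u z)

/-- The function `B̃(u, z)`. -/
def Btilde (α β : Fin 3 → ℝ) (u z : ℝ) : ℝ :=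
  2 * (α 0 - α 1) * (β 0 - β 1) *
    ((2 * α 0 + α 1) * (α 0 + 2 * α 1) * ((β 0 - β 1) * z + (β 0 + 2 * β 1))
      + (2 * β 0 + β 1) * (β 0 + 2 * β 1) * ((α 0 - α 1) * u + (α 0 + 2 * α 1)))

/-- `∫₀¹ dz ∫₀¹ du w(u, z) δ(F(u, z)) = L`: the Dirac delta is the limit as `ε → 0⁺` of
`ε⁻¹ η(· / ε)`, with the same value `L` for every continuous compactly supported `η` of
integral one. -/
def IsDeltaIntegral (w F : ℝ → ℝ → ℝ) (L : ℝ) : Prop :=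
  ∀ η : ℝ → ℝ, Continuous η → HasCompactSupport η → ∫ t, η t = 1 →
    Tendsto (fun ε : ℝ => ∫ z in (0 : ℝ)..1, ∫ u in (0 : ℝ)..1,
      w u z * (ε⁻¹ * η (F u z / ε))) (𝓝[>] 0) (𝓝 L)

/-- `(1 / 2π²) ∫₀¹ dz ∑ᵢ |B̃(uᵢ, z)| / |R'_u(uᵢ, z)|`, the sum being over the distinct roots
`uᵢ = uᵢ(z)` of `R(·, z)` in `[0, 1]`; the value lies in `[0, ∞]`. -/
def rootIntegral (α β : Fin 3 → ℝ) (p q : ℝ) : ENNReal :=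
  ENNReal.ofReal (1 / (2 * Real.pi ^ 2)) *
    ∫⁻ z in Icc (0 : ℝ) 1, ∑' u : {u : ℝ // u ∈ Icc (0 : ℝ) 1 ∧ resPQ α β p q u z = 0},
      ENNReal.ofReal (|Btilde α β u.1 z| / |deriv (fun v : ℝ => resPQ α β p q v z) u.1|)

end

end HornReal

namespace HornReal

noncomputable section

/-! ### Characteristic polynomial, Euler angles, elimination of `c` -/

section

/-! In Euler angles `P` and `Q` are quadratics in `c = cos θ`, with coefficients depending on `u =
cos² φ`, `z = cos² ψ` and `s`. Eliminating `c ^ 2` leaves an equation `s * Btilde * c = const`, and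
`Btilde > 0` on the unit square; so for `s ≠ 0` the resultant vanishes exactly when there is a
common root, which is then real and unique (`resPQ_eq_zero_iff`). This root is automatically the
cosine of an angle: the characteristic polynomial at `α₃ + β₃` equals `kfun * (c ^ 2 - 1)` with
`kfun > 0` (`lowSum_eval`), and it is negative for almost every `(p, q)` in the range.

Haar measure is a multiple of `dφ dc dψ` (`lintegral_haar_euler`). The map `((φ, c), ψ) ↦ ((P, Q),
ψ)` has Jacobian `jac`, almost everywhere non-zero, and the area formula (`lintegral_tsum_fiber`)
gives the density as the integral over `ψ` of the sum of `1 / |jac|` over a fibre. Differentiating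
the resultant at a common root (`resPQ_deriv_eq_jac`) turns this into the sum of `|Btilde| / |R'_u|`
over the roots (`fiberSum_eq`).

For the delta integral, zero is a regular value of `R` on the closed square when `(p, q)` is generic
(`resPQ_regular`): a singular zero would give `C` a double eigenvalue or an eigenvalue `α_i + β_j`.
A vector field transverse to the zero set then allows integration by parts (`TransverseField`),
which proves that the limit exists, does not depend on `η`, and is locally bounded in `(p, q)`. To
identify the limit with the density, integrate it against a test function `g(p, q)`: for fixed
angles, coordinates along a pencil of the two quadratics make `R` linear (`resPQ_pencil`), and the
smoothed integrals tend to a multiple of the mean of `g(P, Q)`.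

The density of the eigenvalues follows by the change of variables `cubicPQ`, whose Jacobian is the
Vandermonde product up to sign. -/

theorem charpoly_fin_three (A : Matrix (Fin 3) (Fin 3) ℝ) :
    A.charpoly = X ^ 3 - C (A 0 0 + A 1 1 + A 2 2) * X ^ 2
      + C (A 0 0 * A 1 1 - A 0 1 * A 1 0 + A 0 0 * A 2 2 - A 0 2 * A 2 0
        + A 1 1 * A 2 2 - A 1 2 * A 2 1) * X - C A.det := by
  rw [Matrix.charpoly, Matrix.det_fin_three, Matrix.det_fin_three]
  simp
  ring

theorem charpoly_coeff_one (A : Matrix (Fin 3) (Fin 3) ℝ) :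
    A.charpoly.coeff 1 = A 0 0 * A 1 1 - A 0 1 * A 1 0 + A 0 0 * A 2 2 - A 0 2 * A 2 0
        + A 1 1 * A 2 2 - A 1 2 * A 2 1 := by
  rw [charpoly_fin_three]
  simp only [coeff_add, coeff_sub, coeff_C_mul, coeff_X_pow, coeff_X, coeff_C]
  norm_num

theorem charpoly_coeff_zero (A : Matrix (Fin 3) (Fin 3) ℝ) :
    A.charpoly.coeff 0 = - A.det := by
  rw [charpoly_fin_three]
  simp only [coeff_add, coeff_sub, coeff_C_mul, coeff_X_pow, coeff_X, coeff_C]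
  norm_num

theorem sumMatrix_charpoly (α β : Fin 3 → ℝ) (hα0 : α 0 + α 1 + α 2 = 0)
    (hβ0 : β 0 + β 1 + β 2 = 0) (M : SO3) :
    (sumMatrix α β M.1).charpoly =
      X ^ 3 + C (coeffP α β M.1) * X + C (coeffQ α β M.1) := by
  have ht : (sumMatrix α β M.1).trace = 0 := by
    have h1 : M.1.transpose * M.1 = 1 := M.2.1.1
    rw [sumMatrix, Matrix.trace_add, Matrix.mul_assoc, Matrix.trace_mul_comm, Matrix.mul_assoc, h1]
    simp [Matrix.trace, Fin.sum_univ_three]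
    linarith
  rw [Matrix.trace_fin_three] at ht
  rw [coeffP, coeffQ, charpoly_coeff_one, charpoly_coeff_zero, charpoly_fin_three, ht]
  simp
  ring

/-- The value of `P` at `u = cos² φ`, `z = cos² ψ`, `s = cos φ cos ψ sin φ sin ψ`, `c = cos θ`. -/
def polyP (α β : Fin 3 → ℝ) (u z s c : ℝ) : ℝ := aP α β u z * c ^ 2 + s * bP α β * c + eP α β 0 u z

/-- The value of `Q` at `u = cos² φ`, `z = cos² ψ`, `s = cos φ cos ψ sin φ sin ψ`, `c = cos θ`. -/
def polyQ (α β : Fin 3 → ℝ) (u z s c : ℝ) : ℝ := aQ α β u z * c ^ 2 + s * bQ α β * c + eQ α β 0 u z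

theorem quadP_eval (α β : Fin 3 → ℝ) (p φ ψ c : ℝ) : (quadP α β p φ ψ).eval c =
    polyP α β (Real.cos φ ^ 2) (Real.cos ψ ^ 2) (trigFactor φ ψ) c - p := by
  simp [quadP, polyP, eP]; ring

theorem quadQ_eval (α β : Fin 3 → ℝ) (q φ ψ c : ℝ) : (quadQ α β q φ ψ).eval c =
    polyQ α β (Real.cos φ ^ 2) (Real.cos ψ ^ 2) (trigFactor φ ψ) c - q := by
  simp [quadQ, polyQ, eQ]; ring

theorem coeffP_euler (α β : Fin 3 → ℝ) (hα0 : α 0 + α 1 + α 2 = 0) (hβ0 : β 0 + β 1 + β 2 = 0)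
    (φ θ ψ : ℝ) : coeffP α β (rotZ φ * rotY θ * rotZ ψ) =
    polyP α β (Real.cos φ ^ 2) (Real.cos ψ ^ 2) (trigFactor φ ψ) (Real.cos θ) := by
  have h2 : α 2 = - α 0 - α 1 := by linarith
  have h3 : β 2 = - β 0 - β 1 := by linarith
  rw [coeffP, charpoly_coeff_one]
  simp only [sumMatrix, rotZ, rotY, Matrix.add_apply, Matrix.mul_apply, Fin.sum_univ_three,
    Matrix.diagonal_apply, Matrix.transpose_apply, polyP, aP, bP, eP, trigFactor]
  simp [h2, h3]
  generalize ha : Real.cos φ = a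
  generalize ha' : Real.sin φ = a'
  generalize hb : Real.cos ψ = b
  generalize hb' : Real.sin ψ = b'
  generalize hc : Real.cos θ = c
  generalize hc' : Real.sin θ = c'
  have e1 : a' ^ 2 = 1 - a ^ 2 := by rw [← ha, ← ha', Real.sin_sq]
  have e2 : b' ^ 2 = 1 - b ^ 2 := by rw [← hb, ← hb', Real.sin_sq]
  have e3 : c' ^ 2 = 1 - c ^ 2 := by rw [← hc, ← hc', Real.sin_sq]
  -- Each power of a sine left by `ring_nf` needs its own rule before the sines can be eliminated.
  have g1 : a' ^ 4 = (1 - a ^ 2) ^ 2 := by rw [← e1]; ring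
  have g2 : b' ^ 4 = (1 - b ^ 2) ^ 2 := by rw [← e2]; ring
  have g3 : c' ^ 4 = (1 - c ^ 2) ^ 2 := by rw [← e3]; ring
  ring_nf
  simp only [e1, e2, e3, g1, g2, g3]
  ring

set_option maxRecDepth 20000 in
theorem coeffQ_euler (α β : Fin 3 → ℝ) (hα0 : α 0 + α 1 + α 2 = 0) (hβ0 : β 0 + β 1 + β 2 = 0)
    (φ θ ψ : ℝ) : coeffQ α β (rotZ φ * rotY θ * rotZ ψ) =
    polyQ α β (Real.cos φ ^ 2) (Real.cos ψ ^ 2) (trigFactor φ ψ) (Real.cos θ) := by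
  have h2 : α 2 = - α 0 - α 1 := by linarith
  have h3 : β 2 = - β 0 - β 1 := by linarith
  rw [coeffQ, charpoly_coeff_zero, Matrix.det_fin_three]
  simp only [sumMatrix, rotZ, rotY, Matrix.add_apply, Matrix.mul_apply, Fin.sum_univ_three,
    Matrix.diagonal_apply, Matrix.transpose_apply, polyQ, aQ, bQ, eQ, trigFactor]
  simp [h2, h3]
  generalize ha : Real.cos φ = a
  generalize ha' : Real.sin φ = a'
  generalize hb : Real.cos ψ = b
  generalize hb' : Real.sin ψ = b'
  generalize hc : Real.cos θ = c
  generalize hc' : Real.sin θ = c'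
  have e1 : a' ^ 2 = 1 - a ^ 2 := by rw [← ha, ← ha', Real.sin_sq]
  have e2 : b' ^ 2 = 1 - b ^ 2 := by rw [← hb, ← hb', Real.sin_sq]
  have e3 : c' ^ 2 = 1 - c ^ 2 := by rw [← hc, ← hc', Real.sin_sq]
  have g1 : a' ^ 4 = (1 - a ^ 2) ^ 2 := by rw [← e1]; ring
  have g2 : b' ^ 4 = (1 - b ^ 2) ^ 2 := by rw [← e2]; ring
  have g3 : c' ^ 4 = (1 - c ^ 2) ^ 2 := by rw [← e3]; ring
  ring_nf
  simp only [e1, e2, e3, g1, g2, g3]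
  ring

theorem resultant_quad (a b c d e f : ℝ) :
    Polynomial.resultant (C a * X ^ 2 + C b * X + C c) (C d * X ^ 2 + C e * X + C f) 2 2 =
      (a * f - d * c) ^ 2 - (a * e - d * b) * (b * f - e * c) := by
  rw [Polynomial.resultant]
  have : sylvester (C a * X ^ 2 + C b * X + C c) (C d * X ^ 2 + C e * X + C f) 2 2 =
      !![f, 0, c, 0; e, f, b, c; d, e, a, b; 0, d, 0, a] := by
    ext i j
    fin_cases i <;> fin_cases j <;>
      simp [sylvester, Fin.addCases, coeff_X, coeff_C, coeff_X_pow]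
  rw [this]
  simp [Matrix.det_succ_row_zero, Fin.sum_univ_succ, Fin.succAbove]
  ring

theorem trigFactor_sq (φ ψ : ℝ) : trigFactor φ ψ ^ 2 =
    Real.cos φ ^ 2 * (1 - Real.cos φ ^ 2) * Real.cos ψ ^ 2 * (1 - Real.cos ψ ^ 2) := by
  rw [trigFactor, ← Real.sin_sq, ← Real.sin_sq]; ring

theorem resultant_quadP_quadQ (α β : Fin 3 → ℝ) (p q φ ψ : ℝ) :
    Polynomial.resultant (quadP α β p φ ψ) (quadQ α β q φ ψ) 2 2
        = resPQ α β p q (Real.cos φ ^ 2) (Real.cos ψ ^ 2) := by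
  rw [quadP, quadQ, resultant_quad, resPQ, ← trigFactor_sq]
  ring

/-- This minor is what remains of the coefficient of `c`, up to the factor `s`, once `c ^ 2` has
been eliminated from the two quadratics. -/
theorem Btilde_eq (α β : Fin 3 → ℝ) (u z : ℝ) :
    Btilde α β u z = aQ α β u z * bP α β - aP α β u z * bQ α β := by
  simp only [Btilde, aP, aQ, bP, bQ]; ring

/-- The roots of `Q_q` have sum `-s * bQ / a` and difference `√Δ / a`, so the values of `P_p` there
differ by `s * Btilde * √Δ / a ^ 2 = 2 * B * √Δ`; `A` is their mean. -/
theorem exists_quadP_eval_roots (α β : Fin 3 → ℝ) (p q φ ψ a B : ℝ)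
    (ha : a = aQ α β (Real.cos φ ^ 2) (Real.cos ψ ^ 2)) (ha0 : a ≠ 0)
    (_ : 0 ≤ discrQ α β q φ ψ)
    (hB : 2 * a ^ 2 * B = trigFactor φ ψ * Btilde α β (Real.cos φ ^ 2) (Real.cos ψ ^ 2)) :
    ∃ A : ℝ,
      (quadP α β p φ ψ).eval ((-(trigFactor φ ψ * bQ α β) + Real.sqrt (discrQ α β q φ ψ)) / (2 * a))
          = A + B * Real.sqrt (discrQ α β q φ ψ) ∧
      (quadP α β p φ ψ).eval ((-(trigFactor φ ψ * bQ α β) - Real.sqrt (discrQ α β q φ ψ)) / (2 * a))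
          = A - B * Real.sqrt (discrQ α β q φ ψ) := by
  set D := Real.sqrt (discrQ α β q φ ψ) with hD
  have hB' : B = trigFactor φ ψ * Btilde α β (Real.cos φ ^ 2) (Real.cos ψ ^ 2) / (2 * a ^ 2) := by
    field_simp; linarith
  rw [Btilde_eq, ← ha] at hB'
  have key : ∀ x : ℝ, (quadP α β p φ ψ).eval x = aP α β (Real.cos φ ^ 2) (Real.cos ψ ^ 2) * x ^ 2
      + trigFactor φ ψ * bP α β * x + eP α β p (Real.cos φ ^ 2) (Real.cos ψ ^ 2) := by
    intro x; simp [quadP]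
  refine ⟨(quadP α β p φ ψ).eval ((-(trigFactor φ ψ * bQ α β) + D) / (2 * a)) - B * D, by ring, ?_⟩
  rw [key, key, hB']
  field_simp
  ring

/-- The sum of the smallest eigenvalues of the two summands. -/
def lowSum (α β : Fin 3 → ℝ) : ℝ := -(α 0 + α 1 + β 0 + β 1)

/-- `Btilde` divided by its constant factor. -/
def kfun (α β : Fin 3 → ℝ) (u z : ℝ) : ℝ :=
  (2 * α 0 + α 1) * (α 0 + 2 * α 1) * ((β 0 - β 1) * z + (β 0 + 2 * β 1))
      + (2 * β 0 + β 1) * (β 0 + 2 * β 1) * ((α 0 - α 1) * u + (α 0 + 2 * α 1))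

theorem Btilde_eq_bP_mul (α β : Fin 3 → ℝ) (u z : ℝ) :
    Btilde α β u z = bP α β * kfun α β u z := rfl

/-- The value of the characteristic polynomial at `α₃ + β₃`. -/
theorem lowSum_eval (α β : Fin 3 → ℝ) (u z s c : ℝ) :
    lowSum α β ^ 3 + polyP α β u z s c * lowSum α β + polyQ α β u z s c =
      kfun α β u z * (c ^ 2 - 1) := by
  simp only [lowSum, polyP, polyQ, kfun, aP, bP, eP, aQ, bQ, eQ]; ring

/-- The resultant in terms of the values and the derivatives of the two quadratics at any `c`. -/
theorem resPQ_eq (α β : Fin 3 → ℝ) (p q u z s c : ℝ) (hs : s ^ 2 = u * (1 - u) * z * (1 - z)) :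
    resPQ α β p q u z =
      (aQ α β u z * (polyP α β u z s c - p) - aP α β u z * (polyQ α β u z s c - q)) ^ 2
      - s * Btilde α β u z *
        ((polyP α β u z s c - p) * (2 * aQ α β u z * c + s * bQ α β)
          - (polyQ α β u z s c - q) * (2 * aP α β u z * c + s * bP α β)) := by
  have e : ∀ p, eP α β p u z = eP α β 0 u z - p := by intro p; simp only [eP]; ring
  have f : ∀ q, eQ α β q u z = eQ α β 0 u z - q := by intro p; simp only [eQ]; ring
  -- The resultant is invariant under translations of the variable, so the Taylor coefficients at
  -- `c` may replace those at `0`.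
  rw [resPQ, ← hs, Btilde_eq, e p, f q, polyP, polyQ]
  ring

/-- The resultant vanishes iff the quadratics have the common root `c`, if `s` is not zero. -/
theorem resPQ_eq_zero_iff (α β : Fin 3 → ℝ) (p q u z s : ℝ)
    (hs : s ^ 2 = u * (1 - u) * z * (1 - z)) (hs0 : s ≠ 0) (hB : Btilde α β u z ≠ 0) (c : ℝ) :
    (polyP α β u z s c = p ∧ polyQ α β u z s c = q) ↔ (resPQ α β p q u z = 0 ∧
      c = (aP α β u z * eQ α β q u z - aQ α β u z * eP α β p u z) / (s * Btilde α β u z)) := by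
  have e : eP α β p u z = eP α β 0 u z - p := by simp only [eP]; ring
  have f : eQ α β q u z = eQ α β 0 u z - q := by simp only [eQ]; ring
  -- Without its `c ^ 2` term the combination is linear in `c`, with non-zero slope; this gives the
  -- formula for the root.
  have hT : aQ α β u z * (polyP α β u z s c - p) - aP α β u z * (polyQ α β u z s c - q) =
      s * Btilde α β u z * c -
        (aP α β u z * eQ α β q u z - aQ α β u z * eP α β p u z) := by
    rw [e, f, Btilde_eq, polyP, polyQ]; ring
  have hR := resPQ_eq α β p q u z s c hs
  rw [eq_div_iff (mul_ne_zero hs0 hB)]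
  constructor
  · rintro ⟨h1, h2⟩
    rw [h1, h2] at hR hT
    constructor
    · rw [hR]; ring
    · linarith
  · rintro ⟨h1, h2⟩
    have hT0 : aQ α β u z * (polyP α β u z s c - p) - aP α β u z * (polyQ α β u z s c - q) = 0 := by
      rw [hT]; linarith
    rw [h1, hT0] at hR
    -- Once the first combination vanishes, so does this one, because `R = 0`. Together they are a
    -- linear system for the two values with determinant `Btilde`.
    have hY : bQ α β * (polyP α β u z s c - p) - bP α β * (polyQ α β u z s c - q) = 0 := by
      have : s ^ 2 * Btilde α β u z *
        (bQ α β * (polyP α β u z s c - p) - bP α β * (polyQ α β u z s c - q)) = 0 := by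
        linear_combination hR - 2 * s * Btilde α β u z * c * hT0
      simpa [hs0, hB] using this
    have h3 : Btilde α β u z * (polyP α β u z s c - p) = 0 := by
      rw [Btilde_eq]; linear_combination bP α β * hT0 - aP α β u z * hY
    have h4 : Btilde α β u z * (polyQ α β u z s c - q) = 0 := by
      rw [Btilde_eq]; linear_combination bQ α β * hT0 - aQ α β u z * hY
    constructor
    · have := (mul_eq_zero.1 h3).resolve_left hB; linarith
    · have := (mul_eq_zero.1 h4).resolve_left hB; linarith

section pos

variable {α β : Fin 3 → ℝ} (hα : α 2 < α 1 ∧ α 1 < α 0) (hβ : β 2 < β 1 ∧ β 1 < β 0)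
  (hα0 : α 0 + α 1 + α 2 = 0) (hβ0 : β 0 + β 1 + β 2 = 0)

include hα hβ

theorem bP_pos : 0 < bP α β := by
  have := sub_pos.2 hα.2
  have := sub_pos.2 hβ.2
  unfold bP; positivity

include hα0 hβ0

/-- Zero trace gives `2 α₁ + α₂ = α₁ - α₃` and `α₁ + 2 α₂ = α₂ - α₃`, and likewise for `β`, so every
factor is positive by the strict ordering. -/
theorem kfun_pos {u z : ℝ} (hu : 0 ≤ u) (hz : 0 ≤ z) : 0 < kfun α β u z := by
  obtain ⟨h1, h2⟩ := hα
  obtain ⟨h3, h4⟩ := hβ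
  have a1 : 0 < 2 * α 0 + α 1 := by linarith
  have a2 : 0 < α 0 + 2 * α 1 := by linarith
  have a3 : 0 < 2 * β 0 + β 1 := by linarith
  have a4 : 0 < β 0 + 2 * β 1 := by linarith
  have a5 := sub_pos.2 h2
  have a6 := sub_pos.2 h4
  unfold kfun; positivity

theorem Btilde_pos {u z : ℝ} (hu : 0 ≤ u) (hz : 0 ≤ z) : 0 < Btilde α β u z := by
  rw [Btilde_eq_bP_mul]
  exact mul_pos (bP_pos hα hβ) (kfun_pos hα hβ hα0 hβ0 hu hz)

theorem aP_neg {u z : ℝ} (hu : 0 ≤ u) (hz : 0 ≤ z) : aP α β u z < 0 := by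
  obtain ⟨h1, h2⟩ := hα
  obtain ⟨h3, h4⟩ := hβ
  have a2 : 0 < α 0 + 2 * α 1 := by linarith
  have a4 : 0 < β 0 + 2 * β 1 := by linarith
  have a5 := mul_nonneg (sub_pos.2 h2).le hu
  have a6 := mul_nonneg (sub_pos.2 h4).le hz
  unfold aP
  have := mul_pos (by linarith : 0 < α 0 + 2 * α 1 + α 0 * u - α 1 * u)
    (by linarith : 0 < β 0 + 2 * β 1 + β 0 * z - β 1 * z)
  linarith

end pos

end

/-! ### The area formula for maps that need not be injective -/

section

open scoped ENNReal NNReal in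
/-- A differentiable map is injective on each piece of a countable measurable partition of a
set where its derivative is invertible. -/
theorem exists_partition_injOn {E : Type*} [NormedAddCommGroup E] [NormedSpace ℝ E]
    [FiniteDimensional ℝ E] [MeasurableSpace E] [BorelSpace E] {s : Set E} {f : E → E}
    {f' : E → E →L[ℝ] E} (hf' : ∀ x ∈ s, HasFDerivWithinAt f (f' x) s x)
    (hdet : ∀ x ∈ s, (f' x).det ≠ 0) :
    ∃ t : ℕ → Set E, Pairwise (Function.onFun Disjoint t) ∧ (∀ n, MeasurableSet (t n)) ∧
      (s ⊆ ⋃ n, t n) ∧ ∀ n, InjOn f (s ∩ t n) := by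
  classical
  -- A map closer to an invertible `A` than `1 / ‖A⁻¹‖` is injective; half of this is taken as
  -- tolerance. For singular `A` the value is immaterial.
  have key : ∀ A : E →L[ℝ] E, ∃ r : ℝ≥0, r ≠ 0 ∧
      (A.det ≠ 0 → ∀ u : Set E, ApproximatesLinearOn f A u r → InjOn f u) := by
    intro A
    by_cases hA : A.det = 0
    · exact ⟨1, one_ne_zero, fun h => absurd hA h⟩
    · let B := A.toContinuousLinearEquivOfDetNeZero hA
      have hB : (B : E →L[ℝ] E) = A := A.coe_toContinuousLinearEquivOfDetNeZero hA
      rcases subsingleton_or_nontrivial E with hE | hE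
      · exact ⟨1, one_ne_zero, fun _ u _ => Function.Injective.injOn (Function.injective_of_subsingleton f)⟩
      · have hpos : 0 < ‖(B.symm : E →L[ℝ] E)‖₊⁻¹ := by
          rw [inv_pos]; exact B.nnnorm_symm_pos
        refine ⟨‖(B.symm : E →L[ℝ] E)‖₊⁻¹ / 2, (half_pos hpos).ne', fun _ u hu => ?_⟩
        rw [← hB] at hu
        exact hu.injOn (Or.inr (NNReal.half_lt_self hpos.ne'))
  choose r hr0 hr using key
  obtain ⟨t, A, h1, h2, h3, h4, h5⟩ :=
    exists_partition_approximatesLinearOn_of_hasFDerivWithinAt f s f' hf' r hr0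
  refine ⟨t, h1, h2, h3, fun n => ?_⟩
  rcases s.eq_empty_or_nonempty with hs | hs
  · simp [hs]
  · obtain ⟨y, hy, hAy⟩ := h5 hs n
    exact hr (A n) (hAy ▸ hdet y hy) _ (h4 n)

open scoped ENNReal in
/-- The area formula, for maps that are not assumed to be injective. -/
theorem lintegral_tsum_fiber {E : Type*} [NormedAddCommGroup E] [NormedSpace ℝ E]
    [FiniteDimensional ℝ E] [MeasurableSpace E] [BorelSpace E] (μ : Measure E) [μ.IsAddHaarMeasure]
    {s : Set E} (hs : MeasurableSet s) {f : E → E} {f' : E → E →L[ℝ] E}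
    (hf' : ∀ x ∈ s, HasFDerivWithinAt f (f' x) s x)
    (hdet : MeasurableSet {x | x ∈ s ∧ (f' x).det ≠ 0}) {h : E → ℝ≥0∞} (hh : Measurable h) :
    AEMeasurable (fun y => ∑' x : {x : E // x ∈ s ∧ f x = y}, h x) μ ∧
    ∫⁻ y, ∑' x : {x : E // x ∈ s ∧ f x = y}, h x ∂μ =
      ∫⁻ x in s, ENNReal.ofReal |(f' x).det| * h x ∂μ := by
  classical
  set S := {x | x ∈ s ∧ (f' x).det ≠ 0} with hS
  have hSs : S ⊆ s := fun x hx => hx.1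
  obtain ⟨t, ht1, ht2, ht3, ht4⟩ := exists_partition_injOn
    (fun x (hx : x ∈ S) => (hf' x hx.1).mono hSs) (fun x (hx : x ∈ S) => hx.2)
  have hA : ∀ n, MeasurableSet (S ∩ t n) := fun n => hdet.inter (ht2 n)
  have hfA : ∀ n, ∀ x ∈ S ∩ t n, HasFDerivWithinAt f (f' x) (S ∩ t n) x := fun n x hx =>
    (hf' x hx.1.1).mono (fun y hy => hy.1.1)
  have hemb := fun n => measurableEmbedding_of_fderivWithin (hA n) (hfA n) (ht4 n)
  -- `G n` is `h` transported by `f` from the `n`-th piece to its image, and zero elsewhere.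
  let G : ℕ → E → ℝ≥0∞ := fun n => Function.extend ((S ∩ t n).domRestrict f)
    (fun x => h x.1) 0
  have hG1 : ∀ n x, x ∈ S ∩ t n → G n (f x) = h x := by
    intro n x hx
    exact (hemb n).injective.extend_apply (fun x => h x.1) 0 (⟨x, hx⟩ : (S ∩ t n : Set E))
  have hG2 : ∀ n y, y ∉ f '' (S ∩ t n) → G n y = 0 := by
    intro n y hy
    refine Function.extend_apply' _ _ _ ?_
    rintro ⟨⟨x, hx⟩, rfl⟩
    exact hy ⟨x, hx, rfl⟩
  have hGm : ∀ n, Measurable (G n) := fun n =>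
    (hemb n).measurable_extend (hh.comp measurable_subtype_coe) measurable_zero
  have hGi : ∀ n, ∫⁻ y, G n y ∂μ = ∫⁻ x in S ∩ t n, ENNReal.ofReal |(f' x).det| * h x ∂μ := by
    intro n
    have h1 : MeasurableSet (f '' (S ∩ t n)) := measurable_image_of_fderivWithin (hA n) (hfA n) (ht4 n)
    rw [← setLIntegral_eq_of_support_subset (s := f '' (S ∩ t n))]
    · rw [lintegral_image_eq_lintegral_abs_det_fderiv_mul μ (hA n) (hfA n) (ht4 n)]
      exact setLIntegral_congr_fun (hA n) fun x hx => by simp only [hG1 n x hx]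
    · intro y hy
      by_contra h'
      exact hy (hG2 n y h')
  have hU : (⋃ n, S ∩ t n) = S := by
    rw [← inter_iUnion]; exact inter_eq_left.2 ht3
  -- A point of the fibre lies in exactly one piece, and a piece meets the fibre at most once.
  have hsum : ∀ y, y ∉ f '' (s \ S) →
      ∑' x : {x : E // x ∈ s ∧ f x = y}, h x = ∑' n, G n y := by
    intro y hy
    have e1 : ∑' x : {x : E // x ∈ s ∧ f x = y}, h x =
        ∑' x, ∑' n, (S ∩ t n ∩ {x | f x = y}).indicator h x := by
      rw [show (∑' x : {x : E // x ∈ s ∧ f x = y}, h x) =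
        ∑' x, {x : E | x ∈ s ∧ f x = y}.indicator h x from tsum_subtype _ _]
      refine tsum_congr fun x => ?_
      by_cases hx : x ∈ s ∧ f x = y
      · have hxS : x ∈ S := by
          by_contra h'
          exact hy ⟨x, ⟨hx.1, h'⟩, hx.2⟩
        obtain ⟨n, hn⟩ := mem_iUnion.1 (ht3 hxS)
        rw [indicator_of_mem (show x ∈ {x : E | x ∈ s ∧ f x = y} from hx), tsum_eq_single n,
          indicator_of_mem]
        · exact ⟨⟨hxS, hn⟩, hx.2⟩
        · intro m hm
          refine indicator_of_notMem ?_ _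
          rintro ⟨⟨_, h'⟩, _⟩
          exact (disjoint_left.1 (ht1 hm) h') hn
      · rw [indicator_of_notMem (show x ∉ {x : E | x ∈ s ∧ f x = y} from hx)]
        symm
        refine ENNReal.tsum_eq_zero.2 fun n => indicator_of_notMem ?_ _
        rintro ⟨⟨h', _⟩, h''⟩
        exact hx ⟨h'.1, h''⟩
    rw [e1, ENNReal.tsum_comm]
    refine tsum_congr fun n => ?_
    by_cases hyn : y ∈ f '' (S ∩ t n)
    · obtain ⟨x, hx, rfl⟩ := hyn
      rw [hG1 n x hx, tsum_eq_single x, indicator_of_mem]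
      · exact ⟨hx, rfl⟩
      · intro x' hx'
        refine indicator_of_notMem ?_ _
        rintro ⟨h', h''⟩
        exact hx' (ht4 n h' hx h'')
    · rw [hG2 n y hyn]
      refine ENNReal.tsum_eq_zero.2 fun x => indicator_of_notMem ?_ _
      rintro ⟨h', h''⟩
      exact hyn ⟨x, h', h''⟩
  -- Sard: the critical values, where the fibre may be uncountable, form a null set.
  have hnull : μ (f '' (s \ S)) = 0 :=
    addHaar_image_eq_zero_of_det_fderivWithin_eq_zero μ
      (fun x hx => (hf' x hx.1).mono sdiff_subset) (fun x hx => by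
        by_contra h'
        exact hx.2 ⟨hx.1, h'⟩)
  have hae : (fun y => ∑' x : {x : E // x ∈ s ∧ f x = y}, h x) =ᵐ[μ] fun y => ∑' n, G n y := by
    filter_upwards [measure_eq_zero_iff_ae_notMem.1 hnull] with y hy using hsum y hy
  refine ⟨⟨_, Measurable.tsum hGm, hae⟩, ?_⟩
  rw [lintegral_congr_ae hae, lintegral_tsum fun n => (hGm n).aemeasurable]
  simp_rw [hGi]
  rw [← lintegral_iUnion hA (fun i j hij => (ht1 hij).mono inter_subset_right inter_subset_right),
    hU, ← lintegral_indicator hdet, ← lintegral_indicator hs]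
  refine lintegral_congr fun x => ?_
  by_cases hx : x ∈ s
  · by_cases hx' : (f' x).det = 0
    · simp [indicator, hS, hx, hx']
    · simp [indicator, hS, hx, hx']
  · simp [indicator, hS, hx]

end

/-! ### The group `SO(3)` and Euler angles -/

section

theorem mem_SO3_iff (M : Matrix (Fin 3) (Fin 3) ℝ) :
    M ∈ Matrix.specialOrthogonalGroup (Fin 3) ℝ ↔ M * M.transpose = 1 ∧ M.det = 1 := by
  rw [Matrix.mem_specialOrthogonalGroup_iff, Matrix.mem_orthogonalGroup_iff]

theorem rotZ_mem (t : ℝ) : rotZ t ∈ Matrix.specialOrthogonalGroup (Fin 3) ℝ := by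
  rw [mem_SO3_iff]
  have h := Real.sin_sq_add_cos_sq t
  constructor
  · ext i j
    fin_cases i <;> fin_cases j <;>
      simp [rotZ, Matrix.mul_apply, Fin.sum_univ_three] <;> nlinarith
  · simp [rotZ, Matrix.det_fin_three]; nlinarith

theorem rotY_mem (t : ℝ) : rotY t ∈ Matrix.specialOrthogonalGroup (Fin 3) ℝ := by
  rw [mem_SO3_iff]
  have h := Real.sin_sq_add_cos_sq t
  constructor
  · ext i j
    fin_cases i <;> fin_cases j <;>
      simp [rotY, Matrix.mul_apply, Fin.sum_univ_three] <;> nlinarith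
  · simp [rotY, Matrix.det_fin_three]; nlinarith

/-- `rotZ` as an element of `SO(3)`. -/
def rz (t : ℝ) : SO3 := ⟨rotZ t, rotZ_mem t⟩

/-- `rotY` as an element of `SO(3)`. -/
def ry (t : ℝ) : SO3 := ⟨rotY t, rotY_mem t⟩

theorem rz_add (s t : ℝ) : rz (s + t) = rz s * rz t := by
  refine Subtype.ext ?_
  change rotZ (s + t) = rotZ s * rotZ t
  ext i j
  fin_cases i <;> fin_cases j <;>
    simp [rotZ, Matrix.mul_apply, Fin.sum_univ_three, Real.cos_add, Real.sin_add] <;> ring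

theorem rz_add_two_pi (t : ℝ) : rz (t + 2 * Real.pi) = rz t := by
  refine Subtype.ext ?_
  change rotZ (t + 2 * Real.pi) = rotZ t
  simp [rotZ]

theorem exists_cos_sin {x y : ℝ} (h : x ^ 2 + y ^ 2 = 1) : ∃ t : ℝ, Real.cos t = x ∧ Real.sin t = y := by
  have hn : ‖(⟨x, y⟩ : ℂ)‖ = 1 := by
    rw [Complex.norm_def, Complex.normSq_mk, Real.sqrt_eq_one]; linarith
  refine ⟨Complex.arg ⟨x, y⟩, ?_, ?_⟩
  · have := Complex.norm_mul_cos_arg ⟨x, y⟩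
    rwa [hn, one_mul] at this
  · have := Complex.norm_mul_sin_arg ⟨x, y⟩
    rwa [hn, one_mul] at this

/-- Spherical coordinates on the unit sphere. -/
theorem exists_spherical {x y w : ℝ} (h : x ^ 2 + y ^ 2 + w ^ 2 = 1) :
    ∃ a : ℝ, x = Real.cos a * Real.sin (Real.arccos w) ∧ y = Real.sin a * Real.sin (Real.arccos w) := by
  rw [Real.sin_arccos]
  have h1 : 1 - w ^ 2 = x ^ 2 + y ^ 2 := by linarith
  rw [h1]
  have h2 : Real.sqrt (x ^ 2 + y ^ 2) = ‖(⟨x, y⟩ : ℂ)‖ := by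
    rw [Complex.norm_def, Complex.normSq_mk]; congr 1; ring
  rw [h2]
  refine ⟨Complex.arg ⟨x, y⟩, ?_, ?_⟩
  · rw [mul_comm]; exact (Complex.norm_mul_cos_arg ⟨x, y⟩).symm
  · rw [mul_comm]; exact (Complex.norm_mul_sin_arg ⟨x, y⟩).symm

theorem SO3_col_sq (M : SO3) (j : Fin 3) : M.1 0 j ^ 2 + M.1 1 j ^ 2 + M.1 2 j ^ 2 = 1 := by
  have h1 : M.1.transpose * M.1 = 1 := M.2.1.1
  have h2 := congrFun (congrFun h1 j) j
  simp [Matrix.mul_apply, Fin.sum_univ_three] at h2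
  linarith

theorem SO3_row_sq (M : SO3) (j : Fin 3) : M.1 j 0 ^ 2 + M.1 j 1 ^ 2 + M.1 j 2 ^ 2 = 1 := by
  have h1 : M.1 * M.1.transpose = 1 := M.2.1.2
  have h2 := congrFun (congrFun h1 j) j
  simp [Matrix.mul_apply, Fin.sum_univ_three] at h2
  linarith

theorem abs_SO3_le (M : SO3) (i j : Fin 3) : |M.1 i j| ≤ 1 := by
  have h := SO3_row_sq M i
  rw [← sq_le_one_iff_abs_le_one]
  have h0 := sq_nonneg (M.1 i 0)
  have h1 := sq_nonneg (M.1 i 1)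
  have h2 := sq_nonneg (M.1 i 2)
  fin_cases j
  · change M.1 i 0 ^ 2 ≤ 1; linarith
  · change M.1 i 1 ^ 2 ≤ 1; linarith
  · change M.1 i 2 ^ 2 ≤ 1; linarith

/-- Rows and columns are unit vectors, so the rest of the last row and column vanishes, and what
remains is a plane rotation. -/
theorem exists_eq_rz {N : SO3} (h : N.1 2 2 = 1) : ∃ b, N = rz b := by
  have hr := SO3_row_sq N 2
  have hc := SO3_col_sq N 2
  rw [h] at hr hc
  have e20 : N.1 2 0 = 0 := by nlinarith
  have e21 : N.1 2 1 = 0 := by nlinarith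
  have e02 : N.1 0 2 = 0 := by nlinarith
  have e12 : N.1 1 2 = 0 := by nlinarith
  have hd : N.1.det = 1 := N.2.2
  rw [Matrix.det_fin_three, h, e20, e21, e02, e12] at hd
  have r0 := SO3_row_sq N 0
  have r1 := SO3_row_sq N 1
  have c0 := SO3_col_sq N 0
  rw [e02] at r0
  rw [e12] at r1
  rw [e20] at c0
  -- The two squares add up to `2 - 2 det N = 0`.
  have e1 : N.1 1 1 = N.1 0 0 := by
    nlinarith [sq_nonneg (N.1 1 1 - N.1 0 0), sq_nonneg (N.1 0 1 + N.1 1 0)]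
  have e2 : N.1 0 1 = -N.1 1 0 := by
    nlinarith [sq_nonneg (N.1 1 1 - N.1 0 0), sq_nonneg (N.1 0 1 + N.1 1 0)]
  obtain ⟨b, hb1, hb2⟩ := exists_cos_sin (x := N.1 0 0) (y := N.1 1 0) (by linarith)
  refine ⟨b, Subtype.ext ?_⟩
  change N.1 = rotZ b
  rw [rotZ, hb1, hb2]
  ext i j
  fin_cases i <;> fin_cases j <;> simp [*]

/-- Decomposition of a rotation in Euler angles. -/
theorem exists_euler (M : SO3) : ∃ a b, M = rz a * ry (Real.arccos (M.1 2 2)) * rz b := by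
  obtain ⟨a, h0, h1⟩ := exists_spherical (SO3_col_sq M 2)
  set θ := Real.arccos (M.1 2 2) with hθ
  have hc : Real.cos θ = M.1 2 2 :=
    Real.cos_arccos (abs_le.1 (abs_SO3_le M 2 2)).1 (abs_le.1 (abs_SO3_le M 2 2)).2
  -- `rz a * ry θ` has the same third column as `M`.
  have hN : ((rz a * ry θ)⁻¹ * M).1 2 2 = 1 := by
    change ((rotZ a * rotY θ).transpose * M.1) 2 2 = 1
    simp [Matrix.mul_apply, Fin.sum_univ_three, rotZ, rotY, h0, h1, hc]
    rw [← hc]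
    nlinarith [Real.sin_sq_add_cos_sq a, Real.sin_sq_add_cos_sq θ]
  obtain ⟨b, hb⟩ := exists_eq_rz hN
  exact ⟨a, b, by rw [← hb]; group⟩

instance : SecondCountableTopology SO3 :=
  have : SecondCountableTopology (Matrix (Fin 3) (Fin 3) ℝ) :=
    inferInstanceAs (SecondCountableTopology (Fin 3 → Fin 3 → ℝ))
  TopologicalSpace.Subtype.secondCountableTopology
    ((Matrix.specialOrthogonalGroup (Fin 3) ℝ : Submonoid _) : Set (Matrix (Fin 3) (Fin 3) ℝ))

instance : IsTopologicalGroup SO3 where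
  continuous_inv := by
    refine Continuous.subtype_mk ?_ _
    exact continuous_subtype_val.matrix_transpose

instance : CompactSpace SO3 := by
  refine (isCompact_iff_compactSpace
    (s := ((Matrix.specialOrthogonalGroup (Fin 3) ℝ : Submonoid _) :
      Set (Matrix (Fin 3) (Fin 3) ℝ)))).1 ?_
  have hcl : IsClosed {M : Matrix (Fin 3) (Fin 3) ℝ | M * M.transpose = 1 ∧ M.det = 1} :=
    (isClosed_eq (by fun_prop) continuous_const).inter (isClosed_eq (by fun_prop) continuous_const)
  have hK : IsCompact (Set.pi univ fun _ : Fin 3 => Set.pi univ fun _ : Fin 3 => Icc (-1 : ℝ) 1) :=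
    isCompact_univ_pi fun _ => isCompact_univ_pi fun _ => isCompact_Icc
  refine IsCompact.of_isClosed_subset hK ?_ ?_
  · convert hcl using 1
    ext M
    exact mem_SO3_iff M
  · intro M hM i _ j _
    exact abs_le.1 (abs_SO3_le ⟨M, hM⟩ i j)

theorem continuous_rz : Continuous rz := by
  refine Continuous.subtype_mk (continuous_matrix fun i j => ?_) _
  fin_cases i <;> fin_cases j <;> simp [rotZ] <;> fun_prop

theorem continuous_ry : Continuous ry := by
  refine Continuous.subtype_mk (continuous_matrix fun i j => ?_) _
  fin_cases i <;> fin_cases j <;> simp [rotY] <;> fun_prop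

section haar

variable [MeasurableSpace SO3] [BorelSpace SO3] (μ : Measure SO3) [μ.IsHaarMeasure]
  [IsProbabilityMeasure μ]

/-- Compactness makes the group unimodular: a right translate of `μ` is again a Haar probability
measure, and there is only one. -/
instance : μ.IsMulRightInvariant where
  map_mul_right_eq_self g := by
    have : IsProbabilityMeasure (μ.map (· * g)) :=
      Measure.isProbabilityMeasure_map (measurable_mul_const g).aemeasurable
    have : (μ.map (· * g)).IsHaarMeasure := inferInstance
    exact Measure.isHaarMeasure_eq_of_isProbabilityMeasure _ _

end haar

end

/-! ### Archimedes: the height on the sphere is uniform -/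

section

open scoped ENNReal

/-- The substitution `c = cos θ`. -/
theorem lintegral_sin_mul_comp_cos (g : ℝ → ℝ≥0∞) :
    ∫⁻ θ in Ioo 0 Real.pi, ENNReal.ofReal (Real.sin θ) * g (Real.cos θ) =
      ∫⁻ c in Ioo (-1) 1, g c := by
  have himg : Real.cos '' Ioo 0 Real.pi = Ioo (-1) 1 := by
    ext c
    constructor
    · rintro ⟨θ, ⟨h0, h1⟩, rfl⟩
      constructor
      · rw [← Real.cos_pi]
        exact Real.strictAntiOn_cos ⟨h0.le, h1.le⟩ ⟨Real.pi_pos.le, le_rfl⟩ h1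
      · rw [← Real.cos_zero]
        exact Real.strictAntiOn_cos ⟨le_rfl, Real.pi_pos.le⟩ ⟨h0.le, h1.le⟩ h0
    · rintro ⟨h0, h1⟩
      refine ⟨Real.arccos c, ⟨Real.arccos_pos.2 h1, ?_⟩, Real.cos_arccos h0.le h1.le⟩
      exact Real.arccos_lt_pi.2 h0
  rw [← himg, lintegral_image_eq_lintegral_abs_deriv_mul measurableSet_Ioo
    (fun x _ => (Real.hasDerivAt_cos x).hasDerivWithinAt)
    (Real.injOn_cos.mono Ioo_subset_Icc_self)]
  refine setLIntegral_congr_fun measurableSet_Ioo fun θ hθ => ?_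
  simp only [abs_neg]
  rw [abs_of_pos (Real.sin_pos_of_mem_Ioo hθ)]

/-- Archimedes: the height of a uniform point of the ball, divided by its distance to the centre,
is uniform in `[-1, 1]`. -/
theorem exists_lintegral_ball_height : ∃ K : ℝ≥0∞, K ≠ 0 ∧ K ≠ ∞ ∧ ∀ g : ℝ → ℝ≥0∞, Measurable g →
    ∫⁻ z in {z : Fin 3 → ℝ | z 0 ^ 2 + z 1 ^ 2 + z 2 ^ 2 ≤ 1},
      g (z 2 / Real.sqrt (z 0 ^ 2 + z 1 ^ 2 + z 2 ^ 2)) = K * ∫⁻ c in Ioo (-1) 1, g c := by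
  refine ⟨∫⁻ r in Ioc (0 : ℝ) 1, ENNReal.ofReal (2 * Real.pi * r ^ 2), ?_, ?_, ?_⟩
  · rw [← pos_iff_ne_zero, setLIntegral_pos_iff (by fun_prop)]
    have : Ioc (0 : ℝ) 1 ⊆ (Function.support fun r : ℝ => ENNReal.ofReal (2 * Real.pi * r ^ 2)) := by
      intro r hr
      rw [Function.mem_support, Ne, ENNReal.ofReal_eq_zero, not_le]
      have := hr.1
      have := Real.pi_pos
      positivity
    rw [inter_eq_right.2 this]
    simp
  · refine ne_top_of_le_ne_top ?_ (setLIntegral_mono (g := fun _ => ENNReal.ofReal (2 * Real.pi))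
      measurable_const fun r hr => ENNReal.ofReal_le_ofReal ?_)
    · simp [ENNReal.mul_eq_top]
    · have := pow_le_one₀ hr.1.le hr.2 (n := 2)
      nlinarith [Real.pi_pos]
  · intro g hg
    -- `w` stands for `x² + y²`, `t` for the height; the indicator is that of the ball.
    let F : ℝ → ℝ → ℝ≥0∞ := fun w t => (Iic 1).indicator (fun _ => g (t / Real.sqrt (w + t ^ 2))) (w + t ^ 2)
    have hF : Measurable (Function.uncurry F) := by
      have h1 : MeasurableSet {y : ℝ × ℝ | y.1 + y.2 ^ 2 ∈ Iic 1} :=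
        (by fun_prop : Measurable fun y : ℝ × ℝ => y.1 + y.2 ^ 2) measurableSet_Iic
      exact Measurable.ite h1 (by fun_prop) measurable_const
    have hF' : ∀ {γ : Type} [MeasurableSpace γ] {a b : γ → ℝ}, Measurable a → Measurable b →
        Measurable fun x => F (a x) (b x) := fun ha hb => hF.comp (ha.prodMk hb)
    have step1 : ∫⁻ z in {z : Fin 3 → ℝ | z 0 ^ 2 + z 1 ^ 2 + z 2 ^ 2 ≤ 1},
        g (z 2 / Real.sqrt (z 0 ^ 2 + z 1 ^ 2 + z 2 ^ 2)) =
        ∫⁻ t : ℝ, ∫⁻ x : ℝ × ℝ, F (x.1 ^ 2 + x.2 ^ 2) t := by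
      have e1 : ∀ z : Fin 3 → ℝ, F (z 0 ^ 2 + z 1 ^ 2) (z 2) =
          {z : Fin 3 → ℝ | z 0 ^ 2 + z 1 ^ 2 + z 2 ^ 2 ≤ 1}.indicator
          (fun z => g (z 2 / Real.sqrt (z 0 ^ 2 + z 1 ^ 2 + z 2 ^ 2))) z := by
        intro z; rfl
      rw [← lintegral_indicator (measurableSet_le (by fun_prop) (by fun_prop)), ← lintegral_congr e1,
        ← lintegral_prod (fun y : ℝ × (ℝ × ℝ) => F (y.2.1 ^ 2 + y.2.2 ^ 2) y.1)
          (hF' (by fun_prop) (by fun_prop)).aemeasurable]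
      have hmp : MeasurePreserving (fun z : Fin 3 → ℝ => (z 2, (z 0, z 1)))
          volume (volume : Measure (ℝ × (ℝ × ℝ))) := by
        have h1 := volume_preserving_piFinSuccAbove (fun _ : Fin 3 => ℝ) 2
        have h2 := (MeasurePreserving.id (volume : Measure ℝ)).prod (volume_preserving_finTwoArrow ℝ)
        exact h2.comp h1
      exact hmp.lintegral_comp (f := fun y : ℝ × (ℝ × ℝ) => F (y.2.1 ^ 2 + y.2.2 ^ 2) y.1)
        (hF' (by fun_prop) (by fun_prop))
    have step2 : ∀ t : ℝ, ∫⁻ x : ℝ × ℝ, F (x.1 ^ 2 + x.2 ^ 2) t =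
        ∫⁻ ρ in Ioi (0 : ℝ), ENNReal.ofReal (2 * Real.pi * ρ) * F (ρ ^ 2) t := by
      intro t
      rw [← lintegral_comp_polarCoord_symm, polarCoord_target, Measure.volume_eq_prod,
        ← Measure.prod_restrict, lintegral_prod _ (by
          refine Measurable.aemeasurable (Measurable.mul (by fun_prop) (hF' ?_ (by fun_prop)))
          simp only [polarCoord_symm_apply]
          fun_prop)]
      refine setLIntegral_congr_fun measurableSet_Ioi fun ρ hρ => ?_
      have : ∀ θ : ℝ, ((polarCoord.symm (ρ, θ)).1 ^ 2 + (polarCoord.symm (ρ, θ)).2 ^ 2) = ρ ^ 2 := by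
        intro θ
        simp only [polarCoord_symm_apply]
        nlinarith [Real.sin_sq_add_cos_sq θ]
      simp only [this]
      simp only [lintegral_const, smul_eq_mul, Measure.restrict_apply MeasurableSet.univ, univ_inter,
        Real.volume_Ioo]
      rw [mul_comm, ← mul_assoc, ← ENNReal.ofReal_mul (by linarith [Real.pi_pos])]
      congr 2
      ring
    have step3 : ∫⁻ t : ℝ, ∫⁻ ρ in Ioi (0 : ℝ), ENNReal.ofReal (2 * Real.pi * ρ) * F (ρ ^ 2) t =
        ∫⁻ y : ℝ × ℝ, (Ioi 0).indicator (fun ρ => ENNReal.ofReal (2 * Real.pi * ρ) * F (ρ ^ 2) y.1) y.2 := by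
      rw [Measure.volume_eq_prod, lintegral_prod]
      · refine lintegral_congr fun t => ?_
        rw [← lintegral_indicator measurableSet_Ioi]
      · have h1 : MeasurableSet {y : ℝ × ℝ | y.2 ∈ Ioi 0} :=
          (by fun_prop : Measurable fun y : ℝ × ℝ => y.2) measurableSet_Ioi
        refine Measurable.aemeasurable (Measurable.ite h1
          (Measurable.mul (by fun_prop) (hF' (by fun_prop) (by fun_prop))) measurable_const)
    rw [step1]
    simp_rw [step2]
    rw [step3, ← lintegral_comp_polarCoord_symm, polarCoord_target]
    -- The second polar change is in the half plane `(t, ρ) = (r cos θ, r sin θ)`, where `ρ` is the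
    -- radius from the first. The two Jacobians multiply to `2π r² sin θ`, so the variables
    -- separate; the radial factor integrates to `K`.
    have step4 : ∀ y ∈ Ioi (0 : ℝ) ×ˢ Ioo (-Real.pi) Real.pi,
        ENNReal.ofReal y.1 • (Ioi 0).indicator (fun ρ => ENNReal.ofReal (2 * Real.pi * ρ) *
          F (ρ ^ 2) (polarCoord.symm y).1) (polarCoord.symm y).2 =
        (Iic 1).indicator (fun r => ENNReal.ofReal (2 * Real.pi * r ^ 2)) y.1 *
          (Ioo 0 Real.pi).indicator (fun θ => ENNReal.ofReal (Real.sin θ) * g (Real.cos θ)) y.2 := by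
      rintro ⟨r, θ⟩ ⟨hr, hθ⟩
      simp only [mem_Ioi] at hr
      simp only [polarCoord_symm_apply]
      by_cases h : θ ∈ Ioo 0 Real.pi
      · have hs := Real.sin_pos_of_mem_Ioo h
        rw [indicator_of_mem (show r * Real.sin θ ∈ Ioi 0 from mul_pos hr hs), indicator_of_mem h]
        have e : (r * Real.sin θ) ^ 2 + (r * Real.cos θ) ^ 2 = r ^ 2 := by
          nlinarith [Real.sin_sq_add_cos_sq θ]
        simp only [F, e, Real.sqrt_sq hr.le, mul_div_cancel_left₀ _ hr.ne', smul_eq_mul]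
        by_cases h1 : r ≤ 1
        · rw [indicator_of_mem (show r ^ 2 ∈ Iic 1 from pow_le_one₀ hr.le h1),
            indicator_of_mem (show r ∈ Iic 1 from h1), ← mul_assoc,
            ← mul_assoc (ENNReal.ofReal (2 * Real.pi * r ^ 2)), ← ENNReal.ofReal_mul hr.le,
            ← ENNReal.ofReal_mul (p := 2 * Real.pi * r ^ 2) (by have := Real.pi_pos; positivity)]
          congr 2
          ring
        · rw [indicator_of_notMem (show r ^ 2 ∉ Iic 1 by
            rw [mem_Iic, not_le]; exact one_lt_pow₀ (not_le.1 h1) two_ne_zero),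
            indicator_of_notMem (show r ∉ Iic 1 from h1)]
          simp
      · rw [indicator_of_notMem h, indicator_of_notMem]
        · simp
        · rw [mem_Ioi, not_lt]
          refine mul_nonpos_of_nonneg_of_nonpos hr.le
            (Real.sin_nonpos_of_nonpos_of_neg_pi_le ?_ hθ.1.le)
          by_contra h'
          exact h ⟨not_le.1 h', hθ.2⟩
    rw [setLIntegral_congr_fun (measurableSet_Ioi.prod measurableSet_Ioo) step4,
      Measure.volume_eq_prod, ← Measure.prod_restrict,
      lintegral_prod_mul (f := (Iic 1).indicator (fun r => ENNReal.ofReal (2 * Real.pi * r ^ 2)))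
        (g := (Ioo 0 Real.pi).indicator (fun θ => ENNReal.ofReal (Real.sin θ) * g (Real.cos θ)))
        ((by fun_prop : Measurable _).indicator measurableSet_Iic).aemeasurable
        ((by fun_prop : Measurable _).indicator measurableSet_Ioo).aemeasurable,
      setLIntegral_indicator measurableSet_Iic, setLIntegral_indicator measurableSet_Ioo,
      inter_eq_left.2 (Ioo_subset_Ioo_left (by linarith [Real.pi_pos] : -Real.pi ≤ 0)),
      lintegral_sin_mul_comp_cos, inter_comm, Ioi_inter_Iic]

end

/-! ### Haar measure in Euler angles -/

section

open scoped ENNReal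

/-- `N` is a rotation that takes the third basis vector to `x / |x|`. -/
theorem exists_SO3_mul {x : Fin 3 → ℝ} (hx : 0 < x 0 ^ 2 + x 1 ^ 2 + x 2 ^ 2) : ∃ N : SO3, ∀ M : SO3,
    (M.1.mulVec x) 2 / Real.sqrt (x 0 ^ 2 + x 1 ^ 2 + x 2 ^ 2) = (M * N).1 2 2 := by
  set r := Real.sqrt (x 0 ^ 2 + x 1 ^ 2 + x 2 ^ 2) with hr
  have hr0 : 0 < r := Real.sqrt_pos.2 hx
  have hr2 : r ^ 2 = x 0 ^ 2 + x 1 ^ 2 + x 2 ^ 2 := Real.sq_sqrt hx.le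
  have h1 : (x 0 / r) ^ 2 + (x 1 / r) ^ 2 + (x 2 / r) ^ 2 = 1 := by
    field_simp; linarith
  obtain ⟨a, h2, h3⟩ := exists_spherical h1
  have h4 : x 2 / r = Real.cos (Real.arccos (x 2 / r)) := by
    have : |x 2 / r| ≤ 1 := by
      rw [← sq_le_one_iff_abs_le_one]; nlinarith [sq_nonneg (x 0 / r), sq_nonneg (x 1 / r)]
    rw [Real.cos_arccos (abs_le.1 this).1 (abs_le.1 this).2]
  refine ⟨rz a * ry (Real.arccos (x 2 / r)), fun M => ?_⟩
  change _ = (M.1 * (rotZ a * rotY (Real.arccos (x 2 / r)))) 2 2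
  have e : ∀ i, (rotZ a * rotY (Real.arccos (x 2 / r))) i 2 = x i / r := by
    intro i
    fin_cases i <;> simp [Matrix.mul_apply, Fin.sum_univ_three, rotZ, rotY, ← h2, ← h3, ← h4]
  rw [Matrix.mul_apply, Fin.sum_univ_three, e, e, e, Matrix.mulVec, dotProduct, Fin.sum_univ_three]
  field_simp

theorem SO3_mulVec_sq (M : SO3) (x : Fin 3 → ℝ) :
    (M.1.mulVec x) 0 ^ 2 + (M.1.mulVec x) 1 ^ 2 + (M.1.mulVec x) 2 ^ 2 =
      x 0 ^ 2 + x 1 ^ 2 + x 2 ^ 2 := by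
  have h1 : M.1.transpose * M.1 = 1 := M.2.1.1
  have h2 : M.1.mulVec x ⬝ᵥ M.1.mulVec x = x ⬝ᵥ x := by
    rw [Matrix.dotProduct_mulVec, Matrix.vecMul_mulVec, ← Matrix.dotProduct_mulVec, h1,
      Matrix.one_mulVec]
  simp only [dotProduct, Fin.sum_univ_three] at h2
  linarith

theorem measurePreserving_SO3_mulVec (M : SO3) :
    MeasurePreserving (fun x : Fin 3 → ℝ => M.1.mulVec x) volume volume := by
  have hd : M.1.det = 1 := M.2.2
  refine ⟨by fun_prop, ?_⟩
  have := Real.map_matrix_volume_pi_eq_smul_volume_pi (M := M.1) (by rw [hd]; exact one_ne_zero)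
  rw [hd] at this
  exact (by simpa using this : Measure.map (⇑(Matrix.toLin' M.1)) volume = volume)

/-- A function of the Euler angles `φ`, `ψ` and of `c = cos θ`. -/
def eulerSO3 (φ c ψ : ℝ) : SO3 := rz φ * ry (Real.arccos c) * rz ψ

theorem continuous_eulerSO3 : Continuous fun y : ℝ × ℝ × ℝ => eulerSO3 y.1 y.2.1 y.2.2 := by
  have h1 := continuous_rz
  have h2 := continuous_ry
  have h3 := Real.continuous_arccos
  unfold eulerSO3
  fun_prop

theorem setLIntegral_add_of_periodic {f : ℝ → ℝ≥0∞} (hf : ∀ x, f (x + 2 * Real.pi) = f x) (a : ℝ) :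
    ∫⁻ x in Ioo (-Real.pi) Real.pi, f (x + a) = ∫⁻ x in Ioo (-Real.pi) Real.pi, f x := by
  rw [setLIntegral_congr Ioo_ae_eq_Ioc, setLIntegral_congr Ioo_ae_eq_Ioc]
  have hT : (0 : ℝ) < 2 * Real.pi := by have := Real.pi_pos; positivity
  have h1 : ∫⁻ x in Ioc (-Real.pi) Real.pi, f (x + a) = ∫⁻ x in Ioc (-Real.pi + a) (Real.pi + a), f x := by
    have := (measurePreserving_add_right volume a).setLIntegral_comp_preimage_emb
      (measurableEmbedding_addRight a) f (Ioc (-Real.pi + a) (Real.pi + a))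
    rw [← this]
    congr 2
    simp
  rw [h1]
  have h2 := (isAddFundamentalDomain_Ioc hT (-Real.pi + a)).setLIntegral_eq
    (isAddFundamentalDomain_Ioc hT (-Real.pi)) f (by
      rintro ⟨g, hg⟩ x
      obtain ⟨n, rfl⟩ := AddSubgroup.mem_zmultiples_iff.1 hg
      change f (n • (2 * Real.pi) + x) = f x
      rw [add_comm]
      exact (Function.Periodic.zsmul hf n) x)
  rw [show Ioc (-Real.pi + a) (Real.pi + a) = Ioc (-Real.pi + a) (-Real.pi + a + 2 * Real.pi) by
    congr 1; ring, h2]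
  congr 3
  ring

section haar

variable [MeasurableSpace SO3] [BorelSpace SO3] (μ : Measure SO3) [μ.IsHaarMeasure]
  [IsProbabilityMeasure μ]

/-- The entry `M₃₃` of a random rotation is uniform in `[-1, 1]`. -/
theorem lintegral_haar_last_entry {g : ℝ → ℝ≥0∞} (hg : Measurable g) :
    ∫⁻ M : SO3, g (M.1 2 2) ∂μ = ENNReal.ofReal (1 / 2) * ∫⁻ c in Ioo (-1) 1, g c := by
  obtain ⟨K, hK0, hK1, hK⟩ := exists_lintegral_ball_height
  set B := {z : Fin 3 → ℝ | z 0 ^ 2 + z 1 ^ 2 + z 2 ^ 2 ≤ 1} with hB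
  have hBm : MeasurableSet B := measurableSet_le (by fun_prop) (by fun_prop)
  have hentry : ∀ i j, Continuous fun M : SO3 => M.1 i j := fun i j =>
    continuous_subtype_val.matrix_elem i j
  have hmv : ∀ i : Fin 3, Measurable fun y : (Fin 3 → ℝ) × SO3 => (y.2.1.mulVec y.1) i := by
    intro i
    have h : Continuous fun y : (Fin 3 → ℝ) × SO3 => ∑ j, y.2.1 i j * y.1 j :=
      continuous_finsetSum _ fun j _ => ((hentry i j).comp continuous_snd).mul
        ((continuous_apply j).comp continuous_fst)
    exact h.measurable
  -- The normalised height of `M x` is integrated over both `M` and `x` in the ball. For fixed `x`,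
  -- right invariance reduces it to the entry `M₃₃`; for fixed `M`, invariance of Lebesgue measure
  -- removes `M`.
  have hmain : ∀ g : ℝ → ℝ≥0∞, Measurable g →
      volume B * ∫⁻ M : SO3, g (M.1 2 2) ∂μ = K * ∫⁻ c in Ioo (-1) 1, g c := by
    intro g hg
    have h0 : ∀ᵐ x : Fin 3 → ℝ, 0 < x 0 ^ 2 + x 1 ^ 2 + x 2 ^ 2 := by
      have : ∀ᵐ x : Fin 3 → ℝ, x ≠ 0 := by
        rw [ae_iff]; simp
      filter_upwards [this] with x hx
      by_contra h
      refine hx ?_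
      have h0 := sq_nonneg (x 0)
      have h1 := sq_nonneg (x 1)
      have h2 := sq_nonneg (x 2)
      ext i
      have : x i ^ 2 = 0 := by fin_cases i <;> simp only [Fin.zero_eta, Fin.mk_one, Fin.reduceFinMk] <;> linarith
      simpa using this
    calc volume B * ∫⁻ M : SO3, g (M.1 2 2) ∂μ
        = ∫⁻ x in B, ∫⁻ M : SO3, g (M.1 2 2) ∂μ := by
          rw [lintegral_const, Measure.restrict_apply MeasurableSet.univ, univ_inter, mul_comm]
      _ = ∫⁻ x in B, ∫⁻ M : SO3, g ((M.1.mulVec x) 2 / Real.sqrt (x 0 ^ 2 + x 1 ^ 2 + x 2 ^ 2)) ∂μ := by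
          refine lintegral_congr_ae (ae_restrict_of_ae ?_)
          filter_upwards [h0] with x hx
          obtain ⟨N, hN⟩ := exists_SO3_mul hx
          simp_rw [hN]
          exact (lintegral_mul_right_eq_self (fun M : SO3 => g (M.1 2 2)) N).symm
      _ = ∫⁻ M : SO3, (∫⁻ x in B, g ((M.1.mulVec x) 2 / Real.sqrt (x 0 ^ 2 + x 1 ^ 2 + x 2 ^ 2))) ∂μ := by
          refine lintegral_lintegral_swap (Measurable.aemeasurable (hg.comp (Measurable.div (hmv 2) ?_)))
          fun_prop
      _ = ∫⁻ M : SO3, (∫⁻ x in B, g (x 2 / Real.sqrt (x 0 ^ 2 + x 1 ^ 2 + x 2 ^ 2))) ∂μ := by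
          refine lintegral_congr fun M => ?_
          have h1 := (measurePreserving_SO3_mulVec M).setLIntegral_comp_preimage hBm
            (f := fun x => g (x 2 / Real.sqrt (x 0 ^ 2 + x 1 ^ 2 + x 2 ^ 2))) (by fun_prop)
          rw [← h1]
          have h2 : (fun x : Fin 3 → ℝ => M.1.mulVec x) ⁻¹' B = B := by
            ext x; simp only [hB, mem_preimage, mem_ofPred_eq, SO3_mulVec_sq]
          rw [h2]
          simp_rw [SO3_mulVec_sq]
      _ = K * ∫⁻ c in Ioo (-1) 1, g c := by
          rw [lintegral_const, measure_univ, mul_one, hK g hg]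
  -- The case `g = 1` gives `volume B = 2 K`, hence the factor `1 / 2`.
  have hvol := hmain (fun _ => 1) measurable_const
  simp only [lintegral_const, measure_univ, mul_one, Measure.restrict_apply MeasurableSet.univ,
    univ_inter, Real.volume_Ioo, one_mul] at hvol
  have h2 := hmain g hg
  rw [hvol, mul_assoc, ENNReal.mul_right_inj hK0 hK1] at h2
  rw [← h2, ← mul_assoc, ← ENNReal.ofReal_mul (by norm_num)]
  norm_num

/-- Haar measure in Euler angles. -/
theorem lintegral_haar_euler {g : SO3 → ℝ≥0∞} (hg : Measurable g) :
    ∫⁻ M, g M ∂μ = ENNReal.ofReal (1 / (8 * Real.pi ^ 2)) *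
      ∫⁻ c in Ioo (-1) 1, ∫⁻ φ in Ioo (-Real.pi) Real.pi, ∫⁻ ψ in Ioo (-Real.pi) Real.pi,
        g (eulerSO3 φ c ψ) := by
  have hrz := continuous_rz.measurable
  have hry := continuous_ry.measurable
  set κ := (volume.restrict (Ioo (-Real.pi) Real.pi) : Measure ℝ) with hκ
  have hκu : κ univ = ENNReal.ofReal (2 * Real.pi) := by
    rw [hκ, Measure.restrict_apply MeasurableSet.univ, univ_inter, Real.volume_Ioo]; congr 1; ring
  -- By two-sided invariance the integral may be averaged over left and right rotations about the
  -- third axis.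
  have h1 : ∀ φ ψ : ℝ, ∫⁻ M, g (rz φ * M * rz ψ) ∂μ = ∫⁻ M, g M ∂μ := by
    intro φ ψ
    rw [lintegral_mul_left_eq_self (fun M => g (M * rz ψ)), lintegral_mul_right_eq_self g]
  have h2 : ∫⁻ φ, ∫⁻ ψ, ∫⁻ M, g (rz φ * M * rz ψ) ∂μ ∂κ ∂κ =
      ENNReal.ofReal (2 * Real.pi) ^ 2 * ∫⁻ M, g M ∂μ := by
    simp_rw [h1]
    rw [lintegral_const, lintegral_const, hκu]
    ring
  have h3 : ∫⁻ φ, ∫⁻ ψ, ∫⁻ M, g (rz φ * M * rz ψ) ∂μ ∂κ ∂κ =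
      ∫⁻ M, ∫⁻ φ, ∫⁻ ψ, g (rz φ * M * rz ψ) ∂κ ∂κ ∂μ := by
    have e1 : ∀ φ, ∫⁻ ψ, ∫⁻ M, g (rz φ * M * rz ψ) ∂μ ∂κ = ∫⁻ M, ∫⁻ ψ, g (rz φ * M * rz ψ) ∂κ ∂μ :=
      fun φ => lintegral_lintegral_swap (by
        refine Measurable.aemeasurable (hg.comp ?_)
        fun_prop)
    simp_rw [e1]
    refine lintegral_lintegral_swap (Measurable.aemeasurable ?_)
    refine Measurable.lintegral_prod_right' (f := fun y : (ℝ × SO3) × ℝ => g (rz y.1.1 * y.1.2 * rz y.2)) ?_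
    exact hg.comp (by fun_prop)
  -- The outer factors of an Euler decomposition of `M` only shift the periodic averages. The
  -- averaged integrand thus depends on `M` through its last entry alone, whose law is known.
  have h4 : ∀ M : SO3, ∫⁻ φ, ∫⁻ ψ, g (rz φ * M * rz ψ) ∂κ ∂κ =
      ∫⁻ φ, ∫⁻ ψ, g (eulerSO3 φ (M.1 2 2) ψ) ∂κ ∂κ := by
    intro M
    obtain ⟨a, b, hM⟩ := exists_euler M
    set N := ry (Real.arccos (M.1 2 2)) with hN
    have e1 : ∀ φ, ∫⁻ ψ, g (rz φ * M * rz ψ) ∂κ = ∫⁻ ψ, g (rz (φ + a) * N * rz ψ) ∂κ := by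
      intro φ
      rw [← setLIntegral_add_of_periodic (f := fun ψ => g (rz (φ + a) * N * rz ψ))
        (fun x => by rw [rz_add_two_pi]) b]
      refine lintegral_congr fun ψ => ?_
      rw [hM, add_comm ψ b, rz_add, rz_add]
      simp only [mul_assoc]
    simp_rw [e1]
    exact setLIntegral_add_of_periodic (f := fun φ => ∫⁻ ψ, g (rz φ * N * rz ψ) ∂κ)
        (fun x => by simp only [rz_add_two_pi]) a
  have h5 : Measurable fun c : ℝ => ∫⁻ φ, ∫⁻ ψ, g (eulerSO3 φ c ψ) ∂κ ∂κ := by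
    have hm : Measurable fun y : (ℝ × ℝ) × ℝ => g (eulerSO3 y.1.2 y.1.1 y.2) := by
      refine hg.comp ?_
      exact (continuous_eulerSO3.comp (by fun_prop : Continuous fun y : (ℝ × ℝ) × ℝ =>
        (y.1.2, y.1.1, y.2))).measurable
    exact Measurable.lintegral_prod_right' (f := fun y : ℝ × ℝ => ∫⁻ ψ, g (eulerSO3 y.2 y.1 ψ) ∂κ)
      (Measurable.lintegral_prod_right' hm)
  rw [h3] at h2
  simp_rw [h4] at h2
  rw [lintegral_haar_last_entry μ h5] at h2
  have h6 : ENNReal.ofReal (2 * Real.pi) ^ 2 ≠ 0 := by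
    have := Real.pi_pos
    simp [this]
  have h7 : ENNReal.ofReal (2 * Real.pi) ^ 2 ≠ ∞ := by simp [ENNReal.mul_eq_top]
  rw [← ENNReal.mul_right_inj h6 h7, ← h2, ← mul_assoc, ← ENNReal.ofReal_pow (by positivity),
    ← ENNReal.ofReal_mul (by positivity)]
  congr 2
  have := Real.pi_pos
  field_simp
  norm_num

end haar

end

/-! ### The law of `(P, Q)` in Euler angles -/

section

open scoped ENNReal

/-- The values of `P` and `Q` in terms of `((φ, c), ψ)`. -/
def eulerPQ (α β : Fin 3 → ℝ) (y : (ℝ × ℝ) × ℝ) : ℝ × ℝ :=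
  (polyP α β (Real.cos y.1.1 ^ 2) (Real.cos y.2 ^ 2) (trigFactor y.1.1 y.2) y.1.2,
    polyQ α β (Real.cos y.1.1 ^ 2) (Real.cos y.2 ^ 2) (trigFactor y.1.1 y.2) y.1.2)

/-- The domain `0 < φ < π / 2`, `-1 < c < 1`, `0 < ψ < π / 2`. -/
def eulerDomain : Set ((ℝ × ℝ) × ℝ) :=
  (Ioo 0 (Real.pi / 2) ×ˢ Ioo (-1) 1) ×ˢ Ioo 0 (Real.pi / 2)

theorem measurableSet_eulerDomain : MeasurableSet eulerDomain :=
  (measurableSet_Ioo.prod measurableSet_Ioo).prod measurableSet_Ioo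

theorem continuous_eulerPQ (α β : Fin 3 → ℝ) : Continuous (eulerPQ α β) := by
  unfold eulerPQ polyP polyQ aP eP aQ eQ trigFactor
  fun_prop

theorem PQ_eulerSO3 {α β : Fin 3 → ℝ} (hα0 : α 0 + α 1 + α 2 = 0) (hβ0 : β 0 + β 1 + β 2 = 0)
    {c : ℝ} (hc : c ∈ Icc (-1) 1) (φ ψ : ℝ) : PQ α β (eulerSO3 φ c ψ) = eulerPQ α β ((φ, c), ψ) := by
  have h : (eulerSO3 φ c ψ).1 = rotZ φ * rotY (Real.arccos c) * rotZ ψ := rfl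
  rw [PQ, h, coeffP_euler α β hα0 hβ0, coeffQ_euler α β hα0 hβ0, Real.cos_arccos hc.1 hc.2]
  rfl

theorem continuous_PQ (α β : Fin 3 → ℝ) : Continuous (PQ α β) := by
  have h : ∀ i j, Continuous fun M : SO3 => sumMatrix α β M.1 i j := by
    intro i j
    have : Continuous fun M : SO3 => sumMatrix α β M.1 := by
      unfold sumMatrix
      fun_prop
    exact this.matrix_elem i j
  unfold PQ coeffP coeffQ
  simp_rw [charpoly_coeff_one, charpoly_coeff_zero, Matrix.det_fin_three]
  fun_prop

theorem lintegral_fold {f : ℝ → ℝ≥0∞} (hf : ∀ x, f (-x) = f x) (hf' : ∀ x, f (x + Real.pi) = f x) :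
    ∫⁻ x in Ioo (-Real.pi) Real.pi, f x = 4 * ∫⁻ x in Ioo 0 (Real.pi / 2), f x := by
  have hpi := Real.pi_pos
  have h1 : ∫⁻ x in Ioo (Real.pi / 2) Real.pi, f x = ∫⁻ x in Ioo 0 (Real.pi / 2), f x := by
    rw [← (Measure.measurePreserving_sub_left volume Real.pi).setLIntegral_comp_preimage_emb
      (MeasurableEquiv.subLeft Real.pi).measurableEmbedding f (Ioo (Real.pi / 2) Real.pi)]
    have e : (fun x => Real.pi - x) ⁻¹' Ioo (Real.pi / 2) Real.pi = Ioo 0 (Real.pi / 2) := by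
      ext x; simp only [mem_preimage, mem_Ioo]; constructor <;> rintro ⟨_, _⟩ <;> constructor <;> linarith
    rw [e]
    refine lintegral_congr fun x => ?_
    rw [sub_eq_neg_add, hf', hf]
  have h2 : ∫⁻ x in Ioo (-Real.pi) 0, f x = ∫⁻ x in Ioo 0 Real.pi, f x := by
    rw [← (Measure.measurePreserving_neg (volume : Measure ℝ)).setLIntegral_comp_preimage_emb
      (MeasurableEquiv.neg ℝ).measurableEmbedding f (Ioo (-Real.pi) 0)]
    have e : Neg.neg ⁻¹' Ioo (-Real.pi) 0 = Ioo 0 Real.pi := by simp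
    rw [e]
    exact lintegral_congr fun x => hf x
  have h3 : ∀ {a b c : ℝ}, a ≤ b → b ≤ c → ∫⁻ x in Ioo a c, f x =
      (∫⁻ x in Ioo a b, f x) + ∫⁻ x in Ioo b c, f x := by
    intro a b c hab hbc
    rw [setLIntegral_congr (Ioo_ae_eq_Ioc (a := a) (b := c)),
      setLIntegral_congr (Ioo_ae_eq_Ioc (a := a) (b := b)),
      setLIntegral_congr (Ioo_ae_eq_Ioc (a := b) (b := c)), ← Ioc_union_Ioc_eq_Ioc hab hbc,
      lintegral_union measurableSet_Ioc (Ioc_disjoint_Ioc_of_le le_rfl)]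
  rw [h3 (by linarith : -Real.pi ≤ 0) hpi.le, h2,
    h3 (by linarith : 0 ≤ Real.pi / 2) (by linarith : Real.pi / 2 ≤ Real.pi), h1]
  ring

theorem eulerPQ_neg_left (α β : Fin 3 → ℝ) (φ c ψ : ℝ) :
    eulerPQ α β ((-φ, c), ψ) = eulerPQ α β ((φ, -c), ψ) := by
  simp [eulerPQ, polyP, polyQ, trigFactor]

theorem eulerPQ_neg_right (α β : Fin 3 → ℝ) (φ c ψ : ℝ) :
    eulerPQ α β ((φ, c), -ψ) = eulerPQ α β ((φ, -c), ψ) := by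
  simp [eulerPQ, polyP, polyQ, trigFactor]

theorem eulerPQ_add_pi_left (α β : Fin 3 → ℝ) (φ c ψ : ℝ) :
    eulerPQ α β ((φ + Real.pi, c), ψ) = eulerPQ α β ((φ, c), ψ) := by
  simp [eulerPQ, trigFactor]

theorem eulerPQ_add_pi_right (α β : Fin 3 → ℝ) (φ c ψ : ℝ) :
    eulerPQ α β ((φ, c), ψ + Real.pi) = eulerPQ α β ((φ, c), ψ) := by
  simp [eulerPQ, trigFactor]

theorem lintegral_Ioo_neg (f : ℝ → ℝ≥0∞) :
    ∫⁻ c in Ioo (-1) 1, f (-c) = ∫⁻ c in Ioo (-1) 1, f c := by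
  have := (Measure.measurePreserving_neg (volume : Measure ℝ)).setLIntegral_comp_preimage_emb
      (MeasurableEquiv.neg ℝ).measurableEmbedding f (Ioo (-1) 1)
  have e : Neg.neg ⁻¹' Ioo (-1 : ℝ) 1 = Ioo (-1) 1 := by simp
  rw [e] at this
  exact this

section haar

variable [MeasurableSpace SO3] [BorelSpace SO3] (μ : Measure SO3) [μ.IsHaarMeasure]
  [IsProbabilityMeasure μ]

/-- The law of `(P, Q)` in Euler angles. -/
theorem map_PQ_eq {α β : Fin 3 → ℝ} (hα0 : α 0 + α 1 + α 2 = 0) (hβ0 : β 0 + β 1 + β 2 = 0) :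
    μ.map (PQ α β) = ENNReal.ofReal (2 / Real.pi ^ 2) •
      (volume.restrict eulerDomain).map (eulerPQ α β) := by
  refine Measure.ext_of_lintegral _ fun g hg => ?_
  have hPQ := (continuous_PQ α β).measurable
  have hE := (continuous_eulerPQ α β).measurable
  rw [lintegral_map hg hPQ, lintegral_smul_measure, lintegral_map hg hE,
    lintegral_haar_euler μ (g := fun M => g (PQ α β M)) (hg.comp hPQ)]
  set κ := (volume.restrict (Ioo (-Real.pi) Real.pi) : Measure ℝ)
  set κ' := (volume.restrict (Ioo 0 (Real.pi / 2)) : Measure ℝ) with hκ'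
  set τ := (volume.restrict (Ioo (-1) 1) : Measure ℝ) with hτ
  have hm : ∀ {γ : Type} [MeasurableSpace γ] {a b d : γ → ℝ}, Measurable a → Measurable b →
      Measurable d → Measurable fun x => g (eulerPQ α β ((a x, b x), d x)) :=
    fun ha hb hd => hg.comp (hE.comp ((ha.prodMk hb).prodMk hd))
  have h1 : ∫⁻ c, ∫⁻ φ, ∫⁻ ψ, g (PQ α β (eulerSO3 φ c ψ)) ∂κ ∂κ ∂τ =
      ∫⁻ c, ∫⁻ φ, ∫⁻ ψ, g (eulerPQ α β ((φ, c), ψ)) ∂κ ∂κ ∂τ := by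
    refine setLIntegral_congr_fun measurableSet_Ioo fun c hc => ?_
    simp only [PQ_eulerSO3 hα0 hβ0 (Ioo_subset_Icc_self hc)]
  -- The integral over `c` goes innermost because a change of sign of `φ` or `ψ` reverses `s`, which
  -- `c ↦ -c` compensates. Each angle then folds onto a quarter circle, and the constant becomes `16
  -- / (8π²) = 2 / π²`.
  have h2 : ∫⁻ c, ∫⁻ φ, ∫⁻ ψ, g (eulerPQ α β ((φ, c), ψ)) ∂κ ∂κ ∂τ =
      ∫⁻ φ, ∫⁻ ψ, ∫⁻ c, g (eulerPQ α β ((φ, c), ψ)) ∂τ ∂κ ∂κ := by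
    rw [lintegral_lintegral_swap]
    · refine lintegral_congr fun φ => ?_
      exact lintegral_lintegral_swap (hm (by fun_prop) (by fun_prop) (by fun_prop)).aemeasurable
    · refine Measurable.aemeasurable (Measurable.lintegral_prod_right'
        (f := fun y : (ℝ × ℝ) × ℝ => g (eulerPQ α β ((y.1.2, y.1.1), y.2))) ?_)
      exact hm (by fun_prop) (by fun_prop) (by fun_prop)
  have h3 : ∀ φ, ∫⁻ ψ, ∫⁻ c, g (eulerPQ α β ((φ, c), ψ)) ∂τ ∂κ =
      4 * ∫⁻ ψ, ∫⁻ c, g (eulerPQ α β ((φ, c), ψ)) ∂τ ∂κ' := by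
    intro φ
    refine lintegral_fold (fun ψ => ?_) (fun ψ => ?_)
    · simp only [eulerPQ_neg_right]
      exact lintegral_Ioo_neg fun c => g (eulerPQ α β ((φ, c), ψ))
    · simp only [eulerPQ_add_pi_right]
  have h4 : ∫⁻ φ, ∫⁻ ψ, ∫⁻ c, g (eulerPQ α β ((φ, c), ψ)) ∂τ ∂κ' ∂κ =
      4 * ∫⁻ φ, ∫⁻ ψ, ∫⁻ c, g (eulerPQ α β ((φ, c), ψ)) ∂τ ∂κ' ∂κ' := by
    refine lintegral_fold (fun φ => lintegral_congr fun ψ => ?_)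
      (fun φ => lintegral_congr fun ψ => ?_)
    · simp only [eulerPQ_neg_left]
      exact lintegral_Ioo_neg fun c => g (eulerPQ α β ((φ, c), ψ))
    · simp only [eulerPQ_add_pi_left]
  have h5 : ∫⁻ y in eulerDomain, g (eulerPQ α β y) =
      ∫⁻ φ, ∫⁻ ψ, ∫⁻ c, g (eulerPQ α β ((φ, c), ψ)) ∂τ ∂κ' ∂κ' := by
    have e1 : (volume.restrict eulerDomain : Measure ((ℝ × ℝ) × ℝ)) = (κ'.prod τ).prod κ' := by
      rw [eulerDomain, hκ', hτ, Measure.prod_restrict, Measure.prod_restrict]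
      rfl
    rw [e1, lintegral_prod (fun y => g (eulerPQ α β y)) (hg.comp hE).aemeasurable, lintegral_prod]
    · refine lintegral_congr fun φ => ?_
      exact lintegral_lintegral_swap (hm (by fun_prop) (by fun_prop) (by fun_prop)).aemeasurable
    · refine Measurable.aemeasurable (Measurable.lintegral_prod_right'
        (f := fun y : (ℝ × ℝ) × ℝ => g (eulerPQ α β y)) (hg.comp hE))
  have h6 : (4 : ℝ≥0∞) ≠ ∞ := by simp
  rw [h1, h2]
  simp_rw [h3]
  rw [lintegral_const_mul' _ _ h6, h4, h5, ← mul_assoc, ← mul_assoc, smul_eq_mul]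
  congr 1
  rw [show (4 : ℝ≥0∞) = ENNReal.ofReal 4 by simp, ← ENNReal.ofReal_mul (by positivity),
    ← ENNReal.ofReal_mul (by positivity)]
  congr 1
  have := Real.pi_pos
  field_simp
  norm_num

end haar

end

/-! ### The Jacobian in `(φ, c)` and the derivative of the resultant -/

section

open scoped ENNReal

/-- The derivative of `aP` in `u`. -/
def aPu (α β : Fin 3 → ℝ) (z : ℝ) : ℝ := -((α 0 - α 1) * (β 0 + 2 * β 1 + (β 0 - β 1) * z))

/-- The derivative of `eP` in `u`. -/
def ePu (α β : Fin 3 → ℝ) (z : ℝ) : ℝ :=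
  (α 0 - α 1) * (β 1 + 2 * β 0) - z * (α 0 - α 1) * (β 0 - β 1)

/-- The derivative of `aQ` in `u`. -/
def aQu (α β : Fin 3 → ℝ) (z : ℝ) : ℝ :=
  -((α 0 - α 1) * (α 0 + α 1 - β 0) * (β 0 + 2 * β 1))
    - (α 0 - α 1) * (β 0 - β 1) * (α 0 + α 1 + β 0 + β 1) * z

/-- The derivative of `eQ` in `u`. -/
def eQu (α β : Fin 3 → ℝ) (z : ℝ) : ℝ :=
  (α 0 - α 1) * (α 0 + α 1 - β 1) * (2 * β 0 + β 1)
    - (α 0 - α 1) * (β 0 - β 1) * (α 0 + α 1 + β 0 + β 1) * z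

/-- The derivative of `P` in `φ`. -/
def polyPφ (α β : Fin 3 → ℝ) (φ ψ c : ℝ) : ℝ :=
  -(2 * Real.cos φ * Real.sin φ) * (aPu α β (Real.cos ψ ^ 2) * c ^ 2 + ePu α β (Real.cos ψ ^ 2))
    + Real.cos ψ * Real.sin ψ * (Real.cos φ ^ 2 - Real.sin φ ^ 2) * bP α β * c

/-- The derivative of `Q` in `φ`. -/
def polyQφ (α β : Fin 3 → ℝ) (φ ψ c : ℝ) : ℝ :=
  -(2 * Real.cos φ * Real.sin φ) * (aQu α β (Real.cos ψ ^ 2) * c ^ 2 + eQu α β (Real.cos ψ ^ 2))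
    + Real.cos ψ * Real.sin ψ * (Real.cos φ ^ 2 - Real.sin φ ^ 2) * bQ α β * c

/-- The derivative of `P` in `c`. -/
def polyPc (α β : Fin 3 → ℝ) (φ ψ c : ℝ) : ℝ :=
  2 * aP α β (Real.cos φ ^ 2) (Real.cos ψ ^ 2) * c + trigFactor φ ψ * bP α β

/-- The derivative of `Q` in `c`. -/
def polyQc (α β : Fin 3 → ℝ) (φ ψ c : ℝ) : ℝ :=
  2 * aQ α β (Real.cos φ ^ 2) (Real.cos ψ ^ 2) * c + trigFactor φ ψ * bQ α β

/-- The Jacobian of `(P, Q)` in `(φ, c)`. -/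
def jac (α β : Fin 3 → ℝ) (φ ψ c : ℝ) : ℝ :=
  polyPφ α β φ ψ c * polyQc α β φ ψ c - polyQφ α β φ ψ c * polyPc α β φ ψ c

theorem hasDerivAt_cos_sq (φ : ℝ) :
    HasDerivAt (fun φ => Real.cos φ ^ 2) (-(2 * Real.cos φ * Real.sin φ)) φ := by
  exact ((Real.hasDerivAt_cos φ).pow 2).congr_deriv (by simp)

theorem hasDerivAt_trigFactor (φ ψ : ℝ) : HasDerivAt (fun φ => trigFactor φ ψ)
    (Real.cos ψ * Real.sin ψ * (Real.cos φ ^ 2 - Real.sin φ ^ 2)) φ := by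
  unfold trigFactor
  exact ((((Real.hasDerivAt_cos φ).mul_const (Real.cos ψ)).mul (Real.hasDerivAt_sin φ)).mul_const
    (Real.sin ψ)).congr_deriv (by ring)

theorem hasDerivAt_quadratic_angle (a0 a1 e0 e1 b φ ψ c : ℝ) {f : ℝ → ℝ}
    (hf : ∀ φ, f φ = (a0 + a1 * Real.cos φ ^ 2) * c ^ 2 + trigFactor φ ψ * b * c
      + (e0 + e1 * Real.cos φ ^ 2)) :
    HasDerivAt f (-(2 * Real.cos φ * Real.sin φ) * (a1 * c ^ 2 + e1)
    + Real.cos ψ * Real.sin ψ * (Real.cos φ ^ 2 - Real.sin φ ^ 2) * b * c) φ := by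
  have hu := hasDerivAt_cos_sq φ
  have hs := hasDerivAt_trigFactor φ ψ
  rw [show f = _ from funext hf]
  exact (((((hu.const_mul a1).const_add a0).mul_const (c ^ 2)).add
    ((hs.mul_const b).mul_const c)).add ((hu.const_mul e1).const_add e0)).congr_deriv (by ring)

theorem aP_affine (α β : Fin 3 → ℝ) (u z : ℝ) : aP α β u z = aP α β 0 z + aPu α β z * u := by
  simp only [aP, aPu]; ring

theorem aQ_affine (α β : Fin 3 → ℝ) (u z : ℝ) : aQ α β u z = aQ α β 0 z + aQu α β z * u := by
  simp only [aQ, aQu]; ring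

theorem eP_affine (α β : Fin 3 → ℝ) (p u z : ℝ) : eP α β p u z = eP α β p 0 z + ePu α β z * u := by
  simp only [eP, ePu]; ring

theorem eQ_affine (α β : Fin 3 → ℝ) (q u z : ℝ) : eQ α β q u z = eQ α β q 0 z + eQu α β z * u := by
  simp only [eQ, eQu]; ring

theorem hasDerivAt_polyP_angle (α β : Fin 3 → ℝ) (φ ψ c : ℝ) :
    HasDerivAt (fun φ => polyP α β (Real.cos φ ^ 2) (Real.cos ψ ^ 2) (trigFactor φ ψ) c)
      (polyPφ α β φ ψ c) φ := by
  refine hasDerivAt_quadratic_angle (aP α β 0 (Real.cos ψ ^ 2)) _ (eP α β 0 0 (Real.cos ψ ^ 2)) _ _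
    φ ψ c fun φ => ?_
  rw [polyP, aP_affine, eP_affine]

theorem hasDerivAt_polyQ_angle (α β : Fin 3 → ℝ) (φ ψ c : ℝ) :
    HasDerivAt (fun φ => polyQ α β (Real.cos φ ^ 2) (Real.cos ψ ^ 2) (trigFactor φ ψ) c)
      (polyQφ α β φ ψ c) φ := by
  refine hasDerivAt_quadratic_angle (aQ α β 0 (Real.cos ψ ^ 2)) _ (eQ α β 0 0 (Real.cos ψ ^ 2)) _ _
    φ ψ c fun φ => ?_
  rw [polyQ, aQ_affine, eQ_affine]

theorem hasDerivAt_quadratic (a b e c : ℝ) :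
    HasDerivAt (fun c => a * c ^ 2 + b * c + e) (2 * a * c + b) c := by
  exact ((((hasDerivAt_pow 2 c).const_mul a).add ((hasDerivAt_id c).const_mul b)).add_const
    e).congr_deriv (by simp; ring)

theorem hasDerivAt_polyP (α β : Fin 3 → ℝ) (φ ψ c : ℝ) :
    HasDerivAt (fun c => polyP α β (Real.cos φ ^ 2) (Real.cos ψ ^ 2) (trigFactor φ ψ) c)
      (polyPc α β φ ψ c) c := hasDerivAt_quadratic _ _ _ _

theorem hasDerivAt_polyQ (α β : Fin 3 → ℝ) (φ ψ c : ℝ) :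
    HasDerivAt (fun c => polyQ α β (Real.cos φ ^ 2) (Real.cos ψ ^ 2) (trigFactor φ ψ) c)
      (polyQc α β φ ψ c) c := hasDerivAt_quadratic _ _ _ _

/-- The derivative of the resultant in `φ` at a common root. -/
theorem resPQ_deriv_eq_jac {α β : Fin 3 → ℝ} {p q φ ψ c R : ℝ}
    (hR : HasDerivAt (fun u => resPQ α β p q u (Real.cos ψ ^ 2)) R (Real.cos φ ^ 2))
    (hP : polyP α β (Real.cos φ ^ 2) (Real.cos ψ ^ 2) (trigFactor φ ψ) c = p)
    (hQ : polyQ α β (Real.cos φ ^ 2) (Real.cos ψ ^ 2) (trigFactor φ ψ) c = q) :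
    R * (2 * Real.cos φ * Real.sin φ) =
      trigFactor φ ψ * Btilde α β (Real.cos φ ^ 2) (Real.cos ψ ^ 2) * jac α β φ ψ c := by
  have h1 : HasDerivAt (fun φ => resPQ α β p q (Real.cos φ ^ 2) (Real.cos ψ ^ 2))
      (R * (-(2 * Real.cos φ * Real.sin φ))) φ :=
    HasDerivAt.comp_of_eq φ hR (hasDerivAt_cos_sq φ) rfl
  have hu := hasDerivAt_cos_sq φ
  have hs := hasDerivAt_trigFactor φ ψ
  have hp := (hasDerivAt_polyP_angle α β φ ψ c).sub_const p
  have hq := (hasDerivAt_polyQ_angle α β φ ψ c).sub_const q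
  have haQ : HasDerivAt (fun φ => aQ α β (Real.cos φ ^ 2) (Real.cos ψ ^ 2))
      (aQu α β (Real.cos ψ ^ 2) * (-(2 * Real.cos φ * Real.sin φ))) φ := by
    rw [funext fun φ => aQ_affine α β (Real.cos φ ^ 2) (Real.cos ψ ^ 2)]
    exact (hu.const_mul _).const_add _
  have haP : HasDerivAt (fun φ => aP α β (Real.cos φ ^ 2) (Real.cos ψ ^ 2))
      (aPu α β (Real.cos ψ ^ 2) * (-(2 * Real.cos φ * Real.sin φ))) φ := by
    rw [funext fun φ => aP_affine α β (Real.cos φ ^ 2) (Real.cos ψ ^ 2)]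
    exact (hu.const_mul _).const_add _
  have hB : HasDerivAt (fun φ => Btilde α β (Real.cos φ ^ 2) (Real.cos ψ ^ 2))
      ((aQu α β (Real.cos ψ ^ 2) * bP α β - aPu α β (Real.cos ψ ^ 2) * bQ α β) *
        (-(2 * Real.cos φ * Real.sin φ))) φ := by
    simp_rw [Btilde_eq]
    exact ((haQ.mul_const _).sub (haP.mul_const _)).congr_deriv (by ring)
  have h2 := (((haQ.mul hp).sub (haP.mul hq)).pow 2).sub ((hs.mul hB).mul
    ((hp.mul (((haQ.const_mul 2).mul_const c).add (hs.mul_const (bQ α β)))).sub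
      (hq.mul (((haP.const_mul 2).mul_const c).add (hs.mul_const (bP α β))))))
  -- `resPQ_eq` is used with `c` frozen at the common root. There the square has zero derivative,
  -- and in the other term only the derivatives of `P - p` and `Q - q` survive: they make up `jac`.
  have h3 : (fun φ => resPQ α β p q (Real.cos φ ^ 2) (Real.cos ψ ^ 2)) = _ :=
    funext fun φ => resPQ_eq α β p q (Real.cos φ ^ 2) (Real.cos ψ ^ 2) (trigFactor φ ψ) c
      (trigFactor_sq φ ψ)
  rw [h3] at h1
  have h4 := h1.unique h2
  simp only [Pi.sub_apply, Pi.mul_apply, Pi.add_apply, hP, hQ, sub_self, mul_zero, zero_mul, add_zero,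
    zero_add] at h4
  rw [jac, polyPc, polyQc]
  linear_combination -h4

theorem continuous_jac (α β : Fin 3 → ℝ) :
    Continuous fun y : (ℝ × ℝ) × ℝ => jac α β y.1.1 y.2 y.1.2 := by
  unfold jac polyPφ polyQφ polyPc polyQc trigFactor aPu aQu ePu eQu aP aQ
  fun_prop

/-- The matrix is block triangular with last block `1`, because the third coordinate is kept. -/
theorem det_prod_fst (L : (ℝ × ℝ) × ℝ →L[ℝ] (ℝ × ℝ) × ℝ) (hL : ∀ x, (L x).2 = x.2) :
    L.det = (L ((1, 0), 0)).1.1 * (L ((0, 1), 0)).1.2 - (L ((1, 0), 0)).1.2 * (L ((0, 1), 0)).1.1 := by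
  let b := (Module.Basis.finTwoProd ℝ).prod (Module.Basis.singleton Unit ℝ)
  have e : LinearMap.toMatrix b b (L : (ℝ × ℝ) × ℝ →ₗ[ℝ] (ℝ × ℝ) × ℝ) = Matrix.fromBlocks
      !![(L ((1, 0), 0)).1.1, (L ((0, 1), 0)).1.1; (L ((1, 0), 0)).1.2, (L ((0, 1), 0)).1.2]
      (Matrix.of fun i _ => ![(L (0, 1)).1.1, (L (0, 1)).1.2] i) 0 1 := by
    ext i j
    rcases i with i | i <;> rcases j with j | j
    · fin_cases i <;> fin_cases j <;> simp [b, LinearMap.toMatrix_apply]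
    · fin_cases i <;> simp [b, LinearMap.toMatrix_apply]
    · fin_cases j <;> simp [b, LinearMap.toMatrix_apply, hL]
    · simp [b, LinearMap.toMatrix_apply, hL]
  rw [ContinuousLinearMap.det, ← LinearMap.det_toMatrix b, e, Matrix.det_fromBlocks_zero₂₁,
    Matrix.det_fin_two, Matrix.det_one]
  simp
  ring

/-- The map `((φ, c), ψ) ↦ ((P, Q), ψ)`. -/
def eulerPQψ (α β : Fin 3 → ℝ) (y : (ℝ × ℝ) × ℝ) : (ℝ × ℝ) × ℝ := (eulerPQ α β y, y.2)

theorem differentiable_eulerPQψ (α β : Fin 3 → ℝ) : Differentiable ℝ (eulerPQψ α β) := by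
  unfold eulerPQψ eulerPQ polyP polyQ aP eP aQ eQ trigFactor
  fun_prop

theorem det_fderiv_eulerPQψ (α β : Fin 3 → ℝ) (y : (ℝ × ℝ) × ℝ) :
    (fderiv ℝ (eulerPQψ α β) y).det = jac α β y.1.1 y.2 y.1.2 := by
  obtain ⟨⟨φ, c⟩, ψ⟩ := y
  set L := fderiv ℝ (eulerPQψ α β) ((φ, c), ψ) with hL
  have hd : HasFDerivAt (eulerPQψ α β) L ((φ, c), ψ) := (differentiable_eulerPQψ α β _).hasFDerivAt
  have h1 : ∀ x, (L x).2 = x.2 := by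
    intro x
    have h : HasFDerivAt (fun y : (ℝ × ℝ) × ℝ => y.2)
        ((ContinuousLinearMap.snd ℝ (ℝ × ℝ) ℝ).comp L) ((φ, c), ψ) := hd.snd
    have := h.unique hasFDerivAt_snd
    exact congrFun (congrArg DFunLike.coe this) x
  have h2 : L ((1, 0), 0) = ((polyPφ α β φ ψ c, polyQφ α β φ ψ c), 0) := by
    have hc : HasDerivAt (fun φ : ℝ => (((φ, c), ψ) : (ℝ × ℝ) × ℝ)) ((1, 0), 0) φ :=
      ((hasDerivAt_id φ).prodMk (hasDerivAt_const φ c)).prodMk (hasDerivAt_const φ ψ)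
    have h := hd.comp_hasDerivAt φ hc
    exact h.unique (((hasDerivAt_polyP_angle α β φ ψ c).prodMk
      (hasDerivAt_polyQ_angle α β φ ψ c)).prodMk (hasDerivAt_const φ ψ))
  have h3 : L ((0, 1), 0) = ((polyPc α β φ ψ c, polyQc α β φ ψ c), 0) := by
    have hc : HasDerivAt (fun c : ℝ => (((φ, c), ψ) : (ℝ × ℝ) × ℝ)) ((0, 1), 0) c :=
      ((hasDerivAt_const c φ).prodMk (hasDerivAt_id c)).prodMk (hasDerivAt_const c ψ)
    have h := hd.comp_hasDerivAt c hc
    exact h.unique (((hasDerivAt_polyP α β φ ψ c).prodMk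
      (hasDerivAt_polyQ α β φ ψ c)).prodMk (hasDerivAt_const c ψ))
  rw [det_prod_fst L h1, h2, h3, jac]

end

/-! ### The Jacobian is almost everywhere non-zero -/

section

open scoped ENNReal

theorem finite_cubic_zeros {a b c d : ℝ} (h : a ≠ 0 ∨ b ≠ 0 ∨ c ≠ 0 ∨ d ≠ 0) :
    {x : ℝ | a * x ^ 3 + b * x ^ 2 + c * x + d = 0}.Finite := by
  have hf : (C a * X ^ 3 + C b * X ^ 2 + C c * X + C d : ℝ[X]) ≠ 0 := by
    intro h0
    have h3 := congrArg (fun f : ℝ[X] => f.coeff 3) h0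
    have h2 := congrArg (fun f : ℝ[X] => f.coeff 2) h0
    have h1 := congrArg (fun f : ℝ[X] => f.coeff 1) h0
    have h00 := congrArg (fun f : ℝ[X] => f.coeff 0) h0
    simp only [coeff_add, coeff_C_mul, coeff_X_pow, coeff_X, coeff_C, coeff_zero] at h3 h2 h1 h00
    norm_num at h3 h2 h1 h00
    tauto
  refine (Polynomial.finite_setOfPred_isRoot hf).subset fun x hx => ?_
  simpa [Polynomial.IsRoot] using hx

theorem injOn_cos_sq : InjOn (fun φ : ℝ => Real.cos φ ^ 2) (Ioo 0 (Real.pi / 2)) := by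
  intro x hx y hy hxy
  have hpi := Real.pi_pos
  have h1 : 0 ≤ Real.cos x := (Real.cos_pos_of_mem_Ioo ⟨by linarith [hx.1], hx.2⟩).le
  have h2 : 0 ≤ Real.cos y := (Real.cos_pos_of_mem_Ioo ⟨by linarith [hy.1], hy.2⟩).le
  have h3 : Real.cos x = Real.cos y := by
    have : Real.cos x ^ 2 = Real.cos y ^ 2 := hxy
    exact (pow_left_inj₀ h1 h2 two_ne_zero).1 this
  exact Real.injOn_cos ⟨hx.1.le, by linarith [hx.2]⟩ ⟨hy.1.le, by linarith [hy.2]⟩ h3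

theorem cos_sq_mem_Ioo {φ : ℝ} (h : φ ∈ Ioo 0 (Real.pi / 2)) : Real.cos φ ^ 2 ∈ Ioo 0 1 := by
  have h1 : 0 < Real.cos φ := Real.cos_pos_of_mem_Ioo ⟨by linarith [h.1, Real.pi_pos], h.2⟩
  have h2 : 0 < Real.sin φ := Real.sin_pos_of_mem_Ioo ⟨h.1, by linarith [h.2, Real.pi_pos]⟩
  have h3 := Real.sin_sq_add_cos_sq φ
  constructor
  · positivity
  · nlinarith [mul_pos h2 h2]

theorem image_cos_sq : (fun φ : ℝ => Real.cos φ ^ 2) '' Ioo 0 (Real.pi / 2) = Ioo 0 1 := by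
  refine Subset.antisymm (image_subset_iff.2 fun φ h => cos_sq_mem_Ioo h) fun u hu => ?_
  have h1 : 0 < Real.sqrt u := Real.sqrt_pos.2 hu.1
  have h2 : Real.sqrt u < 1 := by rw [Real.sqrt_lt' one_pos]; simpa using hu.2
  refine ⟨Real.arccos (Real.sqrt u), ⟨Real.arccos_pos.2 h2, Real.arccos_lt_pi_div_two.2 h1⟩, ?_⟩
  simp only [Real.cos_arccos (by linarith : -1 ≤ Real.sqrt u) h2.le, Real.sq_sqrt hu.1.le]

theorem trigFactor_pos {φ ψ : ℝ} (hφ : φ ∈ Ioo 0 (Real.pi / 2)) (hψ : ψ ∈ Ioo 0 (Real.pi / 2)) :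
    0 < trigFactor φ ψ := by
  have h1 : 0 < Real.cos φ := Real.cos_pos_of_mem_Ioo ⟨by linarith [hφ.1, Real.pi_pos], hφ.2⟩
  have h2 : 0 < Real.sin φ := Real.sin_pos_of_mem_Ioo ⟨hφ.1, by linarith [hφ.2, Real.pi_pos]⟩
  have h3 : 0 < Real.cos ψ := Real.cos_pos_of_mem_Ioo ⟨by linarith [hψ.1, Real.pi_pos], hψ.2⟩
  have h4 : 0 < Real.sin ψ := Real.sin_pos_of_mem_Ioo ⟨hψ.1, by linarith [hψ.2, Real.pi_pos]⟩
  unfold trigFactor; positivity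

section density

variable {α β : Fin 3 → ℝ} (hα : α 2 < α 1 ∧ α 1 < α 0) (hβ : β 2 < β 1 ∧ β 1 < β 0)
  (hα0 : α 0 + α 1 + α 2 = 0) (hβ0 : β 0 + β 1 + β 2 = 0)

include hα hβ hα0 hβ0

/-- For fixed angles `jac` is a cubic in `c`. With `Btilde = m + n u`, its `c ^ 2` coefficient is `2
cos ψ sin ψ (n u² + 2 m u - m)`; since `m > 0`, this vanishes for finitely many `φ` only. For every
other `φ` there are finitely many zeros `c`, and Fubini concludes. -/
theorem volume_jac_eq_zero :
    volume {y : (ℝ × ℝ) × ℝ | y ∈ eulerDomain ∧ jac α β y.1.1 y.2 y.1.2 = 0} = 0 := by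
  have hm : MeasurableSet {y : (ℝ × ℝ) × ℝ | y ∈ eulerDomain ∧ jac α β y.1.1 y.2 y.1.2 = 0} :=
    measurableSet_eulerDomain.inter
      (measurableSet_eq_fun (continuous_jac α β).measurable measurable_const)
  rw [Measure.volume_eq_prod, Measure.prod_apply_symm hm, lintegral_eq_zero_iff
    (measurable_measure_prodMk_right hm)]
  refine ae_of_all _ fun ψ => ?_
  have hm2 := (measurable_id.prodMk measurable_const : Measurable fun x : ℝ × ℝ => (x, ψ)) hm
  simp only [id_def] at hm2
  simp only [Pi.zero_apply]
  rw [Measure.volume_eq_prod, Measure.measure_prod_null hm2]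
  by_cases hψ : ψ ∈ Ioo 0 (Real.pi / 2)
  swap
  · refine ae_of_all _ fun φ => ?_
    rw [Pi.zero_apply]
    convert measure_empty (μ := (volume : Measure ℝ))
    ext c
    simp only [mem_preimage, mem_ofPred_eq, mem_empty_iff_false, iff_false]
    exact fun h => hψ h.1.2
  set z := Real.cos ψ ^ 2 with hz
  set m := Btilde α β 0 z with hmdef
  set n := aQu α β z * bP α β - aPu α β z * bQ α β with hn
  have hm0 : 0 < m := Btilde_pos hα hβ hα0 hβ0 le_rfl (sq_nonneg _)
  have hfin : {φ | φ ∈ Ioo 0 (Real.pi / 2) ∧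
      0 * (Real.cos φ ^ 2) ^ 3 + n * (Real.cos φ ^ 2) ^ 2 + (2 * m) * Real.cos φ ^ 2 + (-m) = 0}.Finite := by
    refine Finite.of_finite_image (f := fun φ => Real.cos φ ^ 2)
      ((finite_cubic_zeros (a := 0) (b := n) (c := 2 * m) (d := -m) (by
        right; right; right; linarith)).subset ?_) (injOn_cos_sq.mono fun φ h => h.1)
    rintro _ ⟨φ, hφ, rfl⟩
    exact hφ.2
  filter_upwards [measure_eq_zero_iff_ae_notMem.1 (hfin.measure_zero volume)] with φ hφ
  simp only [Pi.zero_apply]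
  by_cases hφ' : φ ∈ Ioo 0 (Real.pi / 2)
  swap
  · convert measure_empty (μ := (volume : Measure ℝ))
    ext c
    simp only [mem_preimage, mem_ofPred_eq, mem_empty_iff_false, iff_false]
    exact fun h => hφ' h.1.1.1
  have hcs : 0 < Real.cos ψ * Real.sin ψ := mul_pos
    (Real.cos_pos_of_mem_Ioo ⟨by linarith [hψ.1, Real.pi_pos], hψ.2⟩)
    (Real.sin_pos_of_mem_Ioo ⟨hψ.1, by linarith [hψ.2, Real.pi_pos]⟩)
  have hj2 : 2 * (Real.cos ψ * Real.sin ψ) * (n * (Real.cos φ ^ 2) ^ 2 + 2 * m * Real.cos φ ^ 2 - m) ≠ 0 := by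
    refine mul_ne_zero (by positivity) fun h => hφ ⟨hφ', ?_⟩
    linarith
  set sd := Real.cos ψ * Real.sin ψ * (Real.cos φ ^ 2 - Real.sin φ ^ 2) with hsd
  set ud := -(2 * Real.cos φ * Real.sin φ) with hud
  refine ((finite_cubic_zeros
    (a := ud * (aPu α β z * (2 * aQ α β (Real.cos φ ^ 2) z)
      - aQu α β z * (2 * aP α β (Real.cos φ ^ 2) z)))
    (b := 2 * (Real.cos ψ * Real.sin ψ) * (n * (Real.cos φ ^ 2) ^ 2 + 2 * m * Real.cos φ ^ 2 - m))
    (c := sd * bP α β * trigFactor φ ψ * bQ α β - sd * bQ α β * trigFactor φ ψ * bP α β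
      + ud * (ePu α β z * (2 * aQ α β (Real.cos φ ^ 2) z)
      - eQu α β z * (2 * aP α β (Real.cos φ ^ 2) z)))
    (d := ud * trigFactor φ ψ * (ePu α β z * bQ α β - eQu α β z * bP α β))
    (Or.inr (Or.inl hj2))).subset ?_).measure_zero _
  rintro c ⟨-, hc⟩
  simp only [jac, polyPφ, polyQφ, polyPc, polyQc, ← hz, ← hsd, ← hud] at hc
  rw [mem_ofPred_eq, ← hc, hmdef, hn, Btilde_eq, aQ_affine α β (Real.cos φ ^ 2),
    aP_affine α β (Real.cos φ ^ 2), hsd, hud, trigFactor, Real.sin_sq]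
  have hss := Real.sin_sq φ
  linear_combination (2 * Real.cos φ ^ 2 * Real.cos ψ * Real.sin ψ * c ^ 2 *
    (aPu α β z * bQ α β - aQu α β z * bP α β)) * hss

end density

end

/-! ### The density as a sum over fibres and over roots of the resultant -/

section

open scoped ENNReal

/-- The sum of the reciprocals of the Jacobian over a fibre. -/
def fiberSum (α β : Fin 3 → ℝ) (w : (ℝ × ℝ) × ℝ) : ℝ≥0∞ :=
  ∑' y : {y : (ℝ × ℝ) × ℝ // y ∈ eulerDomain ∧ eulerPQψ α β y = w},
    ENNReal.ofReal (1 / |jac α β y.1.1.1 y.1.2 y.1.1.2|)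

/-- The density of `(P, Q)`, from the area formula. -/
def eulerDensity (α β : Fin 3 → ℝ) (x : ℝ × ℝ) : ℝ≥0∞ :=
  ENNReal.ofReal (2 / Real.pi ^ 2) * ∫⁻ ψ, fiberSum α β (x, ψ)

/-- The linear combination of `P` and `Q` without the `c ^ 2` term. -/
def elimSq (α β : Fin 3 → ℝ) (x : ℝ × ℝ) (u z : ℝ) : ℝ :=
  aP α β u z * eQ α β x.2 u z - aQ α β u z * eP α β x.1 u z

/-- The set of regular values of `(P, Q)`. -/
def genericSet (α β : Fin 3 → ℝ) : Set (ℝ × ℝ) :=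
  {x | lowSum α β ^ 3 + x.1 * lowSum α β + x.2 < 0 ∧
    (elimSq α β x 0 0 ≠ 0 ∧ elimSq α β x 0 1 ≠ 0 ∧ elimSq α β x 1 0 ≠ 0 ∧ elimSq α β x 1 1 ≠ 0) ∧
    (∀ i j, (α i + β j) ^ 3 + x.1 * (α i + β j) + x.2 ≠ 0) ∧ 4 * x.1 ^ 3 + 27 * x.2 ^ 2 ≠ 0}

theorem isOpen_genericSet (α β : Fin 3 → ℝ) : IsOpen (genericSet α β) := by
  have h : ∀ u z, Continuous fun x => elimSq α β x u z := by
    intro u z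
    unfold elimSq eQ eP
    fun_prop
  have h2 : ∀ {f : ℝ × ℝ → ℝ}, Continuous f → IsOpen {x | f x ≠ 0} := fun hf =>
    isOpen_ne_fun hf continuous_const
  have h4 : ∀ t : ℝ, IsOpen {x : ℝ × ℝ | t ^ 3 + x.1 * t + x.2 ≠ 0} := fun t =>
    isOpen_ne_fun (by fun_prop) continuous_const
  have h5 : IsOpen {x : ℝ × ℝ | 4 * x.1 ^ 3 + 27 * x.2 ^ 2 ≠ 0} :=
    isOpen_ne_fun (by fun_prop) continuous_const
  have h3 : IsOpen {x : ℝ × ℝ | ∀ i j, (α i + β j) ^ 3 + x.1 * (α i + β j) + x.2 ≠ 0} := by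
    have e : {x : ℝ × ℝ | ∀ i j, (α i + β j) ^ 3 + x.1 * (α i + β j) + x.2 ≠ 0} =
        ⋂ i, ⋂ j, {x : ℝ × ℝ | (α i + β j) ^ 3 + x.1 * (α i + β j) + x.2 ≠ 0} := by
      ext x; simp
    rw [e]
    exact isOpen_iInter_of_finite fun i => isOpen_iInter_of_finite fun j => h4 _
  have h6 : IsOpen {x : ℝ × ℝ | lowSum α β ^ 3 + x.1 * lowSum α β + x.2 < 0} :=
    isOpen_lt (by fun_prop) continuous_const
  exact h6.inter
    (((h2 (h 0 0)).inter ((h2 (h 0 1)).inter ((h2 (h 1 0)).inter (h2 (h 1 1))))).inter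
      (h3.inter h5))

theorem ae_ne_zero_of_finite_slices {f : ℝ × ℝ → ℝ} (hf : Continuous f)
    (h : ∀ p, {q | f (p, q) = 0}.Finite) : ∀ᵐ x, f x ≠ 0 := by
  have hm : MeasurableSet {x | f x = 0} := (isClosed_eq hf continuous_const).measurableSet
  rw [ae_iff]
  simp only [not_not]
  rw [Measure.volume_eq_prod, Measure.measure_prod_null hm]
  exact ae_of_all _ fun p => (h p).measure_zero _

/-- All four coefficients are affine in `z`, so their values at `0` and `1` give the coefficients of
a polynomial of degree at most two; its constant term is not zero. -/
theorem elimSq_finite {α β : Fin 3 → ℝ} {x : ℝ × ℝ} {u : ℝ} (h : elimSq α β x u 0 ≠ 0) :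
    {z | elimSq α β x u z = 0}.Finite := by
  refine (finite_cubic_zeros (a := 0)
    (b := (aP α β u 1 - aP α β u 0) * (eQ α β x.2 u 1 - eQ α β x.2 u 0)
      - (aQ α β u 1 - aQ α β u 0) * (eP α β x.1 u 1 - eP α β x.1 u 0))
    (c := (aP α β u 1 - aP α β u 0) * eQ α β x.2 u 0 + aP α β u 0 * (eQ α β x.2 u 1 - eQ α β x.2 u 0)
      - ((aQ α β u 1 - aQ α β u 0) * eP α β x.1 u 0
        + aQ α β u 0 * (eP α β x.1 u 1 - eP α β x.1 u 0)))
    (d := elimSq α β x u 0) (by tauto)).subset fun z hz => ?_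
  simp only [mem_ofPred_eq, elimSq, aP, aQ, eP, eQ] at hz ⊢
  linear_combination hz

theorem resPQ_eq_elimSq {α β : Fin 3 → ℝ} {x : ℝ × ℝ} {u z : ℝ} (h : u * (1 - u) * z * (1 - z) = 0) :
    resPQ α β x.1 x.2 u z = elimSq α β x u z ^ 2 := by
  rw [resPQ, h, elimSq]; ring

theorem lintegral_comp_cos_sq (f : ℝ → ℝ≥0∞) :
    ∫⁻ ψ in Ioo 0 (Real.pi / 2), ENNReal.ofReal (2 * Real.cos ψ * Real.sin ψ) * f (Real.cos ψ ^ 2) =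
      ∫⁻ z in Ioo 0 1, f z := by
  rw [← image_cos_sq, lintegral_image_eq_lintegral_abs_deriv_mul measurableSet_Ioo
    (fun x _ => (hasDerivAt_cos_sq x).hasDerivWithinAt) injOn_cos_sq]
  refine setLIntegral_congr_fun measurableSet_Ioo fun ψ hψ => ?_
  have h1 : 0 < Real.cos ψ := Real.cos_pos_of_mem_Ioo ⟨by linarith [hψ.1, Real.pi_pos], hψ.2⟩
  have h2 : 0 < Real.sin ψ := Real.sin_pos_of_mem_Ioo ⟨hψ.1, by linarith [hψ.2, Real.pi_pos]⟩
  simp only [abs_neg]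
  rw [abs_of_pos (by positivity)]

theorem differentiable_resPQ_left (α β : Fin 3 → ℝ) (p q z : ℝ) :
    Differentiable ℝ fun u => resPQ α β p q u z := by
  unfold resPQ aP eQ aQ eP
  fun_prop

section density

variable {α β : Fin 3 → ℝ} (hα : α 2 < α 1 ∧ α 1 < α 0) (hβ : β 2 < β 1 ∧ β 1 < β 0)
  (hα0 : α 0 + α 1 + α 2 = 0) (hβ0 : β 0 + β 1 + β 2 = 0)

include hα hβ hα0 hβ0

/-- By `lowSum_eval` the value is `kfun * (c ^ 2 - 1)` with `|c| ≤ 1`. -/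
theorem lowSum_le_of_mem_range {x : ℝ × ℝ} (hx : x ∈ range (PQ α β)) :
    lowSum α β ^ 3 + x.1 * lowSum α β + x.2 ≤ 0 := by
  obtain ⟨M, rfl⟩ := hx
  obtain ⟨a, b, hM⟩ := exists_euler M
  have hc := abs_le.1 (abs_SO3_le M 2 2)
  have h := PQ_eulerSO3 hα0 hβ0 hc a b
  rw [eulerSO3, ← hM] at h
  rw [h, eulerPQ, lowSum_eval]
  have h1 := kfun_pos hα hβ hα0 hβ0 (sq_nonneg (Real.cos a)) (sq_nonneg (Real.cos b))
  have h2 : M.1 2 2 ^ 2 ≤ 1 := (sq_le_one_iff_abs_le_one _).2 (abs_SO3_le M 2 2)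
  nlinarith

/-- Each inequation is, for fixed `p`, that of a non-zero polynomial in `q`. The strict inequality
puts common roots in `(-1, 1)`; the corner conditions keep the resultant from vanishing identically
on an edge; the last two exclude the eigenvalues `α_i + β_j` and double eigenvalues, and serve for
regularity. -/
theorem ae_mem_genericSet : ∀ᵐ x, x ∈ range (PQ α β) → x ∈ genericSet α β := by
  have hW : ∀ u z : ℝ, 0 ≤ u → 0 ≤ z → ∀ᵐ x, elimSq α β x u z ≠ 0 := by
    intro u z hu hz
    refine ae_ne_zero_of_finite_slices (by unfold elimSq eQ eP; fun_prop) fun p => ?_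
    refine (finite_cubic_zeros (a := 0) (b := 0) (c := -aP α β u z)
      (d := aP α β u z * eQ α β 0 u z - aQ α β u z * eP α β p u z)
      (Or.inr (Or.inr (Or.inl ?_)))).subset fun q hq => ?_
    · have := aP_neg hα hβ hα0 hβ0 hu hz
      linarith
    · rw [mem_ofPred_eq] at hq ⊢
      simp only [elimSq, eQ] at hq ⊢
      linear_combination hq
  have hline : ∀ t : ℝ, ∀ᵐ x : ℝ × ℝ, t ^ 3 + x.1 * t + x.2 ≠ 0 := by
    intro t
    refine ae_ne_zero_of_finite_slices (by fun_prop) fun p => ?_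
    refine (finite_cubic_zeros (a := 0) (b := 0) (c := 1) (d := t ^ 3 + p * t)
      (by simp)).subset fun q hq => ?_
    simp only [mem_ofPred_eq] at hq ⊢
    linear_combination hq
  have hdisc : ∀ᵐ x : ℝ × ℝ, 4 * x.1 ^ 3 + 27 * x.2 ^ 2 ≠ 0 := by
    refine ae_ne_zero_of_finite_slices (by fun_prop) fun p => ?_
    refine (finite_cubic_zeros (a := 0) (b := 27) (c := 0) (d := 4 * p ^ 3)
      (by simp)).subset fun q hq => ?_
    simp only [mem_ofPred_eq] at hq ⊢
    linear_combination hq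
  have hlines : ∀ᵐ x : ℝ × ℝ, ∀ i j, (α i + β j) ^ 3 + x.1 * (α i + β j) + x.2 ≠ 0 :=
    ae_all_iff.2 fun i => ae_all_iff.2 fun j => hline _
  filter_upwards [hW 0 0 le_rfl le_rfl, hW 0 1 le_rfl zero_le_one, hW 1 0 zero_le_one le_rfl,
    hW 1 1 zero_le_one zero_le_one, hline (lowSum α β), hdisc, hlines] with x h1 h2 h3 h4 h5 h6 h7 hx
  exact ⟨lt_of_le_of_ne (lowSum_le_of_mem_range hα hβ hα0 hβ0 hx) h5, ⟨h1, h2, h3, h4⟩, h7, h6⟩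

/-- This makes every real common root of the quadratics come from a rotation, so no condition on `c`
remains in the density. -/
theorem abs_cos_lt_one {x : ℝ × ℝ} (hx : lowSum α β ^ 3 + x.1 * lowSum α β + x.2 < 0)
    {u z s c : ℝ} (hu : 0 ≤ u) (hz : 0 ≤ z) (hP : polyP α β u z s c = x.1)
    (hQ : polyQ α β u z s c = x.2) : |c| < 1 := by
  rw [← sq_lt_one_iff_abs_lt_one]
  have h := lowSum_eval α β u z s c
  have hk := kfun_pos hα hβ hα0 hβ0 hu hz
  rw [hP, hQ] at h
  rw [h] at hx
  by_contra hge
  have := mul_nonneg hk.le (by linarith : 0 ≤ c ^ 2 - 1)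
  linarith

/-- The fibre is in bijection with the roots `u`: `h0` and `h1` exclude the endpoints, and `c` is
determined by `u`. By `resPQ_deriv_eq_jac`, `jac = 2 R' / (cos ψ sin ψ Btilde)`; the factor `2 cos ψ
sin ψ` is set apart as the Jacobian of `z = cos² ψ`. -/
theorem fiberSum_eq {x : ℝ × ℝ} (hx : lowSum α β ^ 3 + x.1 * lowSum α β + x.2 < 0) {ψ : ℝ}
    (hψ : ψ ∈ Ioo 0 (Real.pi / 2)) (h0 : resPQ α β x.1 x.2 0 (Real.cos ψ ^ 2) ≠ 0)
    (h1 : resPQ α β x.1 x.2 1 (Real.cos ψ ^ 2) ≠ 0) :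
    fiberSum α β (x, ψ) = ENNReal.ofReal (1 / 4) * (ENNReal.ofReal (2 * Real.cos ψ * Real.sin ψ) *
      ∑' u : {u : ℝ // u ∈ Icc (0 : ℝ) 1 ∧ resPQ α β x.1 x.2 u (Real.cos ψ ^ 2) = 0},
      ENNReal.ofReal (|Btilde α β u.1 (Real.cos ψ ^ 2)| /
        |deriv (fun v : ℝ => resPQ α β x.1 x.2 v (Real.cos ψ ^ 2)) u.1|)) := by
  have hcp : 0 < Real.cos ψ := Real.cos_pos_of_mem_Ioo ⟨by linarith [hψ.1, Real.pi_pos], hψ.2⟩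
  have hsp : 0 < Real.sin ψ := Real.sin_pos_of_mem_Ioo ⟨hψ.1, by linarith [hψ.2, Real.pi_pos]⟩
  have hB : ∀ u, 0 ≤ u → 0 < Btilde α β u (Real.cos ψ ^ 2) := fun u hu =>
    Btilde_pos hα hβ hα0 hβ0 hu (sq_nonneg _)
  have hiff : ∀ φ ∈ Ioo 0 (Real.pi / 2), ∀ c, eulerPQ α β ((φ, c), ψ) = x ↔
      (resPQ α β x.1 x.2 (Real.cos φ ^ 2) (Real.cos ψ ^ 2) = 0 ∧
      c = (aP α β (Real.cos φ ^ 2) (Real.cos ψ ^ 2) * eQ α β x.2 (Real.cos φ ^ 2) (Real.cos ψ ^ 2)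
        - aQ α β (Real.cos φ ^ 2) (Real.cos ψ ^ 2) * eP α β x.1 (Real.cos φ ^ 2) (Real.cos ψ ^ 2)) /
        (trigFactor φ ψ * Btilde α β (Real.cos φ ^ 2) (Real.cos ψ ^ 2))) := by
    intro φ hφ c
    rw [← resPQ_eq_zero_iff α β x.1 x.2 _ _ _ (trigFactor_sq φ ψ) (trigFactor_pos hφ hψ).ne'
      (hB _ (sq_nonneg _)).ne', Prod.ext_iff]
    rfl
  let f : {y : (ℝ × ℝ) × ℝ // y ∈ eulerDomain ∧ eulerPQψ α β y = (x, ψ)} →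
      {u : ℝ // u ∈ Icc (0 : ℝ) 1 ∧ resPQ α β x.1 x.2 u (Real.cos ψ ^ 2) = 0} := fun y =>
    ⟨Real.cos y.1.1.1 ^ 2, Ioo_subset_Icc_self (cos_sq_mem_Ioo y.2.1.1.1), by
      obtain ⟨⟨⟨φ, c⟩, ψ'⟩, hy, hy'⟩ := y
      obtain ⟨hy1, hy2⟩ := Prod.ext_iff.1 hy'
      simp only [eulerPQψ] at hy1 hy2
      subst hy2
      exact ((hiff φ hy.1.1 c).1 hy1).1⟩
  have hf : Function.Bijective f := by
    constructor
    · rintro ⟨⟨⟨φ, c⟩, ψ'⟩, hy, hy'⟩ ⟨⟨⟨φ2, c2⟩, ψ2⟩, hz, hz'⟩ hfe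
      obtain ⟨hy1, hy2⟩ := Prod.ext_iff.1 hy'
      obtain ⟨hz1, hz2⟩ := Prod.ext_iff.1 hz'
      simp only [eulerPQψ] at hy1 hy2 hz1 hz2
      subst hy2
      subst hz2
      have e : φ = φ2 := injOn_cos_sq hy.1.1 hz.1.1 (congrArg Subtype.val hfe)
      subst e
      have e2 : c = c2 := by
        rw [((hiff φ hy.1.1 c).1 hy1).2, ((hiff φ hy.1.1 c2).1 hz1).2]
      subst e2
      rfl
    · rintro ⟨u, hu, hu0⟩
      have hu' : u ∈ Ioo (0 : ℝ) 1 := by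
        refine ⟨lt_of_le_of_ne hu.1 ?_, lt_of_le_of_ne hu.2 ?_⟩
        · rintro rfl; exact h0 hu0
        · rintro rfl; exact h1 hu0
      rw [← image_cos_sq] at hu'
      obtain ⟨φ, hφ, rfl⟩ := hu'
      simp only at hu0
      have hc := (hiff φ hφ _).2 ⟨hu0, rfl⟩
      set c := (aP α β (Real.cos φ ^ 2) (Real.cos ψ ^ 2) * eQ α β x.2 (Real.cos φ ^ 2) (Real.cos ψ ^ 2)
        - aQ α β (Real.cos φ ^ 2) (Real.cos ψ ^ 2) * eP α β x.1 (Real.cos φ ^ 2) (Real.cos ψ ^ 2)) /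
        (trigFactor φ ψ * Btilde α β (Real.cos φ ^ 2) (Real.cos ψ ^ 2))
      have hc1 : |c| < 1 := abs_cos_lt_one hα hβ hα0 hβ0 hx (sq_nonneg (Real.cos φ))
        (sq_nonneg (Real.cos ψ)) (congrArg Prod.fst hc) (congrArg Prod.snd hc)
      refine ⟨⟨((φ, c), ψ), ⟨⟨hφ, abs_lt.1 hc1⟩, hψ⟩, ?_⟩, rfl⟩
      rw [eulerPQψ, hc]
  rw [fiberSum, ← ENNReal.tsum_mul_left, ← ENNReal.tsum_mul_left, ← (Equiv.ofBijective f hf).tsum_eq]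
  refine tsum_congr fun y => ?_
  obtain ⟨⟨⟨φ, c⟩, ψ'⟩, hy, hy'⟩ := y
  obtain ⟨hy1, hy2⟩ := Prod.ext_iff.1 hy'
  simp only [eulerPQψ] at hy1 hy2
  subst hy2
  have hφ := hy.1.1
  have hcφ : 0 < Real.cos φ := Real.cos_pos_of_mem_Ioo ⟨by linarith [hφ.1, Real.pi_pos], hφ.2⟩
  have hsφ : 0 < Real.sin φ := Real.sin_pos_of_mem_Ioo ⟨hφ.1, by linarith [hφ.2, Real.pi_pos]⟩
  have hBφ := hB (Real.cos φ ^ 2) (sq_nonneg _)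
  rw [← ENNReal.ofReal_mul (by positivity), ← ENNReal.ofReal_mul (by positivity)]
  congr 1
  change 1 / |jac α β φ ψ' c| = _ * (_ * (|Btilde α β (Real.cos φ ^ 2) (Real.cos ψ' ^ 2)| /
    |deriv (fun v : ℝ => resPQ α β x.1 x.2 v (Real.cos ψ' ^ 2)) (Real.cos φ ^ 2)|))
  have hj := resPQ_deriv_eq_jac ((differentiable_resPQ_left α β x.1 x.2 _).differentiableAt.hasDerivAt)
    (congrArg Prod.fst hy1) (congrArg Prod.snd hy1)
  set R := deriv (fun v : ℝ => resPQ α β x.1 x.2 v (Real.cos ψ' ^ 2)) (Real.cos φ ^ 2)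
  set B := Btilde α β (Real.cos φ ^ 2) (Real.cos ψ' ^ 2)
  have hj2 : jac α β φ ψ' c = 2 * R / (Real.cos ψ' * Real.sin ψ' * B) := by
    rw [eq_div_iff (by positivity)]
    have : Real.cos φ * Real.sin φ * (jac α β φ ψ' c * (Real.cos ψ' * Real.sin ψ' * B)) =
      Real.cos φ * Real.sin φ * (2 * R) := by
      rw [trigFactor] at hj; linear_combination -hj
    exact mul_left_cancel₀ (by positivity) this
  rw [hj2, abs_div, abs_of_pos (by positivity : 0 < Real.cos ψ' * Real.sin ψ' * B), abs_of_pos hBφ,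
    abs_mul, abs_two, one_div_div]
  -- At a multiple root both sides are `0`, by division by zero.
  rcases eq_or_ne R 0 with hR | hR
  · simp [hR]
  · field_simp
    norm_num

theorem eulerDensity_eq_rootIntegral {x : ℝ × ℝ} (hx : x ∈ genericSet α β) :
    eulerDensity α β x = rootIntegral α β x.1 x.2 := by
  obtain ⟨hx0, ⟨hx1, -, hx2, -⟩, -⟩ := hx
  have hout : ∀ ψ, ψ ∉ Ioo 0 (Real.pi / 2) → fiberSum α β (x, ψ) = 0 := by
    intro ψ hψ
    rw [fiberSum, ENNReal.tsum_eq_zero]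
    rintro ⟨y, hy, hy'⟩
    have h2 : y.2 = ψ := (Prod.ext_iff.1 hy').2
    exact absurd (h2 ▸ hy.2) hψ
  have hfin : ∀ u, elimSq α β x u 0 ≠ 0 → {ψ | ψ ∈ Ioo 0 (Real.pi / 2) ∧
      elimSq α β x u (Real.cos ψ ^ 2) = 0}.Finite := by
    intro u hu
    refine Finite.of_finite_image (f := fun φ => Real.cos φ ^ 2)
      ((elimSq_finite hu).subset ?_) (injOn_cos_sq.mono fun φ h => h.1)
    rintro _ ⟨φ, hφ, rfl⟩
    exact hφ.2
  rw [eulerDensity, rootIntegral, setLIntegral_congr (Ioo_ae_eq_Icc).symm, ← lintegral_comp_cos_sq,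
    ← setLIntegral_eq_of_support_subset (s := Ioo 0 (Real.pi / 2)) (by
      intro ψ hψ
      by_contra h
      exact hψ (hout ψ h))]
  have e1 : ∫⁻ ψ in Ioo 0 (Real.pi / 2), fiberSum α β (x, ψ) = ∫⁻ ψ in Ioo 0 (Real.pi / 2),
      ENNReal.ofReal (1 / 4) * (ENNReal.ofReal (2 * Real.cos ψ * Real.sin ψ) *
      ∑' u : {u : ℝ // u ∈ Icc (0 : ℝ) 1 ∧ resPQ α β x.1 x.2 u (Real.cos ψ ^ 2) = 0},
      ENNReal.ofReal (|Btilde α β u.1 (Real.cos ψ ^ 2)| /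
        |deriv (fun v : ℝ => resPQ α β x.1 x.2 v (Real.cos ψ ^ 2)) u.1|)) := by
    refine lintegral_congr_ae ?_
    rw [EventuallyEq, ae_restrict_iff' measurableSet_Ioo]
    filter_upwards [measure_eq_zero_iff_ae_notMem.1 ((hfin 0 hx1).measure_zero volume),
      measure_eq_zero_iff_ae_notMem.1 ((hfin 1 hx2).measure_zero volume)] with ψ ha hb hψ
    refine fiberSum_eq hα hβ hα0 hβ0 hx0 hψ ?_ ?_
    · rw [resPQ_eq_elimSq (by ring)]
      exact pow_ne_zero 2 fun h => ha ⟨hψ, h⟩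
    · rw [resPQ_eq_elimSq (by ring)]
      exact pow_ne_zero 2 fun h => hb ⟨hψ, h⟩
  rw [e1, lintegral_const_mul' _ _ ENNReal.ofReal_ne_top, ← mul_assoc,
    ← ENNReal.ofReal_mul (by positivity)]
  congr 2
  ring

section haar

variable [MeasurableSpace SO3] [BorelSpace SO3] (μ : Measure SO3) [μ.IsHaarMeasure]
  [IsProbabilityMeasure μ]

/-- Carrying `ψ` along makes source and target of equal dimension, so the area formula applies with
weight `1 / |jac|`, which cancels the Jacobian almost everywhere. Integrating out `ψ` leaves the
density. -/
theorem map_PQ_eq_withDensity : AEMeasurable (eulerDensity α β) volume ∧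
    μ.map (PQ α β) = volume.withDensity (eulerDensity α β) := by
  have hh : Measurable fun y : (ℝ × ℝ) × ℝ => ENNReal.ofReal (1 / |jac α β y.1.1 y.2 y.1.2|) := by
    have := (continuous_jac α β).measurable
    fun_prop
  have hdet : MeasurableSet {y : (ℝ × ℝ) × ℝ | y ∈ eulerDomain ∧
      (fderiv ℝ (eulerPQψ α β) y).det ≠ 0} := by
    simp_rw [det_fderiv_eulerPQψ]
    exact measurableSet_eulerDomain.inter
      (measurableSet_eq_fun (continuous_jac α β).measurable measurable_const).compl
  have harea := fun (h : (ℝ × ℝ) × ℝ → ℝ≥0∞) (hh : Measurable h) =>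
    have : (volume : Measure ((ℝ × ℝ) × ℝ)).IsAddHaarMeasure := by
      rw [Measure.volume_eq_prod]; infer_instance
    lintegral_tsum_fiber volume measurableSet_eulerDomain
    (fun y _ => (differentiable_eulerPQψ α β y).hasFDerivAt.hasFDerivWithinAt) hdet hh
  have hT : AEMeasurable (fiberSum α β) volume := (harea _ hh).1
  rw [Measure.volume_eq_prod] at hT
  have hρ : AEMeasurable (eulerDensity α β) volume := by
    unfold eulerDensity
    exact (hT.lintegral_prod_right').const_mul _
  refine ⟨hρ, Measure.ext fun s hs => ?_⟩
  have hE := (continuous_eulerPQ α β).measurable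
  rw [withDensity_apply _ hs, map_PQ_eq μ hα0 hβ0, Measure.smul_apply, smul_eq_mul,
    ← lintegral_indicator_one hs, lintegral_map (measurable_one.indicator hs) hE]
  set g : ℝ × ℝ → ℝ≥0∞ := s.indicator 1 with hg
  have hgm : Measurable g := measurable_one.indicator hs
  have h1 := harea (fun y => g (eulerPQ α β y) * ENNReal.ofReal (1 / |jac α β y.1.1 y.2 y.1.2|))
    ((hgm.comp hE).mul hh)
  have h2 : ∫⁻ y in eulerDomain, g (eulerPQ α β y) = ∫⁻ y in eulerDomain,
      ENNReal.ofReal |(fderiv ℝ (eulerPQψ α β) y).det| *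
      (g (eulerPQ α β y) * ENNReal.ofReal (1 / |jac α β y.1.1 y.2 y.1.2|)) := by
    refine lintegral_congr_ae ?_
    rw [EventuallyEq, ae_restrict_iff' measurableSet_eulerDomain]
    filter_upwards [measure_eq_zero_iff_ae_notMem.1 (volume_jac_eq_zero hα hβ hα0 hβ0)] with y hy hyD
    have hj : jac α β y.1.1 y.2 y.1.2 ≠ 0 := fun h => hy ⟨hyD, h⟩
    rw [det_fderiv_eulerPQψ, mul_left_comm, ← ENNReal.ofReal_mul (abs_nonneg _),
      mul_one_div_cancel (abs_ne_zero.2 hj), ENNReal.ofReal_one, mul_one]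
  have h3 : ∀ w : (ℝ × ℝ) × ℝ, ∑' y : {y : (ℝ × ℝ) × ℝ // y ∈ eulerDomain ∧ eulerPQψ α β y = w},
      g (eulerPQ α β y) * ENNReal.ofReal (1 / |jac α β y.1.1.1 y.1.2 y.1.1.2|) =
      g w.1 * fiberSum α β w := by
    intro w
    rw [fiberSum, ← ENNReal.tsum_mul_left]
    refine tsum_congr fun ⟨y, hy, hy'⟩ => ?_
    have h4 : w.1 = eulerPQ α β y := by rw [← hy']; rfl
    rw [h4]
  rw [h2, ← h1.2]
  simp_rw [h3]
  rw [Measure.volume_eq_prod, lintegral_prod (fun w => g w.1 * fiberSum α β w)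
    ((hgm.comp measurable_fst).aemeasurable.mul hT),
    ← lintegral_indicator hs, ← lintegral_const_mul' _ _ ENNReal.ofReal_ne_top]
  refine lintegral_congr fun x => ?_
  by_cases hx : x ∈ s
  · simp [hg, hx, eulerDensity]
  · simp [hg, hx]

theorem hasPDF_PQ : HasPDF (PQ α β) μ volume :=
  hasPDF_of_map_eq_withDensity (continuous_PQ α β).measurable.aemeasurable _
    (map_PQ_eq_withDensity hα hβ hα0 hβ0 μ).1 (map_PQ_eq_withDensity hα hβ hα0 hβ0 μ).2

theorem pdf_PQ_ae_eq : pdf (PQ α β) μ volume =ᵐ[volume] eulerDensity α β := by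
  have := hasPDF_PQ hα hβ hα0 hβ0 μ
  exact (pdf.eq_of_map_eq_withDensity _ (map_PQ_eq_withDensity hα hβ hα0 hβ0 μ).1).1
    (map_PQ_eq_withDensity hα hβ hα0 hβ0 μ).2

theorem pdf_PQ_eq_rootIntegral : ∀ᵐ x : ℝ × ℝ, x ∈ range (PQ α β) →
    pdf (PQ α β) μ volume x = rootIntegral α β x.1 x.2 := by
  filter_upwards [pdf_PQ_ae_eq hα hβ hα0 hβ0 μ, ae_mem_genericSet hα hβ hα0 hβ0] with x h1 h2 hx
  rw [h1, eulerDensity_eq_rootIntegral hα hβ hα0 hβ0 (h2 hx)]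

theorem pdf_PQ_eq_zero : ∀ᵐ x : ℝ × ℝ, x ∉ range (PQ α β) → pdf (PQ α β) μ volume x = 0 := by
  have := hasPDF_PQ hα hβ hα0 hβ0 μ
  have hm : MeasurableSet (range (PQ α β)) :=
    (isCompact_range (continuous_PQ α β)).isClosed.measurableSet
  have h1 : ∫⁻ x in (range (PQ α β))ᶜ, pdf (PQ α β) μ volume x = 0 := by
    rw [← map_eq_setLIntegral_pdf _ _ _ hm.compl, Measure.map_apply (continuous_PQ α β).measurable
      hm.compl]
    simp
  rw [lintegral_eq_zero_iff (measurable_pdf _ _ _), EventuallyEq, ae_restrict_iff' hm.compl] at h1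
  exact h1

end haar

end density

end

/-! ### Differentials of `P` and `Q` in terms of the entries of `C` -/

section

/-- The matrix `C` in Euler angles. -/
def eulerMatrix (α β : Fin 3 → ℝ) (φ θ ψ : ℝ) : Matrix (Fin 3) (Fin 3) ℝ :=
  sumMatrix α β (rotZ φ * rotY θ * rotZ ψ)

/-- An off-diagonal entry of the adjugate of a symmetric matrix. -/
def adjOff (M : Matrix (Fin 3) (Fin 3) ℝ) (i j k : Fin 3) : ℝ := M i k * M j k - M i j * M k k

-- Varying an Euler angle rotates the summand `M diag(β) Mᵀ` infinitesimally. As `C` commutes with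
-- itself and with its adjugate, only commutators with `diag(α)` contribute: for the three
-- coordinate axes, `P` has derivatives `2 (α₂ - α₃) C₂₃`, `2 (α₃ - α₁) C₁₃`, `2 (α₁ - α₂) C₁₂`, and
-- `Q` the same with adjugate entries. The axis is the third basis vector for `φ`, `(-sin φ, cos φ,
-- 0)` for `θ`, and the third column of the rotation for `ψ`; this and the next five identities
-- spell that out.
set_option maxRecDepth 20000 in
theorem polyPφ_eq (α β : Fin 3 → ℝ) (hβ0 : β 0 + β 1 + β 2 = 0)
    (φ θ ψ : ℝ) : polyPφ α β φ ψ (Real.cos θ) =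
      2 * (α 0 - α 1) * eulerMatrix α β φ θ ψ 0 1 := by
  have h3 : β 2 = - β 0 - β 1 := by linarith
  simp only [eulerMatrix, sumMatrix, rotZ, rotY, Matrix.add_apply, Matrix.mul_apply,
    Fin.sum_univ_three, Matrix.diagonal_apply, Matrix.transpose_apply, polyPφ, aPu, ePu, bP]
  simp [h3]
  generalize ha : Real.cos φ = a
  generalize ha' : Real.sin φ = a'
  generalize hb : Real.cos ψ = b
  generalize hb' : Real.sin ψ = b'
  generalize hc : Real.cos θ = c
  generalize hc' : Real.sin θ = c'
  have e1 : a' ^ 2 = 1 - a ^ 2 := by rw [← ha, ← ha', Real.sin_sq]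
  have e2 : b' ^ 2 = 1 - b ^ 2 := by rw [← hb, ← hb', Real.sin_sq]
  have e3 : c' ^ 2 = 1 - c ^ 2 := by rw [← hc, ← hc', Real.sin_sq]
  ring_nf
  simp only [e1, e2, e3]
  ring

set_option maxRecDepth 20000 in
theorem polyPc_eq (α β : Fin 3 → ℝ) (hα0 : α 0 + α 1 + α 2 = 0) (hβ0 : β 0 + β 1 + β 2 = 0)
    (φ θ ψ : ℝ) : -Real.sin θ * polyPc α β φ ψ (Real.cos θ) =
      2 * (Real.cos φ * ((α 2 - α 0) * eulerMatrix α β φ θ ψ 0 2) -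
        Real.sin φ * ((α 1 - α 2) * eulerMatrix α β φ θ ψ 1 2)) := by
  have h2 : α 2 = - α 0 - α 1 := by linarith
  have h3 : β 2 = - β 0 - β 1 := by linarith
  simp only [eulerMatrix, sumMatrix, rotZ, rotY, Matrix.add_apply, Matrix.mul_apply,
    Fin.sum_univ_three, Matrix.diagonal_apply, Matrix.transpose_apply, polyPc, aP, bP, trigFactor]
  simp [h2, h3]
  generalize ha : Real.cos φ = a
  generalize ha' : Real.sin φ = a'
  generalize hb : Real.cos ψ = b
  generalize hb' : Real.sin ψ = b'
  generalize hc : Real.cos θ = c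
  generalize hc' : Real.sin θ = c'
  have e1 : a' ^ 2 = 1 - a ^ 2 := by rw [← ha, ← ha', Real.sin_sq]
  have e2 : b' ^ 2 = 1 - b ^ 2 := by rw [← hb, ← hb', Real.sin_sq]
  ring_nf
  simp only [e1, e2]
  ring

set_option maxRecDepth 20000 in
theorem polyPψ_eq (α β : Fin 3 → ℝ) (hα0 : α 0 + α 1 + α 2 = 0) (hβ0 : β 0 + β 1 + β 2 = 0)
    (φ θ ψ : ℝ) : polyPφ β α ψ φ (Real.cos θ) =
      2 * (Real.sin θ * (Real.cos φ * ((α 1 - α 2) * eulerMatrix α β φ θ ψ 1 2) +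
        Real.sin φ * ((α 2 - α 0) * eulerMatrix α β φ θ ψ 0 2)) +
        Real.cos θ * ((α 0 - α 1) * eulerMatrix α β φ θ ψ 0 1)) := by
  have h2 : α 2 = - α 0 - α 1 := by linarith
  have h3 : β 2 = - β 0 - β 1 := by linarith
  simp only [eulerMatrix, sumMatrix, rotZ, rotY, Matrix.add_apply, Matrix.mul_apply,
    Fin.sum_univ_three, Matrix.diagonal_apply, Matrix.transpose_apply, polyPφ, aPu, ePu, bP]
  simp [h2, h3]
  generalize ha : Real.cos φ = a
  generalize ha' : Real.sin φ = a'
  generalize hb : Real.cos ψ = b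
  generalize hb' : Real.sin ψ = b'
  generalize hc : Real.cos θ = c
  generalize hc' : Real.sin θ = c'
  have e1 : a' ^ 2 = 1 - a ^ 2 := by rw [← ha, ← ha', Real.sin_sq]
  have e2 : b' ^ 2 = 1 - b ^ 2 := by rw [← hb, ← hb', Real.sin_sq]
  have e3 : c' ^ 2 = 1 - c ^ 2 := by rw [← hc, ← hc', Real.sin_sq]
  ring_nf
  simp only [e1, e2, e3]
  ring

set_option maxRecDepth 20000 in
theorem polyQφ_eq (α β : Fin 3 → ℝ) (hα0 : α 0 + α 1 + α 2 = 0) (hβ0 : β 0 + β 1 + β 2 = 0)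
    (φ θ ψ : ℝ) : polyQφ α β φ ψ (Real.cos θ) =
      2 * (α 0 - α 1) * adjOff (eulerMatrix α β φ θ ψ) 0 1 2 := by
  have h2 : α 2 = - α 0 - α 1 := by linarith
  have h3 : β 2 = - β 0 - β 1 := by linarith
  simp only [eulerMatrix, adjOff, sumMatrix, rotZ, rotY, Matrix.add_apply, Matrix.mul_apply,
    Fin.sum_univ_three, Matrix.diagonal_apply, Matrix.transpose_apply, polyQφ, aQu, eQu, bQ]
  simp [h2, h3]
  generalize ha : Real.cos φ = a
  generalize ha' : Real.sin φ = a'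
  generalize hb : Real.cos ψ = b
  generalize hb' : Real.sin ψ = b'
  generalize hc : Real.cos θ = c
  generalize hc' : Real.sin θ = c'
  have e1 : a' ^ 2 = 1 - a ^ 2 := by rw [← ha, ← ha', Real.sin_sq]
  have e2 : b' ^ 2 = 1 - b ^ 2 := by rw [← hb, ← hb', Real.sin_sq]
  have e3 : c' ^ 2 = 1 - c ^ 2 := by rw [← hc, ← hc', Real.sin_sq]
  have g2 : b' ^ 4 = (1 - b ^ 2) ^ 2 := by rw [← e2]; ring
  have g3 : c' ^ 4 = (1 - c ^ 2) ^ 2 := by rw [← e3]; ring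
  ring_nf
  simp only [e1, e2, e3, g2, g3]
  ring

set_option maxRecDepth 20000 in
theorem polyQc_eq (α β : Fin 3 → ℝ) (hα0 : α 0 + α 1 + α 2 = 0) (hβ0 : β 0 + β 1 + β 2 = 0)
    (φ θ ψ : ℝ) : -Real.sin θ * polyQc α β φ ψ (Real.cos θ) =
      2 * (Real.cos φ * ((α 2 - α 0) * adjOff (eulerMatrix α β φ θ ψ) 0 2 1) -
        Real.sin φ * ((α 1 - α 2) * adjOff (eulerMatrix α β φ θ ψ) 1 2 0)) := by
  have h2 : α 2 = - α 0 - α 1 := by linarith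
  have h3 : β 2 = - β 0 - β 1 := by linarith
  simp only [eulerMatrix, adjOff, sumMatrix, rotZ, rotY, Matrix.add_apply, Matrix.mul_apply,
    Fin.sum_univ_three, Matrix.diagonal_apply, Matrix.transpose_apply, polyQc, aQ, bQ, trigFactor]
  simp [h2, h3]
  generalize ha : Real.cos φ = a
  generalize ha' : Real.sin φ = a'
  generalize hb : Real.cos ψ = b
  generalize hb' : Real.sin ψ = b'
  generalize hc : Real.cos θ = c
  generalize hc' : Real.sin θ = c'
  have e1 : a' ^ 2 = 1 - a ^ 2 := by rw [← ha, ← ha', Real.sin_sq]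
  have e2 : b' ^ 2 = 1 - b ^ 2 := by rw [← hb, ← hb', Real.sin_sq]
  have e3 : c' ^ 2 = 1 - c ^ 2 := by rw [← hc, ← hc', Real.sin_sq]
  have f1 : a' ^ 3 = a' * (1 - a ^ 2) := by rw [← e1]; ring
  have f3 : c' ^ 3 = c' * (1 - c ^ 2) := by rw [← e3]; ring
  have g1 : a' ^ 4 = (1 - a ^ 2) ^ 2 := by rw [← e1]; ring
  have g2 : b' ^ 4 = (1 - b ^ 2) ^ 2 := by rw [← e2]; ring
  ring_nf
  simp only [e1, e2, f1, f3, g1, g2]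
  ring

set_option maxRecDepth 20000 in
theorem polyQψ_eq (α β : Fin 3 → ℝ) (hα0 : α 0 + α 1 + α 2 = 0) (hβ0 : β 0 + β 1 + β 2 = 0)
    (φ θ ψ : ℝ) : polyQφ β α ψ φ (Real.cos θ) =
      2 * (Real.sin θ * (Real.cos φ * ((α 1 - α 2) * adjOff (eulerMatrix α β φ θ ψ) 1 2 0) +
        Real.sin φ * ((α 2 - α 0) * adjOff (eulerMatrix α β φ θ ψ) 0 2 1)) +
        Real.cos θ * ((α 0 - α 1) * adjOff (eulerMatrix α β φ θ ψ) 0 1 2)) := by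
  have h2 : α 2 = - α 0 - α 1 := by linarith
  have h3 : β 2 = - β 0 - β 1 := by linarith
  simp only [eulerMatrix, adjOff, sumMatrix, rotZ, rotY, Matrix.add_apply, Matrix.mul_apply,
    Fin.sum_univ_three, Matrix.diagonal_apply, Matrix.transpose_apply, polyQφ, aQu, eQu, bQ]
  simp [h2, h3]
  generalize ha : Real.cos φ = a
  generalize ha' : Real.sin φ = a'
  generalize hb : Real.cos ψ = b
  generalize hb' : Real.sin ψ = b'
  generalize hc : Real.cos θ = c
  generalize hc' : Real.sin θ = c'
  have e1 : a' ^ 2 = 1 - a ^ 2 := by rw [← ha, ← ha', Real.sin_sq]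
  have e2 : b' ^ 2 = 1 - b ^ 2 := by rw [← hb, ← hb', Real.sin_sq]
  have e3 : c' ^ 2 = 1 - c ^ 2 := by rw [← hc, ← hc', Real.sin_sq]
  have f1 : a' ^ 3 = a' * (1 - a ^ 2) := by rw [← e1]; ring
  have g1 : a' ^ 4 = (1 - a ^ 2) ^ 2 := by rw [← e1]; ring
  have g2 : b' ^ 4 = (1 - b ^ 2) ^ 2 := by rw [← e2]; ring
  have g3 : c' ^ 4 = (1 - c ^ 2) ^ 2 := by rw [← e3]; ring
  ring_nf
  simp only [e1, e2, e3, f1, g1, g2, g3]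
  ring

end

/-! ### Zero is a regular value of the resultant -/

section

theorem sumMatrix_trace {α β : Fin 3 → ℝ} (hα0 : α 0 + α 1 + α 2 = 0)
    (hβ0 : β 0 + β 1 + β 2 = 0) (M : SO3) : (sumMatrix α β M.1).trace = 0 := by
  have h1 : M.1.transpose * M.1 = 1 := M.2.1.1
  rw [sumMatrix, Matrix.trace_add, Matrix.mul_assoc, Matrix.trace_mul_comm, Matrix.mul_assoc, h1]
  simp [Matrix.trace, Fin.sum_univ_three]
  linarith

/-- If a coordinate vector is an eigenvector, its eigenvalue is a sum of eigenvalues. -/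
theorem exists_sumMatrix_diag_eq {α β : Fin 3 → ℝ} (M : SO3) (i : Fin 3)
    (h : ∀ j, j ≠ i → sumMatrix α β M.1 i j = 0) :
    ∃ j, sumMatrix α β M.1 i i = α i + β j := by
  have h1 : M.1.transpose * M.1 = 1 := M.2.1.1
  have h2 : M.1 * M.1.transpose = 1 := mul_eq_one_comm.1 h1
  have h3 : (sumMatrix α β M.1 - Matrix.diagonal α) * M.1 = M.1 * Matrix.diagonal β := by
    rw [sumMatrix, add_sub_cancel_left, Matrix.mul_assoc, h1, Matrix.mul_one]
  obtain ⟨j, hj⟩ : ∃ j, M.1 i j ≠ 0 := by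
    by_contra! h0
    have := congrFun (congrFun h2 i) i
    simp [Matrix.mul_apply, h0] at this
  refine ⟨j, ?_⟩
  have h4 := congrFun (congrFun h3 i) j
  rw [Matrix.mul_diagonal, Matrix.mul_apply, Finset.sum_eq_single i] at h4
  · simp only [Matrix.sub_apply, Matrix.diagonal_apply_eq] at h4
    have : (sumMatrix α β M.1 i i - (α i + β j)) * M.1 i j = 0 := by linear_combination h4
    rcases mul_eq_zero.1 this with h | h
    · linarith
    · exact absurd h hj
  · intro k _ hk
    simp [h k hk, Matrix.diagonal_apply_ne _ hk.symm]
  · simp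

theorem lin_sys_eq_zero {a b x y : ℝ} (hab : a ^ 2 + b ^ 2 = 1) (h1 : a * x - b * y = 0)
    (h2 : a * y + b * x = 0) : x = 0 ∧ y = 0 :=
  ⟨by linear_combination a * h1 + b * h2 - x * hab, by linear_combination a * h2 - b * h1 - y * hab⟩

/-- A traceless symmetric matrix for which a linear combination with its adjugate is diagonal has
two vanishing off-diagonal entries, or a double eigenvalue. -/
theorem offdiag_alternative {X Y a b c f g h : ℝ} (hXY : X ≠ 0 ∨ Y ≠ 0) (ht : a + b + c = 0)
    (h1 : X * h + Y * (g * f - h * c) = 0) (h2 : X * g + Y * (h * f - g * b) = 0)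
    (h3 : X * f + Y * (h * g - f * a) = 0) :
    (h = 0 ∧ g = 0) ∨ (h = 0 ∧ f = 0) ∨ (g = 0 ∧ f = 0) ∨
    4 * (a * b + a * c + b * c - f ^ 2 - g ^ 2 - h ^ 2) ^ 3 +
      27 * (a * b * c + 2 * f * g * h - a * f ^ 2 - b * g ^ 2 - c * h ^ 2) ^ 2 = 0 := by
  by_cases hY : Y = 0
  · simp only [hY, zero_mul, add_zero, ne_eq, not_true_eq_false, or_false] at *
    exact Or.inl ⟨(mul_eq_zero.1 h1).resolve_left hXY, (mul_eq_zero.1 h2).resolve_left hXY⟩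
  -- The hypotheses now say that the off-diagonal 2 by 2 minors of `C + r` vanish; one zero
  -- off-diagonal entry then forces a second.
  obtain ⟨r, rfl⟩ : ∃ r, X = -(r * Y) := ⟨-X / Y, by field_simp⟩
  have e1 : g * f = h * (c + r) := mul_left_cancel₀ hY (by linear_combination h1)
  have e2 : h * f = g * (b + r) := mul_left_cancel₀ hY (by linear_combination h2)
  have e3 : h * g = f * (a + r) := mul_left_cancel₀ hY (by linear_combination h3)
  by_cases hh : h = 0
  · subst hh
    rcases mul_eq_zero.1 (e1.trans (zero_mul _)) with k | k
    · exact Or.inl ⟨rfl, k⟩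
    · exact Or.inr (Or.inl ⟨rfl, k⟩)
  by_cases hg : g = 0
  · subst hg
    rcases mul_eq_zero.1 (e2.trans (zero_mul _)) with k | k
    · exact absurd k hh
    · exact Or.inr (Or.inr (Or.inl ⟨rfl, k⟩))
  by_cases hf : f = 0
  · subst hf
    rcases mul_eq_zero.1 (e3.trans (zero_mul _)) with k | k
    · exact absurd k hh
    · exact absurd k hg
  -- With no zero entry the principal minors vanish as well, so `C + r` has rank at most one and `C`
  -- has eigenvalues `-r, -r, 2r`.
  have f2 : f ^ 2 = (b + r) * (c + r) :=
    mul_left_cancel₀ (mul_ne_zero hh hg) (by linear_combination h * f * e1 + h * (c + r) * e2)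
  have g2 : g ^ 2 = (a + r) * (c + r) :=
    mul_left_cancel₀ (mul_ne_zero hh hf) (by linear_combination h * g * e1 + h * (c + r) * e3)
  have h2' : h ^ 2 = (a + r) * (b + r) :=
    mul_left_cancel₀ (mul_ne_zero hg hf) (by linear_combination h * g * e2 + g * (b + r) * e3)
  have fgh : f * g * h = (a + r) * (b + r) * (c + r) :=
    mul_left_cancel₀ hh (by linear_combination h * h * e1 + h * (c + r) * h2')
  refine Or.inr (Or.inr (Or.inr ?_))
  have hp : a * b + a * c + b * c - f ^ 2 - g ^ 2 - h ^ 2 = -3 * r ^ 2 := by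
    linear_combination -f2 - g2 - h2' - 2 * r * ht
  have hq : a * b * c + 2 * f * g * h - a * f ^ 2 - b * g ^ 2 - c * h ^ 2 = 2 * r ^ 3 := by
    linear_combination 2 * fgh - a * f2 - b * g2 - c * h2' + r ^ 2 * ht
  rw [hp, hq]
  ring

section

variable {α β : Fin 3 → ℝ} (hα0 : α 0 + α 1 + α 2 = 0) (hβ0 : β 0 + β 1 + β 2 = 0)

include hα0 hβ0

/-- Otherwise the `i`-th basis vector is an eigenvector of `C` whose eigenvalue is some `α_i + β_j`,
which `hx` forbids. -/
theorem offdiag_not_both {x : ℝ × ℝ}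
    (hx : ∀ i j, (α i + β j) ^ 3 + x.1 * (α i + β j) + x.2 ≠ 0) {M : SO3} (hM : PQ α β M = x)
    (i : Fin 3) : ¬ ∀ j, j ≠ i → sumMatrix α β M.1 i j = 0 := by
  intro h
  obtain ⟨j, hj⟩ := exists_sumMatrix_diag_eq M i h
  refine hx i j ?_
  have h1 := congrArg Prod.fst hM
  have h2 := congrArg Prod.snd hM
  simp only [PQ, coeffP, coeffQ, charpoly_coeff_one, charpoly_coeff_zero, Matrix.det_fin_three] at h1 h2
  have ht := sumMatrix_trace hα0 hβ0 M
  rw [Matrix.trace, Fin.sum_univ_three] at ht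
  simp only [Matrix.diag] at ht
  rw [← hj, ← h1, ← h2]
  fin_cases i
  · have e1 := h 1 (by decide)
    have e2 := h 2 (by decide)
    simp only [Fin.zero_eta, Fin.isValue] at *
    rw [e1, e2]
    linear_combination sumMatrix α β M.1 0 0 ^ 2 * ht
  · have e1 := h 0 (by decide)
    have e2 := h 2 (by decide)
    simp only [Fin.mk_one, Fin.isValue] at *
    rw [e1, e2]
    linear_combination sumMatrix α β M.1 1 1 ^ 2 * ht
  · have e1 := h 0 (by decide)
    have e2 := h 1 (by decide)
    simp only [Fin.reduceFinMk, Fin.isValue] at *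
    rw [e1, e2]
    linear_combination sumMatrix α β M.1 2 2 ^ 2 * ht

/-- The three equations express that the differential of `X P + Y Q` vanishes at `M`; over a generic
value this is impossible unless `X = Y = 0`. -/
theorem exists_offdiag_ne_zero {x : ℝ × ℝ}
    (hx : ∀ i j, (α i + β j) ^ 3 + x.1 * (α i + β j) + x.2 ≠ 0)
    (hd : 4 * x.1 ^ 3 + 27 * x.2 ^ 2 ≠ 0) {M : SO3} (hM : PQ α β M = x) {X Y : ℝ}
    (hXY : X ≠ 0 ∨ Y ≠ 0)
    (h1 : X * sumMatrix α β M.1 0 1 + Y * adjOff (sumMatrix α β M.1) 0 1 2 = 0)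
    (h2 : X * sumMatrix α β M.1 0 2 + Y * adjOff (sumMatrix α β M.1) 0 2 1 = 0)
    (h3 : X * sumMatrix α β M.1 1 2 + Y * adjOff (sumMatrix α β M.1) 1 2 0 = 0) : False := by
  have hs : ∀ i j, sumMatrix α β M.1 i j = sumMatrix α β M.1 j i := fun i j => by
    simpa using (sumMatrix_isHermitian α β M.1).apply j i
  have ht := sumMatrix_trace hα0 hβ0 M
  rw [Matrix.trace, Fin.sum_univ_three] at ht
  simp only [Matrix.diag] at ht
  simp only [adjOff, hs 1 0, hs 2 0, hs 2 1] at h1 h2 h3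
  have n0 := offdiag_not_both hα0 hβ0 hx hM 0
  have n1 := offdiag_not_both hα0 hβ0 hx hM 1
  have n2 := offdiag_not_both hα0 hβ0 hx hM 2
  simp only [Fin.forall_fin_succ] at n0 n1 n2
  simp [hs 1 0, hs 2 0, hs 2 1] at n0 n1 n2
  have hp := congrArg Prod.fst hM
  have hq := congrArg Prod.snd hM
  simp only [PQ, coeffP, coeffQ, charpoly_coeff_one, charpoly_coeff_zero, Matrix.det_fin_three,
    hs 1 0, hs 2 0, hs 2 1] at hp hq
  rcases offdiag_alternative hXY ht h1 h2 h3 with ⟨e, e'⟩ | ⟨e, e'⟩ | ⟨e, e'⟩ | e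
  · exact n0 e e'
  · exact n1 e e'
  · exact n2 e e'
  · refine hd ?_
    rw [← hp, ← hq]
    linear_combination e

end

/-- At an endpoint where `E` vanishes the derivative is `(1 - 2 u) K(u)`, and `1 - 2 u ≠ 0`. -/
theorem mul_deriv_eq_zero {E K : ℝ → ℝ} {u : ℝ} (hE : DifferentiableAt ℝ E u)
    (hK : DifferentiableAt ℝ K u) (hu : u * (1 - u) = 0) (h0 : E u = 0)
    (h : HasDerivAt (fun v => E v ^ 2 + v * (1 - v) * K v) 0 u) : K u = 0 := by
  have h2 := (hE.hasDerivAt.pow 2).add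
    (((hasDerivAt_id u).mul ((hasDerivAt_id u).const_sub 1)).mul hK.hasDerivAt)
  have h3 := h.unique h2
  simp [h0, hu] at h3
  refine h3.resolve_left fun h4 => ?_
  have h5 : u = 1 / 2 := by linarith
  rw [h5] at hu
  norm_num at hu

/-- Exchanging `(α, φ)` with `(β, ψ)` leaves `P` and `Q` unchanged; this symmetry turns statements
about `u` into statements about `z`. -/
theorem aP_comm (α β : Fin 3 → ℝ) (u z : ℝ) : aP α β u z = aP β α z u := by
  simp only [aP]; ring

theorem bP_comm (α β : Fin 3 → ℝ) : bP α β = bP β α := by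
  simp only [bP]; ring

theorem eP_comm (α β : Fin 3 → ℝ) (p u z : ℝ) : eP α β p u z = eP β α p z u := by
  simp only [eP]; ring

theorem aQ_comm (α β : Fin 3 → ℝ) (u z : ℝ) : aQ α β u z = aQ β α z u := by
  simp only [aQ]; ring

theorem bQ_comm (α β : Fin 3 → ℝ) : bQ α β = bQ β α := by
  simp only [bQ]; ring

theorem eQ_comm (α β : Fin 3 → ℝ) (q u z : ℝ) : eQ α β q u z = eQ β α q z u := by
  simp only [eQ]; ring

theorem trigFactor_comm (φ ψ : ℝ) : trigFactor φ ψ = trigFactor ψ φ := by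
  simp only [trigFactor]; ring

theorem resPQ_comm (α β : Fin 3 → ℝ) (p q u z : ℝ) : resPQ α β p q u z = resPQ β α p q z u := by
  rw [resPQ, resPQ, aP_comm α β, bP_comm α β, eP_comm α β, aQ_comm α β, bQ_comm α β, eQ_comm α β]
  ring

theorem elimSq_comm (α β : Fin 3 → ℝ) (x : ℝ × ℝ) (u z : ℝ) :
    elimSq α β x u z = elimSq β α x z u := by
  rw [elimSq, elimSq, aP_comm α β, eP_comm α β, aQ_comm α β, eQ_comm α β]

theorem polyP_comm (α β : Fin 3 → ℝ) (u z s c : ℝ) : polyP α β u z s c = polyP β α z u s c := by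
  rw [polyP, polyP, aP_comm α β, bP_comm α β, eP_comm α β]

theorem polyQ_comm (α β : Fin 3 → ℝ) (u z s c : ℝ) : polyQ α β u z s c = polyQ β α z u s c := by
  rw [polyQ, polyQ, aQ_comm α β, bQ_comm α β, eQ_comm α β]

theorem polyPc_comm (α β : Fin 3 → ℝ) (φ ψ c : ℝ) : polyPc α β φ ψ c = polyPc β α ψ φ c := by
  rw [polyPc, polyPc, aP_comm α β, bP_comm α β, trigFactor_comm]

theorem polyQc_comm (α β : Fin 3 → ℝ) (φ ψ c : ℝ) : polyQc α β φ ψ c = polyQc β α ψ φ c := by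
  rw [polyQc, polyQc, aQ_comm α β, bQ_comm α β, trigFactor_comm]

theorem genericSet_comm (α β : Fin 3 → ℝ) : genericSet α β = genericSet β α := by
  ext x
  have e : lowSum α β = lowSum β α := by simp only [lowSum]; ring
  simp only [genericSet, mem_ofPred_eq, e, elimSq_comm α β]
  have : (∀ i j, (α i + β j) ^ 3 + x.1 * (α i + β j) + x.2 ≠ 0) ↔
      (∀ i j, (β i + α j) ^ 3 + x.1 * (β i + α j) + x.2 ≠ 0) := by
    rw [forall_comm]
    simp only [add_comm (α _)]
  rw [this]
  tauto

section

variable {α β : Fin 3 → ℝ} (hα : α 2 < α 1 ∧ α 1 < α 0) (hβ : β 2 < β 1 ∧ β 1 < β 0)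
  (hα0 : α 0 + α 1 + α 2 = 0) (hβ0 : β 0 + β 1 + β 2 = 0)

include hα hβ hα0 hβ0

/-- At a singular zero the Jacobians in `(φ, c)` and in `(ψ, c)` both vanish, so `Q_c P - P_c Q`,
with the coefficients frozen, is critical in all three angles. The three rotation axes are
independent, as `sin θ ≠ 0`, so `exists_offdiag_ne_zero` applies. -/
theorem resPQ_regular_interior {x : ℝ × ℝ} (hx : x ∈ genericSet α β) {u z : ℝ}
    (hu : u ∈ Ioo (0 : ℝ) 1) (hz : z ∈ Ioo (0 : ℝ) 1) (h0 : resPQ α β x.1 x.2 u z = 0)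
    (h1 : HasDerivAt (fun v => resPQ α β x.1 x.2 v z) 0 u)
    (h2 : HasDerivAt (fun v => resPQ α β x.1 x.2 u v) 0 z) : False := by
  rw [← image_cos_sq] at hu hz
  obtain ⟨φ, hφ, rfl⟩ := hu
  obtain ⟨ψ, hψ, rfl⟩ := hz
  simp only at *
  have hs := trigFactor_pos hφ hψ
  have hB := Btilde_pos hα hβ hα0 hβ0 (sq_nonneg (Real.cos φ)) (sq_nonneg (Real.cos ψ))
  obtain ⟨hP, hQ⟩ := (resPQ_eq_zero_iff α β x.1 x.2 _ _ _ (trigFactor_sq φ ψ) hs.ne' hB.ne' _).2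
    ⟨h0, rfl⟩
  generalize (aP α β (Real.cos φ ^ 2) (Real.cos ψ ^ 2) * eQ α β x.2 (Real.cos φ ^ 2) (Real.cos ψ ^ 2)
        - aQ α β (Real.cos φ ^ 2) (Real.cos ψ ^ 2) * eP α β x.1 (Real.cos φ ^ 2) (Real.cos ψ ^ 2)) /
        (trigFactor φ ψ * Btilde α β (Real.cos φ ^ 2) (Real.cos ψ ^ 2)) = c at hP hQ
  have hc := abs_lt.1 (abs_cos_lt_one hα hβ hα0 hβ0 hx.1 (sq_nonneg _) (sq_nonneg _) hP hQ)
  have hj1 := resPQ_deriv_eq_jac h1 hP hQ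
  have hj2 := resPQ_deriv_eq_jac (α := β) (β := α) (p := x.1) (q := x.2) (φ := ψ) (ψ := φ) (c := c)
    (R := 0) (by simpa only [resPQ_comm α β] using h2)
    (by rw [polyP_comm, trigFactor_comm]; exact hP) (by rw [polyQ_comm, trigFactor_comm]; exact hQ)
  have hB' := Btilde_pos hβ hα hβ0 hα0 (sq_nonneg (Real.cos ψ)) (sq_nonneg (Real.cos φ))
  have hs' := trigFactor_pos hψ hφ
  rw [zero_mul, eq_comm] at hj1 hj2
  replace hj1 := (mul_eq_zero.1 hj1).resolve_left (mul_pos hs hB).ne'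
  replace hj2 := (mul_eq_zero.1 hj2).resolve_left (mul_pos hs' hB').ne'
  rw [jac] at hj1 hj2
  rw [← polyPc_comm, ← polyQc_comm] at hj2
  -- `aQ * P_c - aP * Q_c = s * Btilde` is not zero.
  have hXY : polyQc α β φ ψ c ≠ 0 ∨ -polyPc α β φ ψ c ≠ 0 := by
    by_contra! h
    obtain ⟨k1, k2⟩ := h
    have e := Btilde_eq α β (Real.cos φ ^ 2) (Real.cos ψ ^ 2)
    rw [polyQc] at k1
    rw [polyPc] at k2
    have : trigFactor φ ψ * Btilde α β (Real.cos φ ^ 2) (Real.cos ψ ^ 2) = 0 := by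
      rw [e]
      linear_combination -aQ α β (Real.cos φ ^ 2) (Real.cos ψ ^ 2) * k2 -
        aP α β (Real.cos φ ^ 2) (Real.cos ψ ^ 2) * k1
    exact (mul_pos hs hB).ne' this
  obtain ⟨θ, hθ, rfl⟩ : ∃ θ ∈ Ioo 0 Real.pi, Real.cos θ = c :=
    ⟨Real.arccos c, ⟨Real.arccos_pos.2 hc.2, Real.arccos_lt_pi.2 hc.1⟩,
      Real.cos_arccos hc.1.le hc.2.le⟩
  have hsθ := Real.sin_pos_of_mem_Ioo hθ
  have f1 := polyPc_eq α β hα0 hβ0 φ θ ψ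
  have f2 := polyQc_eq α β hα0 hβ0 φ θ ψ
  rw [polyPφ_eq α β hβ0, polyQφ_eq α β hα0 hβ0] at hj1
  rw [polyPψ_eq α β hα0 hβ0, polyQψ_eq α β hα0 hβ0] at hj2
  have hα01 : α 0 - α 1 ≠ 0 := (sub_pos.2 hα.2).ne'
  have hα12 : α 1 - α 2 ≠ 0 := (sub_pos.2 hα.1).ne'
  have hα20 : α 2 - α 0 ≠ 0 := (sub_neg.2 (hα.1.trans hα.2)).ne
  generalize polyQc α β φ ψ (Real.cos θ) = X at *
  generalize polyPc α β φ ψ (Real.cos θ) = Y at *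
  have hM : eulerMatrix α β φ θ ψ = sumMatrix α β (rz φ * ry θ * rz ψ).1 := rfl
  have hPQ : PQ α β (rz φ * ry θ * rz ψ) = x := by
    refine Prod.ext ?_ ?_
    · exact (coeffP_euler α β hα0 hβ0 φ θ ψ).trans hP
    · exact (coeffQ_euler α β hα0 hβ0 φ θ ψ).trans hQ
  rw [hM] at f1 f2 hj1 hj2
  clear hM
  generalize rz φ * ry θ * rz ψ = M at *
  set E := sumMatrix α β M.1
  have e01 : X * E 0 1 + -Y * adjOff E 0 1 2 = 0 :=
    (mul_eq_zero.1 (by linear_combination hj1 :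
      (2 * (α 0 - α 1)) * (X * E 0 1 + -Y * adjOff E 0 1 2) = 0)).resolve_left (by simpa using hα01)
  have k1 : Real.cos φ * ((α 2 - α 0) * (X * E 0 2 + -Y * adjOff E 0 2 1)) -
      Real.sin φ * ((α 1 - α 2) * (X * E 1 2 + -Y * adjOff E 1 2 0)) = 0 := by
    linear_combination (Y * f2 - X * f1) / 2
  have k2 : Real.cos φ * ((α 1 - α 2) * (X * E 1 2 + -Y * adjOff E 1 2 0)) +
      Real.sin φ * ((α 2 - α 0) * (X * E 0 2 + -Y * adjOff E 0 2 1)) = 0 :=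
    mul_left_cancel₀ hsθ.ne' (by
      linear_combination hj2 / 2 - Real.cos θ * (α 0 - α 1) * e01)
  obtain ⟨e02, e12⟩ := lin_sys_eq_zero (Real.cos_sq_add_sin_sq φ) k1 k2
  exact exists_offdiag_ne_zero hα0 hβ0 hx.2.2.1 hx.2.2.2 hPQ hXY e01
    ((mul_eq_zero.1 e02).resolve_left hα20) ((mul_eq_zero.1 e12).resolve_left hα12)

/-- On an edge `R` is the square of `elimSq`. If `R` and its normal derivative vanish, so do both
constant terms, i.e. `c = 0` is a common root; then `α_i + β₃` is a root of the cubic, with `i = 2`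
for `u = 0` and `i = 1` for `u = 1`. -/
theorem resPQ_regular_edge {x : ℝ × ℝ} (hx : x ∈ genericSet α β) {u z : ℝ}
    (hu : u = 0 ∨ u = 1) (hz : z ∈ Icc (0 : ℝ) 1) (h0 : resPQ α β x.1 x.2 u z = 0)
    (h1 : HasDerivAt (fun v => resPQ α β x.1 x.2 v z) 0 u) : False := by
  have hu' : u * (1 - u) = 0 := by rcases hu with rfl | rfl <;> simp
  have hu2 : 0 ≤ u := by rcases hu with rfl | rfl <;> simp
  have hE : elimSq α β x u z = 0 := by
    rw [resPQ_eq_elimSq (by rw [hu']; ring)] at h0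
    exact pow_eq_zero_iff two_ne_zero |>.1 h0
  have hz0 : 0 < z := by
    refine lt_of_le_of_ne hz.1 ?_
    rintro rfl
    rcases hu with rfl | rfl
    · exact hx.2.1.1 hE
    · exact hx.2.1.2.2.1 hE
  have hz1 : z < 1 := by
    refine lt_of_le_of_ne hz.2 ?_
    rintro rfl
    rcases hu with rfl | rfl
    · exact hx.2.1.2.1 hE
    · exact hx.2.1.2.2.2 hE
  have hB := Btilde_pos hα hβ hα0 hβ0 hu2 hz.1
  have hd : ∀ {f : ℝ → ℝ}, (∃ a b, ∀ v, f v = a + b * v) → Differentiable ℝ f := by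
    rintro f ⟨a, b, h⟩
    rw [show f = _ from funext h]
    fun_prop
  have daP : Differentiable ℝ fun v => aP α β v z := hd ⟨_, _, fun v => aP_affine α β v z⟩
  have daQ : Differentiable ℝ fun v => aQ α β v z := hd ⟨_, _, fun v => aQ_affine α β v z⟩
  have deP : Differentiable ℝ fun v => eP α β x.1 v z := hd ⟨_, _, fun v => eP_affine α β _ v z⟩
  have deQ : Differentiable ℝ fun v => eQ α β x.2 v z := hd ⟨_, _, fun v => eQ_affine α β _ v z⟩
  have dE : Differentiable ℝ fun v => elimSq α β x v z := by
    unfold elimSq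
    exact (daP.mul deQ).sub (daQ.mul deP)
  have dK : Differentiable ℝ fun v => -(z * (1 - z) * ((aP α β v z * bQ α β - aQ α β v z * bP α β) *
      (bP α β * eQ α β x.2 v z - bQ α β * eP α β x.1 v z))) :=
    ((((daP.mul_const (bQ α β)).sub (daQ.mul_const (bP α β))).mul
        ((deQ.const_mul (bP α β)).sub (deP.const_mul (bQ α β)))).const_mul (z * (1 - z))).neg
  have hG := mul_deriv_eq_zero (dE u) (dK u) hu' hE
    (h1.congr_of_eventuallyEq (Eventually.of_forall fun v => by
      simp only [resPQ, elimSq]; ring))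
  have hK : bP α β * eQ α β x.2 u z - bQ α β * eP α β x.1 u z = 0 := by
    have e : (z * (1 - z) * Btilde α β u z) *
        (bP α β * eQ α β x.2 u z - bQ α β * eP α β x.1 u z) = 0 := by
      rw [Btilde_eq]; linear_combination hG
    exact (mul_eq_zero.1 e).resolve_left (mul_pos (mul_pos hz0 (by linarith)) hB).ne'
  rw [elimSq] at hE
  have hP0 : eP α β x.1 u z = 0 :=
    (mul_eq_zero.1 (by rw [Btilde_eq]; linear_combination aP α β u z * hK - bP α β * hE :
      Btilde α β u z * eP α β x.1 u z = 0)).resolve_left hB.ne'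
  have hQ0 : eQ α β x.2 u z = 0 :=
    (mul_eq_zero.1 (by rw [Btilde_eq]; linear_combination aQ α β u z * hK - bQ α β * hE :
      Btilde α β u z * eQ α β x.2 u z = 0)).resolve_left hB.ne'
  have e2 : β 2 = - β 0 - β 1 := by linarith
  rcases hu with rfl | rfl
  · refine hx.2.2.1 1 2 ?_
    rw [e2]
    simp only [eP, eQ] at hP0 hQ0
    linear_combination -(α 1 + (-β 0 - β 1)) * hP0 - hQ0
  · refine hx.2.2.1 0 2 ?_
    rw [e2]
    simp only [eP, eQ] at hP0 hQ0
    linear_combination -(α 0 + (-β 0 - β 1)) * hP0 - hQ0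

/-- Zero is a regular value of the resultant on the unit square. -/
theorem resPQ_regular {x : ℝ × ℝ} (hx : x ∈ genericSet α β) {u z : ℝ}
    (hu : u ∈ Icc (0 : ℝ) 1) (hz : z ∈ Icc (0 : ℝ) 1) (h0 : resPQ α β x.1 x.2 u z = 0)
    (h1 : HasDerivAt (fun v => resPQ α β x.1 x.2 v z) 0 u)
    (h2 : HasDerivAt (fun v => resPQ α β x.1 x.2 u v) 0 z) : False := by
  by_cases hu' : u = 0 ∨ u = 1
  · exact resPQ_regular_edge hα hβ hα0 hβ0 hx hu' hz h0 h1
  by_cases hz' : z = 0 ∨ z = 1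
  · refine resPQ_regular_edge hβ hα hβ0 hα0 (genericSet_comm α β ▸ hx) hz' hu
      (resPQ_comm α β _ _ _ _ ▸ h0) ?_
    simpa only [resPQ_comm α β] using h2
  push Not at hu' hz'
  exact resPQ_regular_interior hα hβ hα0 hβ0 hx
    ⟨lt_of_le_of_ne hu.1 hu'.1.symm, lt_of_le_of_ne hu.2 hu'.2⟩
    ⟨lt_of_le_of_ne hz.1 hz'.1.symm, lt_of_le_of_ne hz.2 hz'.2⟩ h0 h1 h2

end

end

/-! ### From `(P, Q)` to the eigenvalues -/

section

open scoped ENNReal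

/-- The coefficients of the cubic with roots `g.1`, `g.2`, `-g.1 - g.2`. -/
def cubicPQ (g : ℝ × ℝ) : ℝ × ℝ :=
  (g.1 * g.2 + g.2 * (-g.1 - g.2) + (-g.1 - g.2) * g.1, -(g.1 * g.2 * (-g.1 - g.2)))

/-- Pairs `(γ₁, γ₂)` with `γ₁ ≥ γ₂ ≥ -γ₁ - γ₂`. -/
def topPairs : Set (ℝ × ℝ) := {g | -g.1 - g.2 ≤ g.2 ∧ g.2 ≤ g.1}

theorem measurableSet_topPairs : MeasurableSet topPairs := by
  refine IsClosed.measurableSet ?_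
  have h1 : IsClosed {g : ℝ × ℝ | -g.1 - g.2 ≤ g.2} := isClosed_le (by fun_prop) (by fun_prop)
  have h2 : IsClosed {g : ℝ × ℝ | g.2 ≤ g.1} := isClosed_le (by fun_prop) (by fun_prop)
  exact h1.inter h2

theorem continuous_cubicPQ : Continuous cubicPQ := by
  unfold cubicPQ
  fun_prop

theorem differentiable_cubicPQ : Differentiable ℝ cubicPQ := by
  unfold cubicPQ
  fun_prop

theorem cubicPQ_eval (g : ℝ × ℝ) (t : ℝ) :
    t ^ 3 + (cubicPQ g).1 * t + (cubicPQ g).2 = (t - g.1) * (t - g.2) * (t - (-g.1 - g.2)) := by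
  simp only [cubicPQ]; ring

/-- With equal cubics the largest root of each is a root of the other, hence at most its largest
root; dually for the smallest. -/
theorem injOn_cubicPQ : InjOn cubicPQ topPairs := by
  have key : ∀ g ∈ topPairs, ∀ h ∈ topPairs, cubicPQ g = cubicPQ h →
      g.1 ≤ h.1 ∧ -h.1 - h.2 ≤ -g.1 - g.2 := by
    rintro g hg h hh e
    have h1 := cubicPQ_eval h g.1
    have h3 := cubicPQ_eval h (-g.1 - g.2)
    rw [← e, cubicPQ_eval] at h1 h3
    have h1' : (g.1 - h.1) * (g.1 - h.2) * (g.1 - (-h.1 - h.2)) = 0 := by rw [← h1]; ring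
    have h3' : ((-g.1 - g.2) - h.1) * ((-g.1 - g.2) - h.2) * ((-g.1 - g.2) - (-h.1 - h.2)) = 0 := by
      rw [← h3]; ring
    obtain ⟨g1, g2⟩ := hg
    obtain ⟨k1, k2⟩ := hh
    constructor
    · rcases mul_eq_zero.1 h1' with k | k
      · rcases mul_eq_zero.1 k with k | k <;> linarith
      · linarith
    · rcases mul_eq_zero.1 h3' with k | k
      · rcases mul_eq_zero.1 k with k | k <;> linarith
      · linarith
  intro g hg h hh e
  have a := key g hg h hh e
  have b := key h hh g hg e.symm
  exact Prod.ext (by linarith) (by linarith)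

theorem det_prod (L : ℝ × ℝ →L[ℝ] ℝ × ℝ) :
    L.det = (L (1, 0)).1 * (L (0, 1)).2 - (L (1, 0)).2 * (L (0, 1)).1 := by
  let b := Module.Basis.finTwoProd ℝ
  have e : LinearMap.toMatrix b b (L : ℝ × ℝ →ₗ[ℝ] ℝ × ℝ) =
      !![(L (1, 0)).1, (L (0, 1)).1; (L (1, 0)).2, (L (0, 1)).2] := by
    ext i j
    fin_cases i <;> fin_cases j <;> simp [b, LinearMap.toMatrix_apply]
  rw [ContinuousLinearMap.det, ← LinearMap.det_toMatrix b, e, Matrix.det_fin_two]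
  simp
  ring

theorem abs_det_fderiv_cubicPQ (g : ℝ × ℝ) : |(fderiv ℝ cubicPQ g).det| =
    |(g.1 - g.2) * (g.1 - (-g.1 - g.2)) * (g.2 - (-g.1 - g.2))| := by
  have h : HasFDerivAt cubicPQ (fderiv ℝ cubicPQ g) g := (differentiable_cubicPQ g).hasFDerivAt
  have hA := h.comp_hasDerivAt_of_eq g.1
    ((hasDerivAt_id g.1).prodMk (hasDerivAt_const g.1 g.2)) rfl
  have hB := h.comp_hasDerivAt_of_eq g.2
    ((hasDerivAt_const g.2 g.1).prodMk (hasDerivAt_id g.2)) rfl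
  have hA' : HasDerivAt (fun t => cubicPQ (t, g.2))
      (-2 * g.1 - g.2, 2 * g.1 * g.2 + g.2 ^ 2) g.1 := by
    have i := hasDerivAt_id g.1
    refine HasDerivAt.prodMk ?_ ?_
    · exact (((i.mul_const g.2).add (((i.neg).sub_const g.2).const_mul g.2)).add
        ((i.neg.sub_const g.2).mul i)).congr_deriv (by simp; ring)
    · exact ((i.mul_const g.2).mul (i.neg.sub_const g.2)).neg.congr_deriv (by simp; ring)
  have hB' : HasDerivAt (fun t => cubicPQ (g.1, t))
      (-g.1 - 2 * g.2, g.1 ^ 2 + 2 * g.1 * g.2) g.2 := by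
    have i := hasDerivAt_id g.2
    refine HasDerivAt.prodMk ?_ ?_
    · exact (((i.const_mul g.1).add (i.mul (i.const_sub (-g.1)))).add
        ((i.const_sub (-g.1)).mul_const g.1)).congr_deriv (by simp; ring)
    · exact ((i.const_mul g.1).mul (i.const_sub (-g.1))).neg.congr_deriv (by simp; ring)
  rw [det_prod, hA.unique hA', hB.unique hB', ← abs_neg]
  congr 1
  ring

theorem topEigenvalues_mem (α β : Fin 3 → ℝ) (hα0 : α 0 + α 1 + α 2 = 0)
    (hβ0 : β 0 + β 1 + β 2 = 0) (M : SO3) :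
    topEigenvalues α β M ∈ topPairs ∧ cubicPQ (topEigenvalues α β M) = PQ α β M := by
  set hA := sumMatrix_isHermitian α β M.1
  have hr := hA.roots_charpoly_eq_eigenvalues₀
  set e : Fin 3 → ℝ := fun i => hA.eigenvalues₀ (finCongr (Fintype.card_fin 3).symm i) with he
  have hanti : Antitone e := fun i j hij => hA.eigenvalues₀_antitone (by simpa using hij)
  have hroots : (sumMatrix α β M.1).charpoly.roots = Multiset.map e Finset.univ.val := by
    rw [hr]
    have : Multiset.map e Finset.univ.val = Multiset.map hA.eigenvalues₀
        (Multiset.map (finCongr (Fintype.card_fin 3).symm) Finset.univ.val) := by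
      rw [Multiset.map_map]; rfl
    rw [this, Multiset.map_univ_val_equiv]
    rfl
  have hsplit : (sumMatrix α β M.1).charpoly.Splits := hA.splits_charpoly
  have hprod := hsplit.eq_prod_roots_of_monic (Matrix.charpoly_monic _)
  rw [hroots] at hprod
  have hev : ∀ t : ℝ, t ^ 3 + (PQ α β M).1 * t + (PQ α β M).2 = (t - e 0) * (t - e 1) * (t - e 2) := by
    intro t
    have h1 := congrArg (Polynomial.eval t) hprod
    rw [sumMatrix_charpoly α β hα0 hβ0] at h1
    simp [Fin.univ_succ] at h1
    simp only [PQ, h1]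
    ring
  -- The second difference over `-1, 0, 1` reads off the missing `t ^ 2` coefficient.
  have ht : e 0 + e 1 + e 2 = 0 := by
    have h0 := hev 0
    have h1 := hev 1
    have h2 := hev (-1)
    nlinarith
  have htop : topEigenvalues α β M = (e 0, e 1) := rfl
  have e2 : e 2 = -e 0 - e 1 := by linarith
  rw [htop]
  refine ⟨⟨?_, hanti (by decide)⟩, ?_⟩
  · rw [← e2]; exact hanti (by decide)
  · have h0 := hev 0
    have h1 := hev 1
    rw [e2] at h0 h1
    refine Prod.ext ?_ ?_ <;> simp only [cubicPQ] <;> linarith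

theorem measurableSet_image_cubicPQ {A : Set (ℝ × ℝ)} (hA : MeasurableSet A) :
    MeasurableSet (cubicPQ '' (A ∩ topPairs)) :=
  (hA.inter measurableSet_topPairs).image_of_continuousOn_injOn continuous_cubicPQ.continuousOn
    (injOn_cubicPQ.mono inter_subset_right)

section

variable {α β : Fin 3 → ℝ} (hα0 : α 0 + α 1 + α 2 = 0) (hβ0 : β 0 + β 1 + β 2 = 0)

include hα0 hβ0

/-- The eigenvalue pair is `PQ` followed by the inverse of `cubicPQ` on `topPairs`; measurability
comes from this, not from continuity of eigenvalues. -/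
theorem preimage_topEigenvalues (A : Set (ℝ × ℝ)) :
    topEigenvalues α β ⁻¹' A = PQ α β ⁻¹' (cubicPQ '' (A ∩ topPairs)) := by
  ext M
  obtain ⟨h1, h2⟩ := topEigenvalues_mem α β hα0 hβ0 M
  constructor
  · exact fun h => ⟨_, ⟨h, h1⟩, h2⟩
  · rintro ⟨g, ⟨hg, hgT⟩, e⟩
    rw [← h2] at e
    rw [mem_preimage, ← injOn_cubicPQ hgT h1 e]
    exact hg

variable [MeasurableSpace SO3] [BorelSpace SO3]

theorem measurable_topEigenvalues : Measurable (topEigenvalues α β) := fun A hA => by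
  rw [preimage_topEigenvalues hα0 hβ0]
  exact (continuous_PQ α β).measurable (measurableSet_image_cubicPQ hA)

/-- The density of `(γ₁, γ₂)` in terms of that of `(P, Q)`. -/
theorem map_topEigenvalues (μ : Measure SO3) [HasPDF (PQ α β) μ volume] :
    μ.map (topEigenvalues α β) = volume.withDensity (topPairs.indicator fun g =>
      ENNReal.ofReal |(g.1 - g.2) * (g.1 - (-g.1 - g.2)) * (g.2 - (-g.1 - g.2))| *
        pdf (PQ α β) μ volume (cubicPQ g)) := by
  ext A hA
  rw [Measure.map_apply (measurable_topEigenvalues hα0 hβ0) hA, preimage_topEigenvalues hα0 hβ0,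
    ← Measure.map_apply (continuous_PQ α β).measurable (measurableSet_image_cubicPQ hA),
    map_eq_setLIntegral_pdf _ _ volume (measurableSet_image_cubicPQ hA),
    lintegral_image_eq_lintegral_abs_det_fderiv_mul _ (hA.inter measurableSet_topPairs)
      (fun g _ => (differentiable_cubicPQ g).hasFDerivAt.hasFDerivWithinAt)
      (injOn_cubicPQ.mono inter_subset_right), withDensity_apply _ hA,
    setLIntegral_indicator measurableSet_topPairs, inter_comm]
  simp_rw [abs_det_fderiv_cubicPQ]

theorem hasPDF_topEigenvalues (μ : Measure SO3) [IsProbabilityMeasure μ]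
    [HasPDF (PQ α β) μ volume] : HasPDF (topEigenvalues α β) μ volume ∧
    (∀ᵐ g : ℝ × ℝ, ∀ g₃ : ℝ, g₃ = -g.1 - g.2 →
      (g₃ ≤ g.2 ∧ g.2 ≤ g.1 →
        pdf (topEigenvalues α β) μ volume g =
          ENNReal.ofReal |(g.1 - g.2) * (g.1 - g₃) * (g.2 - g₃)| *
            pdf (PQ α β) μ volume
              (g.1 * g.2 + g.2 * g₃ + g₃ * g.1, -(g.1 * g.2 * g₃))) ∧
      (¬ (g₃ ≤ g.2 ∧ g.2 ≤ g.1) →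
        pdf (topEigenvalues α β) μ volume g = 0)) := by
  have hm : AEMeasurable (topPairs.indicator fun g : ℝ × ℝ =>
      ENNReal.ofReal |(g.1 - g.2) * (g.1 - (-g.1 - g.2)) * (g.2 - (-g.1 - g.2))| *
        pdf (PQ α β) μ volume (cubicPQ g)) volume := by
    have := (measurable_pdf (PQ α β) μ volume).comp continuous_cubicPQ.measurable
    exact (Measurable.indicator (by fun_prop) measurableSet_topPairs).aemeasurable
  have h := hasPDF_of_map_eq_withDensity (measurable_topEigenvalues hα0 hβ0).aemeasurable _ hm
    (map_topEigenvalues hα0 hβ0 μ)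
  refine ⟨h, ?_⟩
  filter_upwards [(pdf.eq_of_map_eq_withDensity _ hm).1 (map_topEigenvalues hα0 hβ0 μ)] with g hg
  rintro _ rfl
  rw [hg]
  refine ⟨fun hT => ?_, fun hT => ?_⟩
  · rw [indicator_of_mem (show g ∈ topPairs from hT)]
    rfl
  · rw [indicator_of_notMem (show g ∉ topPairs from hT)]

end

end

/-! ### Delta integrals by integration by parts -/

section

theorem intervalIntegral_swap_of_continuous {f : ℝ → ℝ → ℝ}
    (hf : Continuous fun y : ℝ × ℝ => f y.1 y.2) :
    ∫ z in (0 : ℝ)..1, ∫ u in (0 : ℝ)..1, f u z = ∫ u in (0 : ℝ)..1, ∫ z in (0 : ℝ)..1, f u z := by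
  simp_rw [intervalIntegral.integral_of_le zero_le_one]
  refine integral_integral_swap ?_
  rw [Measure.prod_restrict]
  have h : Continuous (Function.uncurry fun z u => f u z) := hf.comp continuous_swap
  have : IntegrableOn (Function.uncurry fun z u => f u z) (Icc 0 1 ×ˢ Icc 0 1)
      ((volume : Measure ℝ).prod volume) :=
    h.continuousOn.integrableOn_compact (isCompact_Icc.prod isCompact_Icc)
  exact this.mono_set (prod_mono Ioc_subset_Icc_self Ioc_subset_Icc_self)

/-- A primitive of a continuous bump of integral one is a smoothed Heaviside function. -/
theorem exists_smoothed_heaviside {η : ℝ → ℝ} (hη : Continuous η) (hc : HasCompactSupport η)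
    (h1 : ∫ t, η t = 1) : ∃ H : ℝ → ℝ, (∀ t, HasDerivAt H (η t) t) ∧
      ∃ L > 0, (∀ t ≤ -L, H t = 0) ∧ (∀ t, L ≤ t → H t = 1) ∧ (∀ t, L ≤ |t| → t * η t = 0) ∧
      ∃ C, 0 ≤ C ∧ (∀ t, |H t| ≤ C) ∧ ∀ t, |t * η t| ≤ C := by
  obtain ⟨L, hL0, hL⟩ : ∃ L > 0, ∀ t, L ≤ |t| → η t = 0 := by
    obtain ⟨r, hr⟩ := hc.isCompact.isBounded.subset_closedBall 0
    refine ⟨max r 0 + 1, by positivity, fun t ht => ?_⟩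
    by_contra h
    have h2 := hr (subset_tsupport _ (Function.mem_support.2 h))
    rw [mem_closedBall_zero_iff, Real.norm_eq_abs] at h2
    linarith [le_max_left r 0]
  have hd : ∀ t, HasDerivAt (fun t => ∫ s in (-L)..t, η s) (η t) t := fun t =>
    intervalIntegral.integral_hasDerivAt_right (hη.intervalIntegrable _ _)
      (hη.stronglyMeasurableAtFilter _ _) hη.continuousAt
  have hl : ∀ t ≤ -L, ∫ s in (-L)..t, η s = 0 := by
    intro t ht
    rw [intervalIntegral.integral_congr (g := fun _ => 0)]
    · simp
    · intro s hs
      rw [uIcc_of_ge ht] at hs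
      exact hL s (by rw [abs_of_nonpos (by linarith [hs.2])]; linarith [hs.2])
  have hr : ∀ t, L ≤ t → ∫ s in (-L)..t, η s = 1 := by
    intro t ht
    rw [intervalIntegral.integral_of_le (by linarith), ← h1]
    refine setIntegral_eq_integral_of_forall_compl_eq_zero fun s hs => hL s ?_
    rw [mem_Ioc, not_and_or, not_lt, not_le] at hs
    rcases hs with hs | hs
    · rw [abs_of_nonpos (by linarith)]; linarith
    · rw [abs_of_nonneg (by linarith)]; linarith
  refine ⟨fun t => ∫ s in (-L)..t, η s, hd, L, hL0, hl, hr, fun t ht => by rw [hL t ht, mul_zero], ?_⟩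
  have hcont : Continuous fun t => ∫ s in (-L)..t, η s :=
    continuous_iff_continuousAt.2 fun t => (hd t).continuousAt
  obtain ⟨C, hC⟩ := isCompact_Icc.exists_bound_of_continuousOn (s := Icc (-L) L) hcont.continuousOn
  obtain ⟨D, hD⟩ := isCompact_Icc.exists_bound_of_continuousOn (s := Icc (-L) L)
    (continuous_id.mul hη).continuousOn
  refine ⟨max (max C D) 1, by positivity, fun t => ?_, fun t => ?_⟩
  · beta_reduce
    rcases le_total t (-L) with h | h
    · rw [hl t h, abs_zero]; positivity
    rcases le_total L t with h' | h'
    · rw [hr t h', abs_one]; exact le_max_right _ _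
    · exact (hC t ⟨h, h'⟩).trans ((le_max_left _ _).trans (le_max_left _ _))
  · rcases le_total L |t| with h | h
    · rw [hL t h, mul_zero, abs_zero]; positivity
    · exact (hD t (abs_le.1 h)).trans ((le_max_right _ _).trans (le_max_left _ _))

/-- A vector field `(V, W)` on the unit square with `V F_u + W F_z + E F = w`, with the partial
derivatives `V_u`, `W_z`. -/
structure TransverseField (w F : ℝ → ℝ → ℝ) where
  /-- The first component. -/
  V : ℝ → ℝ → ℝ
  /-- The second component. -/
  W : ℝ → ℝ → ℝ
  /-- The coefficient of `F`. -/
  E : ℝ → ℝ → ℝ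
  /-- The derivative of the first component. -/
  Vu : ℝ → ℝ → ℝ
  /-- The derivative of the second component. -/
  Wz : ℝ → ℝ → ℝ
  /-- The derivative of the function in the first variable. -/
  Fu : ℝ → ℝ → ℝ
  /-- The derivative of the function in the second variable. -/
  Fz : ℝ → ℝ → ℝ
  continuous_V : Continuous fun y : ℝ × ℝ => V y.1 y.2
  continuous_W : Continuous fun y : ℝ × ℝ => W y.1 y.2
  continuous_E : Continuous fun y : ℝ × ℝ => E y.1 y.2
  continuous_Vu : Continuous fun y : ℝ × ℝ => Vu y.1 y.2
  continuous_Wz : Continuous fun y : ℝ × ℝ => Wz y.1 y.2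
  continuous_F : Continuous fun y : ℝ × ℝ => F y.1 y.2
  continuous_Fu : Continuous fun y : ℝ × ℝ => Fu y.1 y.2
  continuous_Fz : Continuous fun y : ℝ × ℝ => Fz y.1 y.2
  hasDerivAt_F_left : ∀ u z, HasDerivAt (fun u => F u z) (Fu u z) u
  hasDerivAt_F_right : ∀ u z, HasDerivAt (fun z => F u z) (Fz u z) z
  hasDerivAt_V : ∀ u ∈ Ioo (0 : ℝ) 1, ∀ z ∈ Icc (0 : ℝ) 1, HasDerivAt (fun u => V u z) (Vu u z) u
  hasDerivAt_W : ∀ u ∈ Icc (0 : ℝ) 1, ∀ z ∈ Ioo (0 : ℝ) 1, HasDerivAt (fun z => W u z) (Wz u z) z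
  eq_w : ∀ u ∈ Icc (0 : ℝ) 1, ∀ z ∈ Icc (0 : ℝ) 1,
    V u z * Fu u z + W u z * Fz u z + E u z * F u z = w u z

namespace TransverseField

variable {w F : ℝ → ℝ → ℝ} (T : TransverseField w F)

/-- The result of integrating `w δ(F)` by parts, where `h`, `k` stand for `H ∘ F` and
`F (δ ∘ F)`, `H` being a primitive of `δ`. -/
def byParts (h k : ℝ → ℝ → ℝ) : ℝ :=
  (∫ z in (0 : ℝ)..1, (T.V 1 z * h 1 z - T.V 0 z * h 0 z))
    + (∫ u in (0 : ℝ)..1, (T.W u 1 * h u 1 - T.W u 0 * h u 0))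
    + ∫ z in (0 : ℝ)..1, ∫ u in (0 : ℝ)..1, (T.E u z * k u z - (T.Vu u z + T.Wz u z) * h u z)

theorem integral_sub_sub {f g h : ℝ → ℝ} (hf : Continuous f) (hg : Continuous g)
    (hh : Continuous h) : ∫ t in (0 : ℝ)..1, (f t - g t - h t) =
      (∫ t in (0 : ℝ)..1, f t) - (∫ t in (0 : ℝ)..1, g t) - ∫ t in (0 : ℝ)..1, h t := by
  rw [← intervalIntegral.integral_sub (hf.intervalIntegrable _ _) (hg.intervalIntegrable _ _),
    ← intervalIntegral.integral_sub (f := fun t => f t - g t)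
      ((hf.sub hg).intervalIntegrable _ _) (hh.intervalIntegrable _ _)]

theorem integral_by_parts {f g f' h h' : ℝ → ℝ} (hf : Continuous f) (hh : Continuous h)
    (hf' : Continuous f') (hh' : Continuous h') (hg : Continuous g)
    (hdf : ∀ t ∈ Ioo (0 : ℝ) 1, HasDerivAt f (f' t) t) (hdh : ∀ t, HasDerivAt h (h' t * g t) t) :
    ∫ t in (0 : ℝ)..1, f t * g t * h' t = (f 1 * h 1 - f 0 * h 0) - ∫ t in (0 : ℝ)..1, f' t * h t := by
  have h1 := intervalIntegral.integral_eq_sub_of_hasDerivAt_of_le zero_le_one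
    (hf.mul hh).continuousOn (fun t ht => (hdf t ht).mul (hdh t))
    (Continuous.intervalIntegrable (by fun_prop) _ _)
  simp only [Pi.mul_apply] at h1
  rw [← h1, ← intervalIntegral.integral_sub (Continuous.intervalIntegrable (by fun_prop) _ _)
    (Continuous.intervalIntegrable (by fun_prop) _ _)]
  refine intervalIntegral.integral_congr fun t _ => ?_
  ring

/-- By `eq_w` the integrand is `V ∂_u H(F/ε) + W ∂_z H(F/ε) + E (F/ε) η(F/ε)`. Moving the
derivatives onto `V` and `W` removes the singular factor `ε⁻¹`. -/
theorem integral_eq_byParts {η H : ℝ → ℝ} (hη : Continuous η) (hH : ∀ t, HasDerivAt H (η t) t)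
    {ε : ℝ} (hε : 0 < ε) :
    ∫ z in (0 : ℝ)..1, ∫ u in (0 : ℝ)..1, w u z * (ε⁻¹ * η (F u z / ε)) =
      T.byParts (fun u z => H (F u z / ε)) (fun u z => F u z / ε * η (F u z / ε)) := by
  obtain ⟨cV, cW, cE, cVu, cWz, cF, cFu, cFz⟩ := And.intro T.continuous_V (And.intro T.continuous_W
    (And.intro T.continuous_E (And.intro T.continuous_Vu (And.intro T.continuous_Wz
    (And.intro T.continuous_F (And.intro T.continuous_Fu T.continuous_Fz))))))
  have cH : Continuous H := continuous_iff_continuousAt.2 fun t => (hH t).continuousAt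
  have hd : ∀ {f : ℝ → ℝ} {f' t : ℝ}, HasDerivAt f f' t →
      HasDerivAt (fun t => H (f t / ε)) (ε⁻¹ * η (f t / ε) * f') t := by
    intro f f' t hf
    exact ((hH (f t / ε)).comp t (hf.div_const ε)).congr_deriv (by field_simp)
  have sl1 : ∀ {f : ℝ → ℝ → ℝ}, (Continuous fun y : ℝ × ℝ => f y.1 y.2) → ∀ z,
      Continuous fun u => f u z := fun hf z => hf.comp (by fun_prop : Continuous fun u => (u, z))
  have sl2 : ∀ {f : ℝ → ℝ → ℝ}, (Continuous fun y : ℝ × ℝ => f y.1 y.2) → ∀ u,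
      Continuous fun z => f u z := fun hf u => hf.comp (by fun_prop : Continuous fun z => (u, z))
  have cη : Continuous fun y : ℝ × ℝ => ε⁻¹ * η (F y.1 y.2 / ε) := by fun_prop
  have cHF : Continuous fun y : ℝ × ℝ => H (F y.1 y.2 / ε) := by fun_prop
  have cη1 := sl1 (f := fun u z => ε⁻¹ * η (F u z / ε)) cη
  have cη2 := sl2 (f := fun u z => ε⁻¹ * η (F u z / ε)) cη
  have cH1 := sl1 (f := fun u z => H (F u z / ε)) cHF
  have cH2 := sl2 (f := fun u z => H (F u z / ε)) cHF
  have pc : ∀ {f : ℝ → ℝ → ℝ}, (Continuous fun y : ℝ × ℝ => f y.1 y.2) →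
      Continuous fun z => ∫ u in (0 : ℝ)..1, f u z := fun {f} hf =>
    intervalIntegral.continuous_parametric_intervalIntegral_of_continuous'
      (f := fun z u => f u z) (hf.comp continuous_swap) 0 1
  have e1 : ∀ z ∈ Icc (0 : ℝ) 1,
      ∫ u in (0 : ℝ)..1, T.V u z * T.Fu u z * (ε⁻¹ * η (F u z / ε)) =
      (T.V 1 z * H (F 1 z / ε) - T.V 0 z * H (F 0 z / ε)) -
        ∫ u in (0 : ℝ)..1, T.Vu u z * H (F u z / ε) := fun z hz =>
    integral_by_parts (h := fun u => H (F u z / ε)) (h' := fun u => ε⁻¹ * η (F u z / ε)) (sl1 cV z)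
      (cH1 z) (sl1 cVu z)
      (cη1 z) (sl1 cFu z)
      (fun u hu => T.hasDerivAt_V u hu z hz) fun u => hd (T.hasDerivAt_F_left u z)
  have e2 : ∀ u ∈ Icc (0 : ℝ) 1,
      ∫ z in (0 : ℝ)..1, T.W u z * T.Fz u z * (ε⁻¹ * η (F u z / ε)) =
      (T.W u 1 * H (F u 1 / ε) - T.W u 0 * H (F u 0 / ε)) -
        ∫ z in (0 : ℝ)..1, T.Wz u z * H (F u z / ε) := fun u hu =>
    integral_by_parts (h := fun z => H (F u z / ε)) (h' := fun z => ε⁻¹ * η (F u z / ε)) (sl2 cW u)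
      (cH2 u) (sl2 cWz u)
      (cη2 u) (sl2 cFz u)
      (fun z hz => T.hasDerivAt_W u hu z hz) fun z => hd (T.hasDerivAt_F_right u z)
  have uI : uIcc (0 : ℝ) 1 = Icc 0 1 := uIcc_of_le zero_le_one
  have s1 : ∫ z in (0 : ℝ)..1, ∫ u in (0 : ℝ)..1, w u z * (ε⁻¹ * η (F u z / ε)) =
      (∫ z in (0 : ℝ)..1, ∫ u in (0 : ℝ)..1, T.V u z * T.Fu u z * (ε⁻¹ * η (F u z / ε))) +
      (∫ z in (0 : ℝ)..1, ∫ u in (0 : ℝ)..1, T.W u z * T.Fz u z * (ε⁻¹ * η (F u z / ε))) +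
      ∫ z in (0 : ℝ)..1, ∫ u in (0 : ℝ)..1, T.E u z * (F u z / ε * η (F u z / ε)) := by
    rw [← intervalIntegral.integral_add, ← intervalIntegral.integral_add]
    · refine intervalIntegral.integral_congr fun z hz => ?_
      rw [← intervalIntegral.integral_add, ← intervalIntegral.integral_add]
      · refine intervalIntegral.integral_congr fun u hu => ?_
        rw [uI] at hz hu
        rw [← T.eq_w u hu z hz]
        ring
      all_goals refine Continuous.intervalIntegrable ?_ _ _
      · exact ((sl1 cV z).mul (sl1 cFu z)).mul (cη1 z) |>.add
          (((sl1 cW z).mul (sl1 cFz z)).mul (cη1 z))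
      · exact sl1 (f := fun u z => T.E u z * (F u z / ε * η (F u z / ε))) (by fun_prop) z
      · exact ((sl1 cV z).mul (sl1 cFu z)).mul (cη1 z)
      · exact ((sl1 cW z).mul (sl1 cFz z)).mul (cη1 z)
    all_goals refine Continuous.intervalIntegrable ?_ _ _
    · exact (pc (f := fun u z => T.V u z * T.Fu u z * (ε⁻¹ * η (F u z / ε))) (by fun_prop)).add
        (pc (f := fun u z => T.W u z * T.Fz u z * (ε⁻¹ * η (F u z / ε))) (by fun_prop))
    · exact pc (f := fun u z => T.E u z * (F u z / ε * η (F u z / ε))) (by fun_prop)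
    · exact pc (f := fun u z => T.V u z * T.Fu u z * (ε⁻¹ * η (F u z / ε))) (by fun_prop)
    · exact pc (f := fun u z => T.W u z * T.Fz u z * (ε⁻¹ * η (F u z / ε))) (by fun_prop)
  have pc2 : ∀ {f : ℝ → ℝ → ℝ}, (Continuous fun y : ℝ × ℝ => f y.1 y.2) →
      Continuous fun u => ∫ z in (0 : ℝ)..1, f u z := fun {f} hf =>
    intervalIntegral.continuous_parametric_intervalIntegral_of_continuous'
      (f := f) hf 0 1
  have b1 : Continuous fun z => T.V 1 z * H (F 1 z / ε) - T.V 0 z * H (F 0 z / ε) :=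
    ((sl2 cV 1).mul (cH2 1)).sub ((sl2 cV 0).mul (cH2 0))
  have b2 : Continuous fun u => T.W u 1 * H (F u 1 / ε) - T.W u 0 * H (F u 0 / ε) :=
    ((sl1 cW 1).mul (cH1 1)).sub ((sl1 cW 0).mul (cH1 0))
  have c1 : Continuous fun y : ℝ × ℝ => T.Vu y.1 y.2 * H (F y.1 y.2 / ε) := by fun_prop
  have c2 : Continuous fun y : ℝ × ℝ => T.Wz y.1 y.2 * H (F y.1 y.2 / ε) := by fun_prop
  have c3 : Continuous fun y : ℝ × ℝ => T.E y.1 y.2 * (F y.1 y.2 / ε * η (F y.1 y.2 / ε)) := by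
    fun_prop
  have s2 : ∫ z in (0 : ℝ)..1, ∫ u in (0 : ℝ)..1, T.V u z * T.Fu u z * (ε⁻¹ * η (F u z / ε)) =
      (∫ z in (0 : ℝ)..1, (T.V 1 z * H (F 1 z / ε) - T.V 0 z * H (F 0 z / ε))) -
        ∫ z in (0 : ℝ)..1, ∫ u in (0 : ℝ)..1, T.Vu u z * H (F u z / ε) := by
    rw [← intervalIntegral.integral_sub (b1.intervalIntegrable _ _)
      ((pc (f := fun u z => T.Vu u z * H (F u z / ε)) c1).intervalIntegrable _ _)]
    exact intervalIntegral.integral_congr fun z hz => e1 z (uI ▸ hz)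
  have s3 : ∫ z in (0 : ℝ)..1, ∫ u in (0 : ℝ)..1, T.W u z * T.Fz u z * (ε⁻¹ * η (F u z / ε)) =
      (∫ u in (0 : ℝ)..1, (T.W u 1 * H (F u 1 / ε) - T.W u 0 * H (F u 0 / ε))) -
        ∫ z in (0 : ℝ)..1, ∫ u in (0 : ℝ)..1, T.Wz u z * H (F u z / ε) := by
    rw [intervalIntegral_swap_of_continuous
        (f := fun u z => T.W u z * T.Fz u z * (ε⁻¹ * η (F u z / ε))) (by fun_prop),
      intervalIntegral_swap_of_continuous (f := fun u z => T.Wz u z * H (F u z / ε)) (by fun_prop),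
      ← intervalIntegral.integral_sub (b2.intervalIntegrable _ _)
      ((pc2 (f := fun u z => T.Wz u z * H (F u z / ε)) c2).intervalIntegrable _ _)]
    exact intervalIntegral.integral_congr fun u hu => e2 u (uI ▸ hu)
  have s4 : ∫ z in (0 : ℝ)..1, ∫ u in (0 : ℝ)..1, (T.E u z * (F u z / ε * η (F u z / ε)) -
      (T.Vu u z + T.Wz u z) * H (F u z / ε)) =
      (∫ z in (0 : ℝ)..1, ∫ u in (0 : ℝ)..1, T.E u z * (F u z / ε * η (F u z / ε))) -
      (∫ z in (0 : ℝ)..1, ∫ u in (0 : ℝ)..1, T.Vu u z * H (F u z / ε)) -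
      ∫ z in (0 : ℝ)..1, ∫ u in (0 : ℝ)..1, T.Wz u z * H (F u z / ε) := by
    rw [← integral_sub_sub (pc (f := fun u z => T.E u z * (F u z / ε * η (F u z / ε))) c3)
      (pc (f := fun u z => T.Vu u z * H (F u z / ε)) c1)
      (pc (f := fun u z => T.Wz u z * H (F u z / ε)) c2)]
    refine intervalIntegral.integral_congr fun z _ => ?_
    rw [← integral_sub_sub (sl1 (f := fun u z => T.E u z * (F u z / ε * η (F u z / ε))) c3 z)
      (sl1 (f := fun u z => T.Vu u z * H (F u z / ε)) c1 z)
      (sl1 (f := fun u z => T.Wz u z * H (F u z / ε)) c2 z)]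
    refine intervalIntegral.integral_congr fun u _ => ?_
    ring
  rw [s1, s2, s3, byParts, s4]
  ring

theorem tendsto_integral_unit {f : ℝ → ℝ → ℝ} {g : ℝ → ℝ} {C : ℝ}
    (hf : ∀ ε > 0, Continuous (f ε)) (hC : ∀ ε > 0, ∀ t ∈ Icc (0 : ℝ) 1, |f ε t| ≤ C)
    (hlim : ∀ᵐ t, t ∈ Icc (0 : ℝ) 1 → Tendsto (fun ε => f ε t) (𝓝[>] 0) (𝓝 (g t))) :
    Tendsto (fun ε => ∫ t in (0 : ℝ)..1, f ε t) (𝓝[>] 0) (𝓝 (∫ t in (0 : ℝ)..1, g t)) := by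
  refine intervalIntegral.tendsto_integral_filter_of_dominated_convergence (fun _ => C) ?_ ?_
    intervalIntegrable_const (hlim.mono fun t ht h => ht (by
      rw [uIoc_of_le zero_le_one] at h; exact Ioc_subset_Icc_self h))
  · filter_upwards [self_mem_nhdsWithin] with ε hε
    exact (hf ε hε).aestronglyMeasurable
  · filter_upwards [self_mem_nhdsWithin] with ε hε
    refine ae_of_all _ fun t ht => hC ε hε t ?_
    rw [uIoc_of_le zero_le_one] at ht
    exact Ioc_subset_Icc_self ht

theorem abs_integral_unit_le {f : ℝ → ℝ} {C : ℝ} (h : ∀ t ∈ Icc (0 : ℝ) 1, |f t| ≤ C) :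
    |∫ t in (0 : ℝ)..1, f t| ≤ C := by
  have := intervalIntegral.norm_integral_le_of_norm_le_const (a := 0) (b := 1) (f := f) (C := C)
    fun t ht => h t (Ioc_subset_Icc_self (by rwa [uIoc_of_le zero_le_one] at ht))
  simpa using this

/-- Two boundary integrals with two terms each and three interior terms give the `7`. The bound does
not involve `ε`. -/
theorem abs_byParts_le {A C : ℝ} (hA0 : 0 ≤ A)
    (hA : ∀ u ∈ Icc (0 : ℝ) 1, ∀ z ∈ Icc (0 : ℝ) 1,
      |T.V u z| ≤ A ∧ |T.W u z| ≤ A ∧ |T.E u z| ≤ A ∧ |T.Vu u z| ≤ A ∧ |T.Wz u z| ≤ A)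
    {h k : ℝ → ℝ → ℝ} (hh : ∀ u z, |h u z| ≤ C) (hk : ∀ u z, |k u z| ≤ C) :
    |T.byParts h k| ≤ 7 * A * C := by
  have m : ∀ {a b : ℝ}, |a| ≤ A → |b| ≤ C → |a * b| ≤ A * C := fun {a b} ha hb => by
    rw [abs_mul]; exact mul_le_mul ha hb (abs_nonneg _) hA0
  have i0 : (0 : ℝ) ∈ Icc (0 : ℝ) 1 := ⟨le_rfl, zero_le_one⟩
  have i1 : (1 : ℝ) ∈ Icc (0 : ℝ) 1 := ⟨zero_le_one, le_rfl⟩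
  have h1 : |∫ z in (0 : ℝ)..1, (T.V 1 z * h 1 z - T.V 0 z * h 0 z)| ≤ 2 * (A * C) :=
    abs_integral_unit_le fun z hz => (abs_sub _ _).trans (by
      linarith [m (hA 1 i1 z hz).1 (hh 1 z), m (hA 0 i0 z hz).1 (hh 0 z)])
  have h2 : |∫ u in (0 : ℝ)..1, (T.W u 1 * h u 1 - T.W u 0 * h u 0)| ≤ 2 * (A * C) :=
    abs_integral_unit_le fun u hu => (abs_sub _ _).trans (by
      linarith [m (hA u hu 1 i1).2.1 (hh u 1), m (hA u hu 0 i0).2.1 (hh u 0)])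
  have h3 : |∫ z in (0 : ℝ)..1, ∫ u in (0 : ℝ)..1,
      (T.E u z * k u z - (T.Vu u z + T.Wz u z) * h u z)| ≤ 3 * (A * C) :=
    abs_integral_unit_le fun z hz => abs_integral_unit_le fun u hu => (abs_sub _ _).trans (by
      obtain ⟨-, -, a3, a4, a5⟩ := hA u hu z hz
      rw [add_mul]
      linarith [m a3 (hk u z), m a4 (hh u z), m a5 (hh u z),
        abs_add_le (T.Vu u z * h u z) (T.Wz u z * h u z)])
  calc _ ≤ _ := abs_add_three _ _ _
    _ ≤ 7 * A * C := by linarith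

theorem tendsto_heaviside {H : ℝ → ℝ} {L x : ℝ} (h0 : ∀ t ≤ -L, H t = 0)
    (h1 : ∀ t, L ≤ t → H t = 1) (hx : x ≠ 0) :
    Tendsto (fun ε => H (x / ε)) (𝓝[>] 0) (𝓝 (if 0 < x then 1 else 0)) := by
  refine tendsto_const_nhds.congr' ?_
  have hinv := tendsto_inv_nhdsGT_zero (𝕜 := ℝ)
  split_ifs with h
  · filter_upwards [(hinv.const_mul_atTop h).eventually_ge_atTop L] with ε hε
    rw [div_eq_mul_inv, h1 _ hε]
  · have hx' : x < 0 := lt_of_le_of_ne (not_lt.1 h) hx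
    filter_upwards [(hinv.const_mul_atTop_of_neg hx').eventually_le_atBot (-L)] with ε hε
    rw [div_eq_mul_inv, h0 _ hε]

theorem tendsto_mul_bump {η : ℝ → ℝ} {L x : ℝ} (hL : ∀ t, L ≤ |t| → t * η t = 0) :
    Tendsto (fun ε => x / ε * η (x / ε)) (𝓝[>] 0) (𝓝 0) := by
  refine tendsto_const_nhds.congr' ?_
  by_cases hx : x = 0
  · simp [hx]
  · have hinv := tendsto_inv_nhdsGT_zero (𝕜 := ℝ)
    filter_upwards [(hinv.const_mul_atTop (abs_pos.2 hx)).eventually_ge_atTop L,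
      self_mem_nhdsWithin] with ε hε hpos
    rw [hL]
    rwa [abs_div, abs_of_pos (show 0 < ε from hpos), div_eq_mul_inv]

theorem exists_bound_unitSquare {f : ℝ → ℝ → ℝ} (hf : Continuous fun y : ℝ × ℝ => f y.1 y.2) :
    ∃ A, 0 ≤ A ∧ ∀ u ∈ Icc (0 : ℝ) 1, ∀ z ∈ Icc (0 : ℝ) 1, |f u z| ≤ A := by
  obtain ⟨A, hA⟩ := (isCompact_Icc.prod isCompact_Icc).exists_bound_of_continuousOn
    (s := Icc (0 : ℝ) 1 ×ˢ Icc (0 : ℝ) 1) hf.continuousOn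
  exact ⟨max A 0, le_max_right _ _, fun u hu z hz => (hA (u, z) ⟨hu, hz⟩).trans (le_max_left _ _)⟩

theorem exists_bound : ∃ A, 0 ≤ A ∧ ∀ u ∈ Icc (0 : ℝ) 1, ∀ z ∈ Icc (0 : ℝ) 1,
    |T.V u z| ≤ A ∧ |T.W u z| ≤ A ∧ |T.E u z| ≤ A ∧ |T.Vu u z| ≤ A ∧ |T.Wz u z| ≤ A := by
  obtain ⟨a1, p1, h1⟩ := exists_bound_unitSquare T.continuous_V
  obtain ⟨a2, p2, h2⟩ := exists_bound_unitSquare T.continuous_W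
  obtain ⟨a3, p3, h3⟩ := exists_bound_unitSquare T.continuous_E
  obtain ⟨a4, p4, h4⟩ := exists_bound_unitSquare T.continuous_Vu
  obtain ⟨a5, p5, h5⟩ := exists_bound_unitSquare T.continuous_Wz
  refine ⟨a1 + a2 + a3 + a4 + a5, by positivity, fun u hu z hz => ?_⟩
  have := h1 u hu z hz
  have := h2 u hu z hz
  have := h3 u hu z hz
  have := h4 u hu z hz
  have := h5 u hu z hz
  refine ⟨?_, ?_, ?_, ?_, ?_⟩ <;> linarith

/-- The delta integral exists if `F` is almost everywhere non-zero on the square and on its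
edges. -/
theorem isDeltaIntegral (hF : ∀ᵐ z, ∀ᵐ u, F u z ≠ 0) (hu0 : ∀ᵐ z, F 0 z ≠ 0)
    (hu1 : ∀ᵐ z, F 1 z ≠ 0) (hz0 : ∀ᵐ u, F u 0 ≠ 0) (hz1 : ∀ᵐ u, F u 1 ≠ 0) :
    IsDeltaIntegral w F (T.byParts (fun u z => if 0 < F u z then 1 else 0) 0) := by
  intro η hη hc h1
  obtain ⟨H, hH, L, hL0, hl, hr, hmul, C, hC0, hC, hCη⟩ := exists_smoothed_heaviside hη hc h1
  obtain ⟨A, hA0, hA⟩ := T.exists_bound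
  have cH : Continuous H := continuous_iff_continuousAt.2 fun t => (hH t).continuousAt
  obtain ⟨cV, cW, cE, cVu, cWz, cF⟩ := And.intro T.continuous_V (And.intro T.continuous_W
    (And.intro T.continuous_E (And.intro T.continuous_Vu (And.intro T.continuous_Wz
    T.continuous_F))))
  have m : ∀ {a b : ℝ}, |a| ≤ A → |b| ≤ C → |a * b| ≤ A * C := fun {a b} ha hb => by
    rw [abs_mul]; exact mul_le_mul ha hb (abs_nonneg _) hA0
  have i0 : (0 : ℝ) ∈ Icc (0 : ℝ) 1 := ⟨le_rfl, zero_le_one⟩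
  have i1 : (1 : ℝ) ∈ Icc (0 : ℝ) 1 := ⟨zero_le_one, le_rfl⟩
  have sl1 : ∀ {f : ℝ → ℝ → ℝ}, (Continuous fun y : ℝ × ℝ => f y.1 y.2) → ∀ z,
      Continuous fun u => f u z := fun hf z => hf.comp (by fun_prop : Continuous fun u => (u, z))
  have sl2 : ∀ {f : ℝ → ℝ → ℝ}, (Continuous fun y : ℝ × ℝ => f y.1 y.2) → ∀ u,
      Continuous fun z => f u z := fun hf u => hf.comp (by fun_prop : Continuous fun z => (u, z))
  have cH1 : ∀ ε z, Continuous fun u => H (F u z / ε) := fun ε z =>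
    cH.comp ((sl1 cF z).div_const ε)
  have cH2 : ∀ ε u, Continuous fun z => H (F u z / ε) := fun ε u =>
    cH.comp ((sl2 cF u).div_const ε)
  have c3 : ∀ ε : ℝ, Continuous fun y : ℝ × ℝ =>
      T.E y.1 y.2 * (F y.1 y.2 / ε * η (F y.1 y.2 / ε)) -
        (T.Vu y.1 y.2 + T.Wz y.1 y.2) * H (F y.1 y.2 / ε) := fun ε => by fun_prop
  have hb : ∀ ε, ∀ z ∈ Icc (0 : ℝ) 1, ∀ u ∈ Icc (0 : ℝ) 1,
      |T.E u z * (F u z / ε * η (F u z / ε)) - (T.Vu u z + T.Wz u z) * H (F u z / ε)| ≤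
        3 * (A * C) := fun ε z hz u hu => (abs_sub _ _).trans (by
      obtain ⟨-, -, a3, a4, a5⟩ := hA u hu z hz
      rw [add_mul]
      linarith [m a3 (hCη (F u z / ε)), m a4 (hC (F u z / ε)), m a5 (hC (F u z / ε)),
        abs_add_le (T.Vu u z * H (F u z / ε)) (T.Wz u z * H (F u z / ε))])
  have key : Tendsto (fun ε => T.byParts (fun u z => H (F u z / ε))
      (fun u z => F u z / ε * η (F u z / ε))) (𝓝[>] 0)
      (𝓝 (T.byParts (fun u z => if 0 < F u z then 1 else 0) 0)) := by
    refine ((tendsto_integral_unit (C := 2 * (A * C)) (fun ε _ => ?_) (fun ε _ z hz => ?_) ?_).add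
      (tendsto_integral_unit (C := 2 * (A * C)) (fun ε _ => ?_) (fun ε _ u hu => ?_) ?_)).add
      (tendsto_integral_unit (C := 3 * (A * C)) (fun ε _ => ?_) (fun ε _ z hz => ?_) ?_)
    · exact ((sl2 cV 1).mul (cH2 ε 1)).sub ((sl2 cV 0).mul (cH2 ε 0))
    · exact (abs_sub _ _).trans (by
        beta_reduce
        linarith [m (hA 1 i1 z hz).1 (hC (F 1 z / ε)),
          m (hA 0 i0 z hz).1 (hC (F 0 z / ε))])
    · filter_upwards [hu0, hu1] with z h0 h1 _
      exact ((tendsto_heaviside hl hr h1).const_mul _).sub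
        ((tendsto_heaviside hl hr h0).const_mul _)
    · exact ((sl1 cW 1).mul (cH1 ε 1)).sub ((sl1 cW 0).mul (cH1 ε 0))
    · exact (abs_sub _ _).trans (by
        beta_reduce
        linarith [m (hA u hu 1 i1).2.1 (hC (F u 1 / ε)),
          m (hA u hu 0 i0).2.1 (hC (F u 0 / ε))])
    · filter_upwards [hz0, hz1] with u h0 h1 _
      exact ((tendsto_heaviside hl hr h1).const_mul _).sub
        ((tendsto_heaviside hl hr h0).const_mul _)
    · exact intervalIntegral.continuous_parametric_intervalIntegral_of_continuous'
        (f := fun z u => T.E u z * (F u z / ε * η (F u z / ε)) -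
          (T.Vu u z + T.Wz u z) * H (F u z / ε)) ((c3 ε).comp continuous_swap) 0 1
    · exact abs_integral_unit_le (hb ε z hz)
    · filter_upwards [hF] with z hz hz01
      refine tendsto_integral_unit (C := 3 * (A * C)) (fun ε _ => ?_) (fun ε _ u hu => ?_) ?_
      · exact (c3 ε).comp (by fun_prop : Continuous fun u => (u, z))
      · exact hb ε z hz01 u hu
      · filter_upwards [hz] with u hu _
        exact ((tendsto_mul_bump hmul).const_mul _).sub ((tendsto_heaviside hl hr hu).const_mul _)
  refine key.congr' ?_
  filter_upwards [self_mem_nhdsWithin] with ε hε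
  exact (T.integral_eq_byParts hη hH hε).symm

end TransverseField

end

/-! ### Transverse fields for the resultant -/

section

section TransverseField

open scoped ContDiff

variable {X : Type*} [NormedAddCommGroup X] [NormedSpace ℝ X]

theorem contDiff_fderiv_apply {G : X × (ℝ × ℝ) → ℝ} (hG : ContDiff ℝ ∞ G) (v : X × (ℝ × ℝ)) :
    ContDiff ℝ ∞ fun y => fderiv ℝ G y v :=
  (hG.fderiv_right (m := ∞) (by simp)).clm_apply contDiff_const

theorem hasDerivAt_fst_of_contDiff {G : X × (ℝ × ℝ) → ℝ} (hG : ContDiff ℝ ∞ G) (x : X) (u z : ℝ) :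
    HasDerivAt (fun u => G (x, u, z)) (fderiv ℝ G (x, u, z) (0, 1, 0)) u :=
  ((hG.differentiable (by simp)) (x, u, z)).hasFDerivAt.comp_hasDerivAt u
    ((hasDerivAt_const u x).prodMk ((hasDerivAt_id u).prodMk (hasDerivAt_const u z)))

theorem hasDerivAt_snd_of_contDiff {G : X × (ℝ × ℝ) → ℝ} (hG : ContDiff ℝ ∞ G) (x : X) (u z : ℝ) :
    HasDerivAt (fun z => G (x, u, z)) (fderiv ℝ G (x, u, z) (0, 0, 1)) z :=
  ((hG.differentiable (by simp)) (x, u, z)).hasFDerivAt.comp_hasDerivAt z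
    ((hasDerivAt_const z x).prodMk ((hasDerivAt_const z u).prodMk (hasDerivAt_id z)))

theorem hasDerivAt_div_max {a N : ℝ → ℝ} {a' N' n t : ℝ} (hn : 0 < n) (ha : HasDerivAt a a' t)
    (hN : HasDerivAt N N' t) (h : ∀ᶠ s in 𝓝 t, n ≤ N s) :
    HasDerivAt (fun s => a s / max (N s) n)
      (a' / max (N t) n - a t * N' / max (N t) n ^ 2) t := by
  have ht : max (N t) n = N t := max_eq_left h.self_of_nhds
  have h0 : N t ≠ 0 := (hn.trans_le h.self_of_nhds).ne'
  rw [ht]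
  refine ((ha.div hN h0).congr_of_eventuallyEq ?_).congr_deriv (by field_simp)
  filter_upwards [h] with s hs
  rw [max_eq_left hs]
  rfl

/-- Transverse fields for a smooth family of functions having `0` as a regular value, with uniform
bounds. -/
theorem exists_transverseField {F w : X × (ℝ × ℝ) → ℝ} (hF : ContDiff ℝ ∞ F) (hw : ContDiff ℝ ∞ w)
    {K : Set X} (hK : IsCompact K)
    (hreg : ∀ x ∈ K, ∀ u ∈ Icc (0 : ℝ) 1, ∀ z ∈ Icc (0 : ℝ) 1, F (x, u, z) = 0 →
      HasDerivAt (fun u => F (x, u, z)) 0 u → HasDerivAt (fun z => F (x, u, z)) 0 z → False) :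
    ∃ A, 0 ≤ A ∧ ∀ x ∈ K, ∀ w' : ℝ → ℝ → ℝ,
      (∀ u ∈ Icc (0 : ℝ) 1, ∀ z ∈ Icc (0 : ℝ) 1, w' u z = w (x, u, z)) →
      ∃ T : TransverseField w' (fun u z => F (x, u, z)), ∀ u ∈ Icc (0 : ℝ) 1, ∀ z ∈ Icc (0 : ℝ) 1,
        |T.V u z| ≤ A ∧ |T.W u z| ≤ A ∧ |T.E u z| ≤ A ∧ |T.Vu u z| ≤ A ∧ |T.Wz u z| ≤ A := by
  set Fu : X × (ℝ × ℝ) → ℝ := fun y => fderiv ℝ F y (0, 1, 0)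
  set Fz : X × (ℝ × ℝ) → ℝ := fun y => fderiv ℝ F y (0, 0, 1)
  have cFu : ContDiff ℝ ∞ Fu := contDiff_fderiv_apply hF _
  have cFz : ContDiff ℝ ∞ Fz := contDiff_fderiv_apply hF _
  have dFu : ∀ x u z, HasDerivAt (fun u => F (x, u, z)) (Fu (x, u, z)) u :=
    hasDerivAt_fst_of_contDiff hF
  have dFz : ∀ x u z, HasDerivAt (fun z => F (x, u, z)) (Fz (x, u, z)) z :=
    hasDerivAt_snd_of_contDiff hF
  -- The field is `w (F_u, F_z) / N` with `E = w F / N`; regularity and compactness bound `N` below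
  -- by some `n > 0`.
  set N : X × (ℝ × ℝ) → ℝ := fun y => Fu y ^ 2 + Fz y ^ 2 + F y ^ 2
  have cN : ContDiff ℝ ∞ N := ((cFu.pow 2).add (cFz.pow 2)).add (hF.pow 2)
  have hQ : IsCompact (K ×ˢ (Icc (0 : ℝ) 1 ×ˢ Icc (0 : ℝ) 1)) :=
    hK.prod (isCompact_Icc.prod isCompact_Icc)
  obtain ⟨n, hn0, hn⟩ := hQ.exists_forall_le' (f := N) cN.continuous.continuousOn (a := 0) (by
    rintro ⟨x, u, z⟩ ⟨hx, hu, hz⟩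
    have hN0 : 0 ≤ N (x, u, z) := by positivity
    refine lt_of_le_of_ne hN0 fun h => ?_
    simp only at hx hu hz
    have e1 : Fu (x, u, z) = 0 := by
      simp only [N] at h
      nlinarith [sq_nonneg (Fu (x, u, z)), sq_nonneg (Fz (x, u, z)), sq_nonneg (F (x, u, z))]
    have e2 : Fz (x, u, z) = 0 := by
      simp only [N] at h
      nlinarith [sq_nonneg (Fu (x, u, z)), sq_nonneg (Fz (x, u, z)), sq_nonneg (F (x, u, z))]
    have e3 : F (x, u, z) = 0 := by
      simp only [N] at h
      nlinarith [sq_nonneg (Fu (x, u, z)), sq_nonneg (Fz (x, u, z)), sq_nonneg (F (x, u, z))]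
    exact hreg x hx u hu z hz e3 (e1 ▸ dFu x u z) (e2 ▸ dFz x u z))
  -- The maximum agrees with `N` over `K` and the square, and keeps the quotients continuous
  -- everywhere.
  set M : X × (ℝ × ℝ) → ℝ := fun y => max (N y) n
  have hM : ∀ y, M y ≠ 0 := fun y => (hn0.trans_le (le_max_right _ _)).ne'
  have cM : Continuous M := cN.continuous.max continuous_const
  have ca : ContDiff ℝ ∞ fun y => w y * Fu y := hw.mul cFu
  have cb : ContDiff ℝ ∞ fun y => w y * Fz y := hw.mul cFz
  set au : X × (ℝ × ℝ) → ℝ := fun y => fderiv ℝ (fun y => w y * Fu y) y (0, 1, 0)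
  set bz : X × (ℝ × ℝ) → ℝ := fun y => fderiv ℝ (fun y => w y * Fz y) y (0, 0, 1)
  set Nu : X × (ℝ × ℝ) → ℝ := fun y => fderiv ℝ N y (0, 1, 0)
  set Nz : X × (ℝ × ℝ) → ℝ := fun y => fderiv ℝ N y (0, 0, 1)
  have c1 : Continuous au := (contDiff_fderiv_apply ca _).continuous
  have c2 : Continuous bz := (contDiff_fderiv_apply cb _).continuous
  have c3 : Continuous Nu := (contDiff_fderiv_apply cN _).continuous
  have c4 : Continuous Nz := (contDiff_fderiv_apply cN _).continuous
  have kV : Continuous fun y => w y * Fu y / M y := ca.continuous.div cM hM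
  have kW : Continuous fun y => w y * Fz y / M y := cb.continuous.div cM hM
  have kE : Continuous fun y => w y * F y / M y := (hw.mul hF).continuous.div cM hM
  have kVu : Continuous fun y => au y / M y - w y * Fu y * Nu y / M y ^ 2 :=
    (c1.div cM hM).sub ((ca.continuous.mul c3).div (cM.pow 2) fun y => pow_ne_zero _ (hM y))
  have kWz : Continuous fun y => bz y / M y - w y * Fz y * Nz y / M y ^ 2 :=
    (c2.div cM hM).sub ((cb.continuous.mul c4).div (cM.pow 2) fun y => pow_ne_zero _ (hM y))
  obtain ⟨A1, hA1⟩ := hQ.exists_bound_of_continuousOn kV.continuousOn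
  obtain ⟨A2, hA2⟩ := hQ.exists_bound_of_continuousOn kW.continuousOn
  obtain ⟨A3, hA3⟩ := hQ.exists_bound_of_continuousOn kE.continuousOn
  obtain ⟨A4, hA4⟩ := hQ.exists_bound_of_continuousOn kVu.continuousOn
  obtain ⟨A5, hA5⟩ := hQ.exists_bound_of_continuousOn kWz.continuousOn
  refine ⟨max 0 (max A1 (max A2 (max A3 (max A4 A5)))), le_max_left _ _, fun x hx w' hw' => ?_⟩
  have s : ∀ {f : X × (ℝ × ℝ) → ℝ}, Continuous f → Continuous fun y : ℝ × ℝ => f (x, y.1, y.2) :=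
    fun hf => hf.comp (by fun_prop)
  refine ⟨{
    V := fun u z => w (x, u, z) * Fu (x, u, z) / M (x, u, z)
    W := fun u z => w (x, u, z) * Fz (x, u, z) / M (x, u, z)
    E := fun u z => w (x, u, z) * F (x, u, z) / M (x, u, z)
    Vu := fun u z => au (x, u, z) / M (x, u, z) -
      w (x, u, z) * Fu (x, u, z) * Nu (x, u, z) / M (x, u, z) ^ 2
    Wz := fun u z => bz (x, u, z) / M (x, u, z) -
      w (x, u, z) * Fz (x, u, z) * Nz (x, u, z) / M (x, u, z) ^ 2
    Fu := fun u z => Fu (x, u, z)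
    Fz := fun u z => Fz (x, u, z)
    continuous_V := s kV
    continuous_W := s kW
    continuous_E := s kE
    continuous_Vu := s kVu
    continuous_Wz := s kWz
    continuous_F := s hF.continuous
    continuous_Fu := s cFu.continuous
    continuous_Fz := s cFz.continuous
    hasDerivAt_F_left := dFu x
    hasDerivAt_F_right := dFz x
    hasDerivAt_V := fun u hu z hz => hasDerivAt_div_max hn0 (hasDerivAt_fst_of_contDiff ca x u z)
      (hasDerivAt_fst_of_contDiff cN x u z) (by
        filter_upwards [Ioo_mem_nhds hu.1 hu.2] with v hv
        exact hn (x, v, z) ⟨hx, Ioo_subset_Icc_self hv, hz⟩)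
    hasDerivAt_W := fun u hu z hz => hasDerivAt_div_max hn0 (hasDerivAt_snd_of_contDiff cb x u z)
      (hasDerivAt_snd_of_contDiff cN x u z) (by
        filter_upwards [Ioo_mem_nhds hz.1 hz.2] with v hv
        exact hn (x, u, v) ⟨hx, hu, Ioo_subset_Icc_self hv⟩)
    eq_w := fun u hu z hz => by
      have e : M (x, u, z) = Fu (x, u, z) ^ 2 + Fz (x, u, z) ^ 2 + F (x, u, z) ^ 2 :=
        max_eq_left (hn (x, u, z) ⟨hx, hu, hz⟩)
      rw [hw' u hu z hz, div_mul_eq_mul_div, div_mul_eq_mul_div, div_mul_eq_mul_div, ← add_div,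
        ← add_div, div_eq_iff (hM _), e]
      ring }, fun u hu z hz => ?_⟩
  have hy : (x, u, z) ∈ K ×ˢ (Icc (0 : ℝ) 1 ×ˢ Icc (0 : ℝ) 1) := ⟨hx, hu, hz⟩
  exact ⟨(hA1 _ hy).trans (by simp), (hA2 _ hy).trans (by simp), (hA3 _ hy).trans (by simp),
    (hA4 _ hy).trans (by simp), (hA5 _ hy).trans (by simp)⟩

end TransverseField

theorem finite_resPQ_left (α β : Fin 3 → ℝ) (x : ℝ × ℝ) (z : ℝ) (h : resPQ α β x.1 x.2 0 z ≠ 0) :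
    {u | resPQ α β x.1 x.2 u z = 0}.Finite := by
  obtain ⟨f, hf⟩ : ∃ f : ℝ[X], ∀ u, f.eval u = resPQ α β x.1 x.2 u z := by
    let L : ℝ → ℝ → ℝ[X] := fun a b => C a + C b * X
    have hL : ∀ a b u, (L a b).eval u = a + b * u := fun a b u => by simp [L]
    refine ⟨(L (aP α β 0 z) (aPu α β z) * L (eQ α β x.2 0 z) (eQu α β z) -
      L (aQ α β 0 z) (aQu α β z) * L (eP α β x.1 0 z) (ePu α β z)) ^ 2 -
      L 0 1 * L 1 (-1) * C z * (1 - C z) * (L (aP α β 0 z) (aPu α β z) * C (bQ α β) -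
        L (aQ α β 0 z) (aQu α β z) * C (bP α β)) *
      (C (bP α β) * L (eQ α β x.2 0 z) (eQu α β z) - C (bQ α β) * L (eP α β x.1 0 z) (ePu α β z)),
      fun u => ?_⟩
    simp only [eval_sub, eval_pow, eval_mul, eval_C, eval_one, hL]
    rw [resPQ, aP_affine α β u, aQ_affine α β u, eP_affine α β _ u, eQ_affine α β _ u]
    ring
  have hf0 : f ≠ 0 := by
    rintro rfl
    exact h (by rw [← hf 0, eval_zero])
  refine (f.roots.toFinset.finite_toSet).subset fun u hu => ?_
  simp only [Finset.mem_coe, Multiset.mem_toFinset, mem_roots hf0, IsRoot, hf]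
  exact hu

section

variable {α β : Fin 3 → ℝ} {x : ℝ × ℝ}

theorem ae_resPQ_edge_ne_zero {u : ℝ} (hu : u * (1 - u) = 0) (h : elimSq α β x u 0 ≠ 0) :
    ∀ᵐ z, resPQ α β x.1 x.2 u z ≠ 0 := by
  filter_upwards [(elimSq_finite h).measure_zero volume |> compl_mem_ae_iff.2] with z hz
  rw [resPQ_eq_elimSq (by rw [hu]; ring)]
  exact pow_ne_zero _ hz

theorem contDiff_resPQ (α β : Fin 3 → ℝ) {n : WithTop ℕ∞} :
    ContDiff ℝ n fun y : (ℝ × ℝ) × (ℝ × ℝ) => resPQ α β y.1.1 y.1.2 y.2.1 y.2.2 := by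
  unfold resPQ aP aQ eP eQ
  fun_prop

theorem contDiff_Btilde (α β : Fin 3 → ℝ) {n : WithTop ℕ∞} :
    ContDiff ℝ n fun y : (ℝ × ℝ) × (ℝ × ℝ) => Btilde α β y.2.1 y.2.2 := by
  unfold Btilde
  fun_prop

variable (hα : α 2 < α 1 ∧ α 1 < α 0) (hβ : β 2 < β 1 ∧ β 1 < β 0)
  (hα0 : α 0 + α 1 + α 2 = 0) (hβ0 : β 0 + β 1 + β 2 = 0)

include hα hβ hα0 hβ0

theorem exists_transverseField_resPQ {K : Set (ℝ × ℝ)} (hK : IsCompact K)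
    (hKG : K ⊆ genericSet α β) :
    ∃ A, 0 ≤ A ∧ ∀ x ∈ K,
      ∃ T : TransverseField (fun u z => |Btilde α β u z|) (resPQ α β x.1 x.2),
        ∀ u ∈ Icc (0 : ℝ) 1, ∀ z ∈ Icc (0 : ℝ) 1,
        |T.V u z| ≤ A ∧ |T.W u z| ≤ A ∧ |T.E u z| ≤ A ∧ |T.Vu u z| ≤ A ∧ |T.Wz u z| ≤ A := by
  obtain ⟨A, hA0, hA⟩ := exists_transverseField (contDiff_resPQ α β) (contDiff_Btilde α β) hK
    fun x hx u hu z hz h0 h1 h2 => resPQ_regular hα hβ hα0 hβ0 (hKG hx) hu hz h0 h1 h2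
  exact ⟨A, hA0, fun x hx => hA x hx _ fun u hu z hz =>
    abs_of_pos (Btilde_pos hα hβ hα0 hβ0 hu.1 hz.1)⟩

theorem exists_isDeltaIntegral (hx : x ∈ genericSet α β) :
    ∃ I, IsDeltaIntegral (fun u z => |Btilde α β u z|) (resPQ α β x.1 x.2) I := by
  obtain ⟨A, -, hA⟩ := exists_transverseField_resPQ hα hβ hα0 hβ0 (isCompact_singleton (x := x))
    (singleton_subset_iff.2 hx)
  obtain ⟨T, -⟩ := hA x rfl
  obtain ⟨h00, h01, h10, h11⟩ := hx.2.1
  have hu0 := ae_resPQ_edge_ne_zero (u := 0) (by simp) h00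
  refine ⟨_, T.isDeltaIntegral ?_ hu0 (ae_resPQ_edge_ne_zero (by simp) h10) ?_ ?_⟩
  · filter_upwards [hu0] with z hz
    exact (finite_resPQ_left α β x z hz).measure_zero volume |> compl_mem_ae_iff.2
  · simp_rw [fun u => resPQ_comm α β x.1 x.2 u 0]
    exact ae_resPQ_edge_ne_zero (by simp) (by rwa [← elimSq_comm])
  · simp_rw [fun u => resPQ_comm α β x.1 x.2 u 1]
    exact ae_resPQ_edge_ne_zero (by simp) (by rwa [← elimSq_comm])

end

/-- The smoothed delta integral. -/
def smoothedDelta (α β : Fin 3 → ℝ) (η : ℝ → ℝ) (ε : ℝ) (x : ℝ × ℝ) : ℝ :=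
  ∫ z in (0 : ℝ)..1, ∫ u in (0 : ℝ)..1,
    |Btilde α β u z| * (ε⁻¹ * η (resPQ α β x.1 x.2 u z / ε))

section

variable {α β : Fin 3 → ℝ} {η : ℝ → ℝ}

theorem continuous_integral_unitSquare {X : Type*} [TopologicalSpace X] [FirstCountableTopology X]
    {f : X → ℝ → ℝ → ℝ} (hf : Continuous fun y : (X × ℝ) × ℝ => f y.1.1 y.2 y.1.2) :
    Continuous fun x => ∫ z in (0 : ℝ)..1, ∫ u in (0 : ℝ)..1, f x u z :=
  intervalIntegral.continuous_parametric_intervalIntegral_of_continuous'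
    (f := fun x z => ∫ u in (0 : ℝ)..1, f x u z)
    (intervalIntegral.continuous_parametric_intervalIntegral_of_continuous'
      (f := fun (y : X × ℝ) u => f y.1 u y.2) hf 0 1) 0 1

theorem continuous_smoothedDelta (hη : Continuous η) (ε : ℝ) :
    Continuous (smoothedDelta α β η ε) := by
  have h1 : Continuous fun y : ((ℝ × ℝ) × ℝ) × ℝ => resPQ α β y.1.1.1 y.1.1.2 y.2 y.1.2 := by
    unfold resPQ aP aQ eP eQ
    fun_prop
  have h2 : Continuous fun y : ((ℝ × ℝ) × ℝ) × ℝ => Btilde α β y.2 y.1.2 := by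
    unfold Btilde
    fun_prop
  have h3 : Continuous fun y : ((ℝ × ℝ) × ℝ) × ℝ =>
      |Btilde α β y.2 y.1.2| * (ε⁻¹ * η (resPQ α β y.1.1.1 y.1.1.2 y.2 y.1.2 / ε)) := by
    fun_prop
  exact continuous_integral_unitSquare (f := fun (x : ℝ × ℝ) u z =>
    |Btilde α β u z| * (ε⁻¹ * η (resPQ α β x.1 x.2 u z / ε))) h3

theorem exists_bound_smoothedDelta (hα : α 2 < α 1 ∧ α 1 < α 0) (hβ : β 2 < β 1 ∧ β 1 < β 0)
    (hα0 : α 0 + α 1 + α 2 = 0) (hβ0 : β 0 + β 1 + β 2 = 0) (hη : Continuous η)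
    (hc : HasCompactSupport η) (h1 : ∫ t, η t = 1) {K : Set (ℝ × ℝ)} (hK : IsCompact K)
    (hKG : K ⊆ genericSet α β) :
    ∃ D, ∀ x ∈ K, ∀ ε > 0, |smoothedDelta α β η ε x| ≤ D := by
  obtain ⟨H, hH, L, -, -, -, -, D, -, hD, hDη⟩ := exists_smoothed_heaviside hη hc h1
  obtain ⟨A, hA0, hA⟩ := exists_transverseField_resPQ hα hβ hα0 hβ0 hK hKG
  refine ⟨7 * A * D, fun x hx ε hε => ?_⟩
  obtain ⟨T, hT⟩ := hA x hx
  rw [smoothedDelta, T.integral_eq_byParts hη hH hε]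
  exact T.abs_byParts_le hA0 hT (fun _ _ => hD _) fun _ _ => hDη _

end

end

/-! ### The pencil of the two quadratics -/

section

open scoped ENNReal

/-- Change of variables along the pencil of two quadratics. -/
theorem integral_comp_quadratics {a b e a' b' e' κ : ℝ} (ha : a ≠ 0) (hκ : 0 < κ)
    (hD : 0 < a' * b - a * b') (f : ℝ × ℝ → ℝ) :
    ∫ x, f x = ∫ y : ℝ × ℝ, κ * (a' * b - a * b') *
      f (a * y.1 ^ 2 + b * y.1 + e - κ * y.2 * a, a' * y.1 ^ 2 + b' * y.1 + e' - κ * y.2 * a') := by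
  set Ψ : ℝ × ℝ → ℝ × ℝ := fun y =>
    (a * y.1 ^ 2 + b * y.1 + e - κ * y.2 * a, a' * y.1 ^ 2 + b' * y.1 + e' - κ * y.2 * a') with hΨ
  have hd : Differentiable ℝ Ψ := by
    rw [hΨ]; fun_prop
  -- `a' x₁ - a x₂` contains neither the second parameter nor the square, so it determines the first
  -- parameter; then `x₁` determines the second.
  have hinj : Function.Injective Ψ := by
    rintro ⟨c, t⟩ ⟨c2, t2⟩ h
    obtain ⟨h1, h2⟩ := Prod.ext_iff.1 h
    simp only [hΨ] at h1 h2
    have hc : c = c2 := mul_left_cancel₀ hD.ne' (by linear_combination a' * h1 - a * h2)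
    subst hc
    have ht : t = t2 := mul_left_cancel₀ (mul_ne_zero hκ.ne' ha) (by linear_combination -h1)
    rw [ht]
  have hsurj : Function.Surjective Ψ := by
    rintro ⟨x1, x2⟩
    obtain ⟨c, hc⟩ : ∃ c, (a' * b - a * b') * c = a' * x1 - a * x2 - (a' * e - a * e') :=
      ⟨(a' * x1 - a * x2 - (a' * e - a * e')) / (a' * b - a * b'), by field_simp⟩
    obtain ⟨t, ht⟩ : ∃ t, κ * t * a = a * c ^ 2 + b * c + e - x1 :=
      ⟨(a * c ^ 2 + b * c + e - x1) / (κ * a), by field_simp⟩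
    refine ⟨(c, t), Prod.ext ?_ ?_⟩
    · simp only [hΨ]
      linarith
    · simp only [hΨ]
      exact mul_left_cancel₀ ha (by linear_combination -hc - a' * ht)
  have hdet : ∀ y, |(fderiv ℝ Ψ y).det| = κ * (a' * b - a * b') := by
    intro y
    have h : HasFDerivAt Ψ (fderiv ℝ Ψ y) y := (hd y).hasFDerivAt
    have hA := h.comp_hasDerivAt_of_eq y.1
      ((hasDerivAt_id y.1).prodMk (hasDerivAt_const y.1 y.2)) rfl
    have hB := h.comp_hasDerivAt_of_eq y.2
      ((hasDerivAt_const y.2 y.1).prodMk (hasDerivAt_id y.2)) rfl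
    have hA' : HasDerivAt (fun t => Ψ (t, y.2)) (2 * a * y.1 + b, 2 * a' * y.1 + b') y.1 :=
      HasDerivAt.prodMk ((hasDerivAt_quadratic a b e y.1).sub_const (κ * y.2 * a))
        ((hasDerivAt_quadratic a' b' e' y.1).sub_const (κ * y.2 * a'))
    have hB' : HasDerivAt (fun t => Ψ (y.1, t)) (-(κ * a), -(κ * a')) y.2 := by
      refine HasDerivAt.prodMk ?_ ?_
      · exact ((((hasDerivAt_id y.2).const_mul κ).mul_const a).const_sub
          (a * y.1 ^ 2 + b * y.1 + e)).congr_deriv (by simp)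
      · exact ((((hasDerivAt_id y.2).const_mul κ).mul_const a').const_sub
          (a' * y.1 ^ 2 + b' * y.1 + e')).congr_deriv (by simp)
    rw [det_prod, hA.unique hA', hB.unique hB', ← abs_of_pos (mul_pos hκ hD), ← abs_neg]
    congr 1
    simp only
    ring
  have h := integral_image_eq_integral_abs_det_fderiv_smul volume MeasurableSet.univ
    (fun y _ => (hd y).hasFDerivAt.hasFDerivWithinAt) hinj.injOn f
  rw [image_univ, hsurj.range_eq, Measure.restrict_univ] at h
  rw [h]
  simp_rw [hdet]
  rfl

/-- The bound is independent of `r` because `√(r + M) - √(r - M) ≤ √(2 M)`, also when the root of a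
negative number is `0`. -/
theorem volume_abs_sq_sub_le {r M : ℝ} (hM : 0 ≤ M) :
    volume {c : ℝ | |c ^ 2 - r| ≤ M} ≤ ENNReal.ofReal (2 * Real.sqrt (2 * M)) := by
  have hsub : {c : ℝ | |c ^ 2 - r| ≤ M} ⊆
      Icc (Real.sqrt (r - M)) (Real.sqrt (r + M)) ∪ Icc (-Real.sqrt (r + M)) (-Real.sqrt (r - M)) := by
    intro c hc
    rw [mem_ofPred_eq, abs_le] at hc
    have h1 : Real.sqrt (r - M) ≤ |c| := Real.sqrt_le_iff.2 ⟨abs_nonneg _, by rw [sq_abs]; linarith⟩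
    have h2 : |c| ≤ Real.sqrt (r + M) := Real.le_sqrt_of_sq_le (by rw [sq_abs]; linarith)
    rcases abs_cases c with ⟨h, -⟩ | ⟨h, -⟩
    · exact Or.inl ⟨h ▸ h1, h ▸ h2⟩
    · exact Or.inr ⟨by linarith, by linarith⟩
  have hlen : Real.sqrt (r + M) - Real.sqrt (r - M) ≤ Real.sqrt (2 * M) := by
    rw [sub_le_iff_le_add, Real.sqrt_le_iff]
    refine ⟨by positivity, ?_⟩
    have h1 := Real.sq_sqrt (by positivity : 0 ≤ 2 * M)
    have h2 : r - M ≤ Real.sqrt (r - M) ^ 2 := by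
      rcases le_total 0 (r - M) with h | h
      · rw [Real.sq_sqrt h]
      · exact h.trans (sq_nonneg _)
    nlinarith [mul_nonneg (Real.sqrt_nonneg (2 * M)) (Real.sqrt_nonneg (r - M))]
  refine (measure_mono hsub).trans ((measure_union_le _ _).trans ?_)
  rw [Real.volume_Icc, Real.volume_Icc, two_mul, ENNReal.ofReal_add (by positivity) (by positivity)]
  exact add_le_add (ENNReal.ofReal_le_ofReal hlen) (ENNReal.ofReal_le_ofReal (by linarith))

section

variable {α β : Fin 3 → ℝ}

theorem lowSum_pencil (α β : Fin 3 → ℝ) (u z : ℝ) :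
    aP α β u z * lowSum α β + aQ α β u z = kfun α β u z := by
  simp only [lowSum, kfun, aP, aQ]; ring

/-- A point of the pencil spanned by the two quadratics. -/
def pencil (α β : Fin 3 → ℝ) (u z s κ : ℝ) (y : ℝ × ℝ) : ℝ × ℝ :=
  (polyP α β u z s y.1 - κ * y.2 * aP α β u z, polyQ α β u z s y.1 - κ * y.2 * aQ α β u z)

/-- In `resPQ_eq` at `c = y.1` the defects of the two values are proportional to the leading
coefficients, so the square drops out and `R` becomes linear in the second parameter. -/
theorem resPQ_pencil {u z s : ℝ} (hs : s ^ 2 = u * (1 - u) * z * (1 - z)) (κ : ℝ) (y : ℝ × ℝ) :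
    resPQ α β (pencil α β u z s κ y).1 (pencil α β u z s κ y).2 u z =
      κ * (s * Btilde α β u z) ^ 2 * y.2 := by
  rw [resPQ_eq α β _ _ u z s y.1 hs, pencil, Btilde_eq]
  ring

theorem lowSum_pencil_eval (u z s κ : ℝ) (y : ℝ × ℝ) :
    lowSum α β ^ 3 + (pencil α β u z s κ y).1 * lowSum α β + (pencil α β u z s κ y).2 =
      kfun α β u z * (y.1 ^ 2 - (1 + κ * y.2)) := by
  rw [pencil]
  linear_combination lowSum_eval α β u z s y.1 - κ * y.2 * lowSum_pencil α β u z

variable (hα : α 2 < α 1 ∧ α 1 < α 0) (hβ : β 2 < β 1 ∧ β 1 < β 0)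
  (hα0 : α 0 + α 1 + α 2 = 0) (hβ0 : β 0 + β 1 + β 2 = 0)

include hα hβ hα0 hβ0

theorem kfun_zero_le {u z : ℝ} (hu : 0 ≤ u) (hz : 0 ≤ z) : kfun α β 0 0 ≤ kfun α β u z := by
  obtain ⟨h1, h2⟩ := hα
  obtain ⟨h3, h4⟩ := hβ
  have a1 : 0 < 2 * α 0 + α 1 := by linarith
  have a2 : 0 < α 0 + 2 * α 1 := by linarith
  have a3 : 0 < 2 * β 0 + β 1 := by linarith
  have a4 : 0 < β 0 + 2 * β 1 := by linarith
  have a5 := sub_pos.2 h2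
  have a6 := sub_pos.2 h4
  have e1 : 0 ≤ (2 * α 0 + α 1) * (α 0 + 2 * α 1) * ((β 0 - β 1) * z) := by positivity
  have e2 : 0 ≤ (2 * β 0 + β 1) * (β 0 + 2 * β 1) * ((α 0 - α 1) * u) := by positivity
  unfold kfun
  linarith

/-- The value `κ = ε / (s * Btilde) ^ 2` makes `R / ε` equal to the second parameter; the constant
Jacobian `κ * s * Btilde` then cancels the weight and `ε⁻¹`. -/
theorem integral_delta_pencil {u z s ε : ℝ} (hu : 0 ≤ u) (hz : 0 ≤ z) (hs0 : 0 < s)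
    (hs : s ^ 2 = u * (1 - u) * z * (1 - z)) (hε : 0 < ε) (g : ℝ × ℝ → ℝ) (η : ℝ → ℝ) :
    ∫ x : ℝ × ℝ, g x * (s * Btilde α β u z * (ε⁻¹ * η (resPQ α β x.1 x.2 u z / ε))) =
      ∫ y : ℝ × ℝ, g (pencil α β u z s (ε / (s * Btilde α β u z) ^ 2) y) * η y.2 := by
  have hB := Btilde_pos hα hβ hα0 hβ0 hu hz
  have hD : aQ α β u z * (s * bP α β) - aP α β u z * (s * bQ α β) = s * Btilde α β u z := by
    rw [Btilde_eq]; ring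
  have hsB := mul_pos hs0 hB
  rw [integral_comp_quadratics (a := aP α β u z) (b := s * bP α β) (e := eP α β 0 u z)
    (a' := aQ α β u z) (b' := s * bQ α β) (e' := eQ α β 0 u z) (κ := ε / (s * Btilde α β u z) ^ 2)
    (aP_neg hα hβ hα0 hβ0 hu hz).ne (by positivity) (by rw [hD]; exact hsB), hD]
  refine integral_congr_ae (ae_of_all _ fun y => ?_)
  have h := resPQ_pencil (α := α) (β := β) hs (ε / (s * Btilde α β u z) ^ 2) y
  change ε / (s * Btilde α β u z) ^ 2 * (s * Btilde α β u z) *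
    (g (pencil α β u z s (ε / (s * Btilde α β u z) ^ 2) y) * (s * Btilde α β u z *
      (ε⁻¹ * η (resPQ α β (pencil α β u z s (ε / (s * Btilde α β u z) ^ 2) y).1
        (pencil α β u z s (ε / (s * Btilde α β u z) ^ 2) y).2 u z / ε)))) = _
  rw [h]
  have e : ε / (s * Btilde α β u z) ^ 2 * (s * Btilde α β u z) ^ 2 * y.2 / ε = y.2 := by
    field_simp
  rw [e]
  field_simp

/-- The values of a compactly supported function on the pencil have controlled support. -/
theorem abs_sq_sub_le_of_pencil {g : ℝ × ℝ → ℝ} {M : ℝ}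
    (hM : ∀ x, g x ≠ 0 → |lowSum α β ^ 3 + x.1 * lowSum α β + x.2| ≤ M) {u z s κ : ℝ} (hu : 0 ≤ u)
    (hz : 0 ≤ z) {y : ℝ × ℝ} (hy : g (pencil α β u z s κ y) ≠ 0) :
    |y.1 ^ 2 - (1 + κ * y.2)| ≤ M / kfun α β 0 0 := by
  have h := hM _ hy
  rw [lowSum_pencil_eval, abs_mul, abs_of_pos (kfun_pos hα hβ hα0 hβ0 hu hz)] at h
  rw [le_div_iff₀ (kfun_pos hα hβ hα0 hβ0 le_rfl le_rfl), mul_comm]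
  exact (mul_le_mul_of_nonneg_right (kfun_zero_le hα hβ hα0 hβ0 hu hz) (abs_nonneg _)).trans h

/-- The bound must not depend on `κ`, which is unbounded as `s → 0`. On the support of `g`, `c ^ 2`
lies within `M / kfun α β 0 0` of `1 + κ t`, and the measure of such `c` is bounded whatever the
centre. -/
theorem abs_integral_pencil_le {g : ℝ × ℝ → ℝ} {η : ℝ → ℝ} (hη : Continuous η)
    (hc : HasCompactSupport η) {M G : ℝ} (hM0 : 0 ≤ M)
    (hM : ∀ x, g x ≠ 0 → |lowSum α β ^ 3 + x.1 * lowSum α β + x.2| ≤ M) (hg : Continuous g)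
    (hG : ∀ x, |g x| ≤ G) {u z s κ : ℝ} (hu : 0 ≤ u) (hz : 0 ≤ z) :
    |∫ y : ℝ × ℝ, g (pencil α β u z s κ y) * η y.2| ≤
      (∫ t, |η t|) * (G * (2 * Real.sqrt (2 * (M / kfun α β 0 0)))) := by
  have hG0 : 0 ≤ G := (abs_nonneg _).trans (hG 0)
  have hk := kfun_pos hα hβ hα0 hβ0 le_rfl le_rfl
  have hcp : Continuous (pencil α β u z s κ) := by
    unfold pencil polyP polyQ
    fun_prop
  have hηi : Integrable fun t => |η t| := (hη.integrable_of_hasCompactSupport hc).abs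
  have hI0 : 0 ≤ ∫ t, |η t| := integral_nonneg fun _ => abs_nonneg _
  have h1 : ‖∫ y : ℝ × ℝ, g (pencil α β u z s κ y) * η y.2‖ₑ ≤
      ENNReal.ofReal ((∫ t, |η t|) * (G * (2 * Real.sqrt (2 * (M / kfun α β 0 0))))) := by
    refine (enorm_integral_le_lintegral_enorm _).trans ?_
    rw [Measure.volume_eq_prod, lintegral_prod_symm _ (by
      have : Continuous fun y : ℝ × ℝ => g (pencil α β u z s κ y) * η y.2 := by fun_prop
      exact this.enorm.measurable.aemeasurable)]
    calc ∫⁻ t, ∫⁻ c, ‖g (pencil α β u z s κ (c, t)) * η t‖ₑ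
        ≤ ∫⁻ t, ENNReal.ofReal |η t| * ENNReal.ofReal (G * (2 * Real.sqrt (2 * (M / kfun α β 0 0)))) := by
          refine lintegral_mono fun t => ?_
          calc ∫⁻ c, ‖g (pencil α β u z s κ (c, t)) * η t‖ₑ
              ≤ ∫⁻ c, {c : ℝ | |c ^ 2 - (1 + κ * t)| ≤ M / kfun α β 0 0}.indicator
                  (fun _ => ENNReal.ofReal |η t| * ENNReal.ofReal G) c := by
                refine lintegral_mono fun c => ?_
                by_cases h : g (pencil α β u z s κ (c, t)) = 0
                · simp [h]
                · rw [indicator_of_mem (by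
                    exact abs_sq_sub_le_of_pencil hα hβ hα0 hβ0 hM hu hz h), enorm_mul, mul_comm,
                    Real.enorm_eq_ofReal_abs, Real.enorm_eq_ofReal_abs]
                  gcongr
                  exact hG _
            _ ≤ _ := by
                rw [lintegral_indicator_const (measurableSet_le (by fun_prop) (by fun_prop)),
                  ENNReal.ofReal_mul hG0, mul_assoc]
                gcongr
                exact volume_abs_sq_sub_le (by positivity)
      _ = _ := by
          rw [lintegral_mul_const _ (by fun_prop), ENNReal.ofReal_mul hI0,
            ofReal_integral_eq_lintegral_ofReal hηi (ae_of_all _ fun _ => abs_nonneg _)]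
  rw [Real.enorm_eq_ofReal_abs] at h1
  exact (ENNReal.ofReal_le_ofReal_iff (by positivity)).1 h1

theorem tendsto_integral_pencil {g : ℝ × ℝ → ℝ} {η : ℝ → ℝ} (hη : Continuous η)
    (hc : HasCompactSupport η) (h1 : ∫ t, η t = 1) {M G : ℝ}
    (hM : ∀ x, g x ≠ 0 → |lowSum α β ^ 3 + x.1 * lowSum α β + x.2| ≤ M) (hg : Continuous g)
    (hG : ∀ x, |g x| ≤ G) {u z s d : ℝ} (hu : 0 ≤ u) (hz : 0 ≤ z) (hd : 0 ≤ d) :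
    Tendsto (fun ε => ∫ y : ℝ × ℝ, g (pencil α β u z s (ε / d) y) * η y.2) (𝓝[>] 0)
      (𝓝 (∫ c, g (polyP α β u z s c, polyQ α β u z s c))) := by
  have hG0 : 0 ≤ G := (abs_nonneg _).trans (hG 0)
  obtain ⟨L, hL⟩ : ∃ L, ∀ t, η t ≠ 0 → |t| ≤ L := by
    obtain ⟨r, hr⟩ := hc.isCompact.isBounded.subset_closedBall 0
    refine ⟨r, fun t ht => ?_⟩
    simpa using hr (subset_tsupport _ (Function.mem_support.2 ht))
  obtain ⟨E, hE⟩ := hη.bounded_above_of_compact_support hc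
  have hE0 : 0 ≤ E := (norm_nonneg _).trans (hE 0)
  have e0 : ∫ c, g (polyP α β u z s c, polyQ α β u z s c) =
      ∫ y : ℝ × ℝ, g (pencil α β u z s 0 y) * η y.2 := by
    have := integral_prod_mul (μ := volume) (ν := volume)
      (fun c => g (polyP α β u z s c, polyQ α β u z s c)) η
    rw [h1, mul_one] at this
    rw [← this, Measure.volume_eq_prod]
    refine integral_congr_ae (ae_of_all _ fun y => ?_)
    simp [pencil]
  rw [e0]
  -- For `ε ≤ 1` the integrand lives where `|y.2| ≤ L` and `y.1 ^ 2 ≤ b`, hence in a fixed box.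
  set b := 1 + L / d + M / kfun α β 0 0
  have hcp : Continuous fun y : ℝ × (ℝ × ℝ) => pencil α β u z s y.1 y.2 := by
    unfold pencil polyP polyQ
    fun_prop
  refine tendsto_integral_filter_of_dominated_convergence
    ((Icc (-(b + 1)) (b + 1) ×ˢ Icc (-L) L).indicator fun _ => G * E) ?_ ?_ ?_ ?_
  · refine Eventually.of_forall fun ε => Continuous.aestronglyMeasurable ?_
    exact (hg.comp (hcp.comp (by fun_prop : Continuous fun y : ℝ × ℝ => (ε / d, y)))).mul
      (hη.comp continuous_snd)
  · filter_upwards [Ioc_mem_nhdsGT (zero_lt_one' ℝ)] with ε hε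
    refine ae_of_all _ fun y => ?_
    by_cases h : g (pencil α β u z s (ε / d) y) * η y.2 = 0
    · rw [h, norm_zero]
      exact indicator_nonneg (fun _ _ => by positivity) _
    · obtain ⟨hgy, hηy⟩ := mul_ne_zero_iff.1 h
      have k1 := abs_sq_sub_le_of_pencil hα hβ hα0 hβ0 hM hu hz hgy
      have k2 := hL _ hηy
      have k3 : ε / d * y.2 ≤ L / d := by
        rw [div_mul_eq_mul_div]
        gcongr
        nlinarith [hε.1, hε.2, abs_le.1 k2, abs_nonneg y.2, le_abs_self y.2]
      have k4 : y.1 ^ 2 ≤ b := by linarith [(abs_le.1 k1).2]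
      have k5 : |y.1| ≤ b + 1 := abs_le_of_sq_le_sq (by nlinarith [sq_nonneg y.1])
        (by nlinarith [sq_nonneg y.1])
      rw [indicator_of_mem (show y ∈ Icc (-(b + 1)) (b + 1) ×ˢ Icc (-L) L from ⟨abs_le.1 k5, abs_le.1 k2⟩), norm_mul]
      exact mul_le_mul (hG _) (hE _) (norm_nonneg _) hG0
  · refine (integrable_indicator_iff (measurableSet_Icc.prod measurableSet_Icc)).2 ?_
    exact integrableOn_const (isCompact_Icc.prod isCompact_Icc).measure_lt_top.ne
  · refine ae_of_all _ fun y => ?_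
    have : Continuous fun ε : ℝ => g (pencil α β u z s (ε / d) y) * η y.2 :=
      (hg.comp (hcp.comp (by fun_prop : Continuous fun ε : ℝ => (ε / d, y)))).mul continuous_const
    have h := (this.tendsto 0).mono_left (nhdsWithin_le_nhds (s := Ioi 0))
    rwa [zero_div] at h

end

end

/-! ### Identification of the delta integral with the density -/

section

theorem integral_comp_cos_sq (f : ℝ → ℝ) :
    ∫ t in (0 : ℝ)..1, f t =
      ∫ φ in Ioo 0 (Real.pi / 2), 2 * Real.cos φ * Real.sin φ * f (Real.cos φ ^ 2) := by
  rw [intervalIntegral.integral_of_le zero_le_one, integral_Ioc_eq_integral_Ioo, ← image_cos_sq,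
    integral_image_eq_integral_abs_deriv_smul measurableSet_Ioo
      (fun x _ => (hasDerivAt_cos_sq x).hasDerivWithinAt) injOn_cos_sq]
  refine setIntegral_congr_fun measurableSet_Ioo fun φ hφ => ?_
  have hc : 0 < Real.cos φ := Real.cos_pos_of_mem_Ioo ⟨by linarith [hφ.1, Real.pi_pos], hφ.2⟩
  have hs : 0 < Real.sin φ := Real.sin_pos_of_mem_Ioo ⟨hφ.1, by linarith [hφ.2, Real.pi_pos]⟩
  simp only [smul_eq_mul]
  rw [abs_neg, abs_of_pos (by positivity)]

/-- Lebesgue measure on the first quadrant of the circle. -/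
def quadrant : Measure ℝ := volume.restrict (Ioo 0 (Real.pi / 2))

instance : IsFiniteMeasure quadrant := by
  unfold quadrant
  exact isFiniteMeasure_restrict.2 (by simp)

theorem quadrant_prod : quadrant.prod quadrant =
    volume.restrict (Ioo 0 (Real.pi / 2) ×ˢ Ioo 0 (Real.pi / 2)) := by
  rw [quadrant, Measure.prod_restrict, Measure.volume_eq_prod]

theorem ae_quadrant_prod : ∀ᵐ y ∂(quadrant.prod quadrant),
    y.1 ∈ Ioo 0 (Real.pi / 2) ∧ y.2 ∈ Ioo 0 (Real.pi / 2) := by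
  rw [quadrant_prod]
  filter_upwards [ae_restrict_mem (measurableSet_Ioo.prod measurableSet_Ioo)] with y hy
  exact hy

/-- The integrand of the smoothed delta integral in the Euler angles `y = (ψ, φ)`. -/
def eulerDelta (α β : Fin 3 → ℝ) (η : ℝ → ℝ) (ε : ℝ) (x y : ℝ × ℝ) : ℝ :=
  trigFactor y.2 y.1 * Btilde α β (Real.cos y.2 ^ 2) (Real.cos y.1 ^ 2) *
    (ε⁻¹ * η (resPQ α β x.1 x.2 (Real.cos y.2 ^ 2) (Real.cos y.1 ^ 2) / ε))

theorem continuous_eulerDelta (α β : Fin 3 → ℝ) {η : ℝ → ℝ} (hη : Continuous η) (ε : ℝ) :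
    Continuous (Function.uncurry (eulerDelta α β η ε)) := by
  have h1 : Continuous fun p : (ℝ × ℝ) × (ℝ × ℝ) =>
      resPQ α β p.1.1 p.1.2 (Real.cos p.2.2 ^ 2) (Real.cos p.2.1 ^ 2) := by
    unfold resPQ aP aQ eP eQ
    fun_prop
  have h2 : Continuous fun p : (ℝ × ℝ) × (ℝ × ℝ) =>
      trigFactor p.2.2 p.2.1 * Btilde α β (Real.cos p.2.2 ^ 2) (Real.cos p.2.1 ^ 2) := by
    unfold trigFactor Btilde
    fun_prop
  unfold eulerDelta Function.uncurry
  fun_prop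

section

variable {α β : Fin 3 → ℝ} {η : ℝ → ℝ} {g : ℝ × ℝ → ℝ}

theorem integrable_eulerDelta (hη : Continuous η) (ε : ℝ) (x : ℝ × ℝ) :
    Integrable (eulerDelta α β η ε x) (quadrant.prod quadrant) := by
  rw [quadrant_prod]
  have h : Continuous (eulerDelta α β η ε x) := (continuous_eulerDelta α β hη ε).uncurry_left x
  exact (h.continuousOn.integrableOn_compact (isCompact_Icc.prod isCompact_Icc)).mono_set
    (prod_mono Ioo_subset_Icc_self Ioo_subset_Icc_self)

theorem integrable_mul_eulerDelta (hη : Continuous η) (hg : Continuous g)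
    (hgc : HasCompactSupport g) (ε : ℝ) :
    Integrable (Function.uncurry fun x y => g x * eulerDelta α β η ε x y)
      (volume.prod (quadrant.prod quadrant)) := by
  have h : Continuous (Function.uncurry fun x y => g x * eulerDelta α β η ε x y) :=
    (hg.comp continuous_fst).mul (continuous_eulerDelta α β hη ε)
  have h1 : IntegrableOn (Function.uncurry fun x y => g x * eulerDelta α β η ε x y)
      (tsupport g ×ˢ univ) (volume.prod (quadrant.prod quadrant)) := by
    rw [IntegrableOn, ← Measure.prod_restrict, Measure.restrict_univ, quadrant_prod,
      Measure.prod_restrict, ← Measure.volume_eq_prod]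
    exact (h.continuousOn.integrableOn_compact
      (hgc.isCompact.prod (isCompact_Icc.prod isCompact_Icc))).mono_set
      (prod_mono le_rfl (prod_mono Ioo_subset_Icc_self Ioo_subset_Icc_self))
  refine (integrableOn_iff_integrable_of_support_subset fun p hp => ?_).1 h1
  exact ⟨subset_tsupport _ (left_ne_zero_of_mul hp), mem_univ _⟩

variable (hα : α 2 < α 1 ∧ α 1 < α 0) (hβ : β 2 < β 1 ∧ β 1 < β 0)
  (hα0 : α 0 + α 1 + α 2 = 0) (hβ0 : β 0 + β 1 + β 2 = 0)

include hα hβ hα0 hβ0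

/-- In angles `du dz` becomes `4 s dφ dψ`, which accounts for the factor `s` in `eulerDelta`. -/
theorem smoothedDelta_eq (hη : Continuous η) (ε : ℝ) (x : ℝ × ℝ) :
    smoothedDelta α β η ε x =
      4 * ∫ y, eulerDelta α β η ε x y ∂(quadrant.prod quadrant) := by
  rw [integral_prod _ (integrable_eulerDelta hη ε x), smoothedDelta, integral_comp_cos_sq,
    ← integral_const_mul]
  refine integral_congr_ae (ae_of_all _ fun ψ => ?_)
  simp only
  rw [integral_comp_cos_sq, ← integral_const_mul, ← integral_const_mul]
  refine integral_congr_ae (ae_of_all _ fun φ => ?_)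
  simp only [eulerDelta, trigFactor]
  rw [abs_of_pos (Btilde_pos hα hβ hα0 hβ0 (sq_nonneg _) (sq_nonneg _))]
  ring

theorem integral_mul_eulerDelta {ε : ℝ} (hε : 0 < ε) {y : ℝ × ℝ}
    (hy : y.1 ∈ Ioo 0 (Real.pi / 2) ∧ y.2 ∈ Ioo 0 (Real.pi / 2)) :
    ∫ x, g x * eulerDelta α β η ε x y =
      ∫ w : ℝ × ℝ, g (pencil α β (Real.cos y.2 ^ 2) (Real.cos y.1 ^ 2) (trigFactor y.2 y.1)
        (ε / (trigFactor y.2 y.1 * Btilde α β (Real.cos y.2 ^ 2) (Real.cos y.1 ^ 2)) ^ 2) w) *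
        η w.2 :=
  integral_delta_pencil hα hβ hα0 hβ0 (sq_nonneg _) (sq_nonneg _) (trigFactor_pos hy.2 hy.1)
    (trigFactor_sq _ _) hε g η

/-- After Fubini the integral over `(p, q)` at fixed angles is taken along the pencil, where it
converges to `∫ g(P(c), Q(c)) dc` under a bound that does not depend on the angles. -/
theorem tendsto_integral_mul_smoothedDelta (hη : Continuous η) (hc : HasCompactSupport η)
    (h1 : ∫ t, η t = 1) (hg : Continuous g) (hgc : HasCompactSupport g) :
    Tendsto (fun ε => ∫ x, g x * smoothedDelta α β η ε x) (𝓝[>] 0)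
      (𝓝 (4 * ∫ y, (∫ c, g (eulerPQ α β ((y.2, c), y.1))) ∂(quadrant.prod quadrant))) := by
  obtain ⟨G, hG⟩ := hg.bounded_above_of_compact_support hgc
  obtain ⟨M, hM0, hM⟩ : ∃ M, 0 ≤ M ∧
      ∀ x, g x ≠ 0 → |lowSum α β ^ 3 + x.1 * lowSum α β + x.2| ≤ M := by
    obtain ⟨M, hM⟩ := hgc.isCompact.exists_bound_of_continuousOn (f := fun x : ℝ × ℝ =>
      lowSum α β ^ 3 + x.1 * lowSum α β + x.2) (Continuous.continuousOn (by fun_prop))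
    exact ⟨max M 0, le_max_right _ _, fun x hx =>
      (hM x (subset_tsupport _ hx)).trans (le_max_left _ _)⟩
  have key : ∀ ε > 0, ∫ x, g x * smoothedDelta α β η ε x =
      4 * ∫ y, (∫ x, g x * eulerDelta α β η ε x y) ∂(quadrant.prod quadrant) := by
    intro ε hε
    have e : ∀ x, g x * smoothedDelta α β η ε x =
        4 * ∫ y, g x * eulerDelta α β η ε x y ∂(quadrant.prod quadrant) := fun x => by
      rw [smoothedDelta_eq hα hβ hα0 hβ0 hη, integral_const_mul]
      ring
    simp_rw [e]
    rw [integral_const_mul]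
    have h := integrable_mul_eulerDelta (α := α) (β := β) hη hg hgc ε
    have hsw := integral_integral_swap (f := fun x y => g x * eulerDelta α β η ε x y) h
    rw [hsw]
  refine Tendsto.congr' (f₁ := fun ε => 4 * ∫ y, (∫ x, g x * eulerDelta α β η ε x y)
    ∂(quadrant.prod quadrant)) ?_ (Tendsto.const_mul 4 ?_)
  · filter_upwards [self_mem_nhdsWithin] with ε hε
    exact (key ε hε).symm
  refine tendsto_integral_filter_of_dominated_convergence
    (fun _ => (∫ t, |η t|) * (G * (2 * Real.sqrt (2 * (M / kfun α β 0 0))))) ?_ ?_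
    (integrable_const _) ?_
  · exact Eventually.of_forall fun ε =>
      (integrable_mul_eulerDelta hη hg hgc ε).integral_prod_right.aestronglyMeasurable
  · filter_upwards [self_mem_nhdsWithin] with ε hε
    filter_upwards [ae_quadrant_prod] with y hy
    rw [integral_mul_eulerDelta hα hβ hα0 hβ0 hε hy, Real.norm_eq_abs]
    exact abs_integral_pencil_le hα hβ hα0 hβ0 hη hc hM0 hM hg hG (sq_nonneg _) (sq_nonneg _)
  · filter_upwards [ae_quadrant_prod] with y hy
    have h := tendsto_integral_pencil hα hβ hα0 hβ0 hη hc h1 hM hg hG (sq_nonneg (Real.cos y.2))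
      (sq_nonneg (Real.cos y.1)) (s := trigFactor y.2 y.1)
      (sq_nonneg (trigFactor y.2 y.1 * Btilde α β (Real.cos y.2 ^ 2) (Real.cos y.1 ^ 2)))
    refine Tendsto.congr' ?_ h
    filter_upwards [self_mem_nhdsWithin] with ε hε
    exact (integral_mul_eulerDelta hα hβ hα0 hβ0 hε hy).symm

variable [MeasurableSpace SO3] [BorelSpace SO3] (μ : Measure SO3) [μ.IsHaarMeasure]
  [IsProbabilityMeasure μ]

/-- `hs` confines `c` to `(-1, 1)`, where `map_PQ_eq` applies; the constant is `4 * (π² / 2)`. -/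
theorem integral_eulerPQ (hg : Continuous g) (hgc : HasCompactSupport g)
    (hs : ∀ x, g x ≠ 0 → lowSum α β ^ 3 + x.1 * lowSum α β + x.2 < 0) :
    4 * ∫ y, (∫ c, g (eulerPQ α β ((y.2, c), y.1))) ∂(quadrant.prod quadrant) =
      2 * Real.pi ^ 2 * ∫ M, g (PQ α β M) ∂μ := by
  obtain ⟨G, hG⟩ := hg.bounded_above_of_compact_support hgc
  set τ : Measure ℝ := volume.restrict (Ioo (-1) 1) with hτ
  have : IsFiniteMeasure τ := isFiniteMeasure_restrict.2 (by simp)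
  have hf : Continuous fun w => g (eulerPQ α β w) := hg.comp (continuous_eulerPQ α β)
  have h1 : ∀ y : ℝ × ℝ, ∫ c, g (eulerPQ α β ((y.2, c), y.1)) =
      ∫ c, g (eulerPQ α β ((y.2, c), y.1)) ∂τ := by
    intro y
    refine (setIntegral_eq_integral_of_forall_compl_eq_zero fun c hc => ?_).symm
    by_contra h
    exact hc (abs_lt.1 (abs_cos_lt_one hα hβ hα0 hβ0 (hs _ h) (sq_nonneg (Real.cos y.2))
      (sq_nonneg (Real.cos y.1)) (s := trigFactor y.2 y.1) rfl rfl))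
  simp_rw [h1]
  have hE : (volume.restrict eulerDomain : Measure ((ℝ × ℝ) × ℝ)) =
      (quadrant.prod τ).prod quadrant := by
    rw [eulerDomain, quadrant, hτ, Measure.prod_restrict, Measure.prod_restrict,
      Measure.volume_eq_prod, Measure.volume_eq_prod]
  have hb : ∀ w, ‖g (eulerPQ α β w)‖ ≤ G := fun w => hG _
  have h2 : ∫ M, g (PQ α β M) ∂μ =
      2 / Real.pi ^ 2 * ∫ w, g (eulerPQ α β w) ∂((quadrant.prod τ).prod quadrant) := by
    rw [← integral_map (continuous_PQ α β).measurable.aemeasurable hg.aestronglyMeasurable,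
      map_PQ_eq μ hα0 hβ0, integral_smul_measure,
      integral_map (continuous_eulerPQ α β).measurable.aemeasurable hg.aestronglyMeasurable, hE,
      ENNReal.toReal_ofReal (by positivity), smul_eq_mul]
  have h3 : ∫ w, g (eulerPQ α β w) ∂((quadrant.prod τ).prod quadrant) =
      ∫ y, (∫ c, g (eulerPQ α β ((y.2, c), y.1)) ∂τ) ∂(quadrant.prod quadrant) := by
    rw [integral_prod_symm _ (Integrable.of_bound hf.aestronglyMeasurable G (ae_of_all _ hb)),
      integral_prod]
    · refine integral_congr_ae (ae_of_all _ fun ψ => ?_)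
      simp only
      rw [integral_prod]
      refine Integrable.of_bound (Continuous.aestronglyMeasurable ?_) G (ae_of_all _ fun w => hb _)
      exact hf.comp (by fun_prop : Continuous fun w : ℝ × ℝ => (w, ψ))
    · have hsm : StronglyMeasurable (Function.uncurry fun (y : ℝ × ℝ) (c : ℝ) =>
          g (eulerPQ α β ((y.2, c), y.1))) :=
        (hf.comp (by fun_prop : Continuous fun p : (ℝ × ℝ) × ℝ =>
          ((p.1.2, p.2), p.1.1))).stronglyMeasurable
      refine Integrable.of_bound hsm.integral_prod_right.aestronglyMeasurable (G * τ.real univ)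
        (ae_of_all _ fun y => ?_)
      exact norm_integral_le_of_norm_le_const (ae_of_all _ fun c => hb _)
  rw [h2, h3]
  field_simp
  ring

/-- The pointwise limit `J` of the smoothed integrals and `2π²` times the density have the same
integral against every smooth function supported in the open generic set, so they agree there almost
everywhere. One bump and one sequence of `ε` suffice, since the limit depends on neither. -/
theorem exists_delta_pdf : ∀ᵐ x : ℝ × ℝ, x ∈ genericSet α β →
    ∃ I : ℝ, IsDeltaIntegral (fun u z => |Btilde α β u z|) (resPQ α β x.1 x.2) I ∧
      pdf (PQ α β) μ volume x = ENNReal.ofReal (1 / (2 * Real.pi ^ 2) * I) := by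
  have hpdf := hasPDF_PQ hα hβ hα0 hβ0 μ
  obtain ⟨η, hη, hc, h1⟩ : ∃ η : ℝ → ℝ, Continuous η ∧ HasCompactSupport η ∧ ∫ t, η t = 1 := by
    let f : ContDiffBump (0 : ℝ) := default
    exact ⟨f.normed volume, f.continuous_normed, f.hasCompactSupport_normed, f.integral_normed⟩
  classical
  choose I hI using fun x : genericSet α β => exists_isDeltaIntegral hα hβ hα0 hβ0 x.2
  set J : ℝ × ℝ → ℝ := fun x => if h : x ∈ genericSet α β then I ⟨x, h⟩ else 0 with hJ
  have hJI : ∀ x ∈ genericSet α β,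
      IsDeltaIntegral (fun u z => |Btilde α β u z|) (resPQ α β x.1 x.2) (J x) := by
    intro x hx
    rw [hJ]
    simp only [hx, dite_true]
    exact hI ⟨x, hx⟩
  obtain ⟨ε, -, hε0, hε⟩ := exists_seq_strictAnti_tendsto' (zero_lt_one' ℝ)
  have hεG : Tendsto ε atTop (𝓝[>] 0) := tendsto_nhdsWithin_iff.2
    ⟨hε, Eventually.of_forall fun n => (hε0 n).1⟩
  have hlim : ∀ x ∈ genericSet α β,
      Tendsto (fun n => smoothedDelta α β η (ε n) x) atTop (𝓝 (J x)) := fun x hx =>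
    (hJI x hx η hη hc h1).comp hεG
  have hGm : MeasurableSet (genericSet α β) := (isOpen_genericSet α β).measurableSet
  have hJm : AEStronglyMeasurable J (volume.restrict (genericSet α β)) :=
    aestronglyMeasurable_of_tendsto_ae atTop
      (fun n => (continuous_smoothedDelta hη (ε n)).aestronglyMeasurable)
      (by filter_upwards [ae_restrict_mem hGm] with x hx using hlim x hx)
  -- The bounds uniform in `ε` on compact sets make `J` locally integrable and dominate the passage
  -- to the limit under the integral with `g`.
  have hbound : ∀ K ⊆ genericSet α β, IsCompact K → ∃ D, (∀ n, ∀ x ∈ K,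
      |smoothedDelta α β η (ε n) x| ≤ D) ∧ ∀ x ∈ K, |J x| ≤ D := by
    intro K hK hKc
    obtain ⟨D, hD⟩ := exists_bound_smoothedDelta hα hβ hα0 hβ0 hη hc h1 hKc hK
    exact ⟨D, fun n x hx => hD x hx _ (hε0 n).1, fun x hx =>
      le_of_tendsto (hlim x (hK hx)).abs (Eventually.of_forall fun n => hD x hx _ (hε0 n).1)⟩
  have hJloc : LocallyIntegrableOn J (genericSet α β) := by
    rw [locallyIntegrableOn_iff (isOpen_genericSet α β).isLocallyClosed]
    intro K hK hKc
    obtain ⟨D, -, hD⟩ := hbound K hK hKc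
    have : IsFiniteMeasure (volume.restrict K) := isFiniteMeasure_restrict.2 hKc.measure_lt_top.ne
    exact Integrable.of_bound (hJm.mono_measure (Measure.restrict_mono hK le_rfl)) D
      (by filter_upwards [ae_restrict_mem hKc.measurableSet] with x hx using hD x hx)
  have hpint : Integrable fun x => (pdf (PQ α β) μ volume x).toReal :=
    integrable_toReal_of_lintegral_ne_top (measurable_pdf _ _ _).aemeasurable (by
      rw [pdf.lintegral_eq_measure_univ]
      exact measure_ne_top _ _)
  have hzero := IsOpen.ae_eq_zero_of_integral_contDiff_smul_eq_zero (isOpen_genericSet α β)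
    (μ := volume) (f := fun x => J x - 2 * Real.pi ^ 2 * (pdf (PQ α β) μ volume x).toReal)
    (hJloc.sub ((hpint.const_mul _).locallyIntegrable.locallyIntegrableOn _)) (by
      intro g hg hgc hgs
      have hgcont := hg.continuous
      obtain ⟨D, hD, hDJ⟩ := hbound _ hgs hgc.isCompact
      have hgi : Integrable g := hgcont.integrable_of_hasCompactSupport hgc
      have hlimg : Tendsto (fun n => ∫ x, g x * smoothedDelta α β η (ε n) x) atTop
          (𝓝 (∫ x, g x * J x)) := by
        refine tendsto_integral_of_dominated_convergence (fun x => D * |g x|) (fun n => ?_)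
          (hgi.abs.const_mul D) (fun n => ae_of_all _ fun x => ?_) (ae_of_all _ fun x => ?_)
        · exact (hgcont.mul (continuous_smoothedDelta hη (ε n))).aestronglyMeasurable
        · by_cases h : g x = 0
          · simp [h]
          · rw [norm_mul, mul_comm]
            exact mul_le_mul_of_nonneg_right (hD n x (subset_tsupport _ h)) (abs_nonneg _)
        · by_cases h : g x = 0
          · simp [h]
          · exact (hlim x (hgs (subset_tsupport _ h))).const_mul _
      have hlim2 := (tendsto_integral_mul_smoothedDelta hα hβ hα0 hβ0 hη hc h1 hgcont hgc).comp hεG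
      rw [integral_eulerPQ hα hβ hα0 hβ0 μ hgcont hgc fun x hx =>
        (hgs (subset_tsupport _ hx)).1] at hlim2
      have heq := tendsto_nhds_unique hlimg hlim2
      rw [← pdf.integral_pdf_smul (μ := volume) hgcont.aestronglyMeasurable] at heq
      have hgJ : Integrable fun x => g x * J x := by
        obtain ⟨G, hG⟩ := hgcont.bounded_above_of_compact_support hgc
        have hon : IntegrableOn (fun x => g x * J x) (tsupport g) :=
          (hJloc.integrableOn_compact_subset hgs hgc.isCompact).bdd_mul
            hgcont.aestronglyMeasurable (ae_of_all _ hG)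
        exact (integrableOn_iff_integrable_of_support_subset fun x (hx : g x * J x ≠ 0) =>
          subset_tsupport _ (left_ne_zero_of_mul hx)).1 hon
      have hgp : Integrable fun x => (pdf (PQ α β) μ volume x).toReal • g x := by
        obtain ⟨G, hG⟩ := hgcont.bounded_above_of_compact_support hgc
        exact hpint.mul_bdd hgcont.aestronglyMeasurable (ae_of_all _ hG)
      rw [← integral_const_mul, ← sub_eq_zero, ← integral_sub hgJ (hgp.const_mul _)] at heq
      rw [← heq]
      refine integral_congr_ae (ae_of_all _ fun x => ?_)
      simp only [smul_eq_mul]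
      ring)
  filter_upwards [hzero, pdf.ofReal_toReal_ae_eq (X := PQ α β) (ℙ := μ) (μ := volume)] with x h0 h2 hx
  refine ⟨J x, hJI x hx, ?_⟩
  rw [← h2]
  congr 1
  have := h0 hx
  field_simp
  linarith

end

end

end

end HornReal

theorem mainTheorem1 (α β : Fin 3 → ℝ)
    (hα : α 2 < α 1 ∧ α 1 < α 0) (hβ : β 2 < β 1 ∧ β 1 < β 0)
    (hα0 : α 0 + α 1 + α 2 = 0) (hβ0 : β 0 + β 1 + β 2 = 0)
    [MeasurableSpace HornReal.SO3] [BorelSpace HornReal.SO3]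
    (μ : Measure HornReal.SO3) [μ.IsHaarMeasure] [IsProbabilityMeasure μ] :
    -- `det (z - C) = z ^ 3 + P z + Q`
    (∀ M : HornReal.SO3, (HornReal.sumMatrix α β M.1).charpoly =
      X ^ 3 + C (HornReal.coeffP α β M.1) * X + C (HornReal.coeffQ α β M.1)) ∧
    -- in Euler angles, `P - p` and `Q - q` are the quadratics `P_p`, `Q_q` at `c = cos θ`
    (∀ p q φ θ ψ : ℝ,
      HornReal.coeffP α β (HornReal.rotZ φ * HornReal.rotY θ * HornReal.rotZ ψ) - p
          = (HornReal.quadP α β p φ ψ).eval (Real.cos θ) ∧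
      HornReal.coeffQ α β (HornReal.rotZ φ * HornReal.rotY θ * HornReal.rotZ ψ) - q
          = (HornReal.quadQ α β q φ ψ).eval (Real.cos θ)) ∧
    -- `R` is the resultant in `c` of `P_p` and `Q_q`
    (∀ p q φ ψ : ℝ,
      Polynomial.resultant (HornReal.quadP α β p φ ψ) (HornReal.quadQ α β q φ ψ) 2 2
        = HornReal.resPQ α β p q (Real.cos φ ^ 2) (Real.cos ψ ^ 2)) ∧
    -- `P_p` takes the values `A ± B √Δ_Q` at the roots of `Q_q`, where
    -- `2 a² B = cos φ cos ψ sin φ sin ψ B̃`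
    (∀ p q φ ψ a B : ℝ, a = HornReal.aQ α β (Real.cos φ ^ 2) (Real.cos ψ ^ 2) → a ≠ 0 →
      0 ≤ HornReal.discrQ α β q φ ψ →
      2 * a ^ 2 * B = HornReal.trigFactor φ ψ *
        HornReal.Btilde α β (Real.cos φ ^ 2) (Real.cos ψ ^ 2) →
      ∃ A : ℝ,
        (HornReal.quadP α β p φ ψ).eval
            ((-(HornReal.trigFactor φ ψ * HornReal.bQ α β)
              + Real.sqrt (HornReal.discrQ α β q φ ψ)) / (2 * a))
          = A + B * Real.sqrt (HornReal.discrQ α β q φ ψ) ∧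
        (HornReal.quadP α β p φ ψ).eval
            ((-(HornReal.trigFactor φ ψ * HornReal.bQ α β)
              - Real.sqrt (HornReal.discrQ α β q φ ψ)) / (2 * a))
          = A - B * Real.sqrt (HornReal.discrQ α β q φ ψ)) ∧
    -- `(P, Q)` has a joint density `ρ`
    HasPDF (HornReal.PQ α β) μ volume ∧
    -- `ρ` vanishes outside the support
    (∀ᵐ x : ℝ × ℝ, x ∉ range (HornReal.PQ α β) → pdf (HornReal.PQ α β) μ volume x = 0) ∧
    -- `ρ = (1 / 2π²) ∫₀¹ dz ∫₀¹ du |B̃| δ(R)` on the support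
    (∀ᵐ x : ℝ × ℝ, x ∈ range (HornReal.PQ α β) →
      ∃ I : ℝ, HornReal.IsDeltaIntegral (fun u z => |HornReal.Btilde α β u z|)
          (HornReal.resPQ α β x.1 x.2) I ∧
        pdf (HornReal.PQ α β) μ volume x = ENNReal.ofReal (1 / (2 * Real.pi ^ 2) * I)) ∧
    -- `ρ = (1 / 2π²) ∫₀¹ dz ∑ᵢ |B̃(uᵢ, z)| / |R'_u(uᵢ, z)|` on the support
    (∀ᵐ x : ℝ × ℝ, x ∈ range (HornReal.PQ α β) →
      pdf (HornReal.PQ α β) μ volume x = HornReal.rootIntegral α β x.1 x.2) ∧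
    -- `(γ₁, γ₂)` has the density `|Δ(γ)| ρ(p, q)` on `γ₁ ≥ γ₂ ≥ γ₃`, and `0` elsewhere
    HasPDF (HornReal.topEigenvalues α β) μ volume ∧
    (∀ᵐ g : ℝ × ℝ, ∀ g₃ : ℝ, g₃ = -g.1 - g.2 →
      (g₃ ≤ g.2 ∧ g.2 ≤ g.1 →
        pdf (HornReal.topEigenvalues α β) μ volume g =
          ENNReal.ofReal |(g.1 - g.2) * (g.1 - g₃) * (g.2 - g₃)| *
            pdf (HornReal.PQ α β) μ volume
              (g.1 * g.2 + g.2 * g₃ + g₃ * g.1, -(g.1 * g.2 * g₃))) ∧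
      (¬ (g₃ ≤ g.2 ∧ g.2 ≤ g.1) →
        pdf (HornReal.topEigenvalues α β) μ volume g = 0)) := by
  have hPQ := HornReal.hasPDF_PQ hα hβ hα0 hβ0 μ
  have htop := HornReal.hasPDF_topEigenvalues hα0 hβ0 μ
  refine ⟨HornReal.sumMatrix_charpoly α β hα0 hβ0, fun p q φ θ ψ => ⟨?_, ?_⟩,
    HornReal.resultant_quadP_quadQ α β, HornReal.exists_quadP_eval_roots α β, hPQ,
    HornReal.pdf_PQ_eq_zero hα hβ hα0 hβ0 μ, ?_, HornReal.pdf_PQ_eq_rootIntegral hα hβ hα0 hβ0 μ,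
    htop.1, htop.2⟩
  · rw [HornReal.coeffP_euler α β hα0 hβ0, HornReal.quadP_eval]
  · rw [HornReal.coeffQ_euler α β hα0 hβ0, HornReal.quadQ_eval]
  · filter_upwards [HornReal.ae_mem_genericSet hα hβ hα0 hβ0,
      HornReal.exists_delta_pdf hα hβ hα0 hβ0 μ] with x h1 h2 hx
    exact h2 (h1 hx)
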